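/- **Setting.** A $*$-test graph $T=(V,E,\gamma,\varepsilon)$ in variables $(x_l)_{l\in L}$ is a finite connected oriented multigraph (loops and multiple edges allowed) whose edges $e$ carry labels $x_{\gamma(e)}^{\varepsilon(e)}$, $\gamma(e)\in L$, $\varepsilon(e)\in\{1,*\}$. It is *cyclic* if some closed walk visits every edge exactly once in the sense of its orientation. For a family $\mathbf A=(A_l)_{l\in L}$ of $N\times N$ matrices put $$\tau_N[T(\mathbf A)]=\frac1N\sum_{\phi:V\to\{1,\dots,N\}}\ \prod_{e=(v,w)\in E}A_{\gamma(e)}^{\varepsilon(e)}(\phi(v),\phi(w)),$$ and let $\tau^0_N[T(\mathbf A)]$ be the same sum restricted to injective $\phi$. For a partition $\pi$ of $V$, $T^\pi$ is obtained from $T$ by identifying the vertices in a same block. Let $\mathfrak r(T)$ be the number of leaves of the tree of two-edge connected components of $T$ (vertices: the components left after removing all cutting edges; edges: the cutting edges), with $\mathfrak r(T)=2$ when this tree is a single vertex. A sequence of $N\times N$ random matrices $X_N$ is a *heavy Wigner matrix* with parameter $(a_k)_{k\ge1}$, $a_k\in\mathbb R$, if almost surely $X_N=X_N^*$; the entries on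 and below the diagonal are independent and centered; the diagonal, respectively strictly sub-diagonal, entries of $\sqrt N X_N$ have a common law $\nu_N$ on $\mathbb R$, respectively $\mu_N$ on $\mathbb C$, with $\mu_N$ invariant under complex conjugation; $\mu_N,\nu_N$ have all moments; and for every $k\ge1$, as $N\to\infty$, $N^{-(k-1)}\int|z|^{2k}\,d\mu_N(z)\to a_k$ and $N^{-(k-1)}\int t^{2k}\,d\nu_N(t)=O(1)$. **Theorem.** Let $X_1,\dots,X_p$ be independent heavy Wigner matrices, $X_j$ with parameter $(a_{j,k})_{k\ge1}$, and let $\mathbf Y_N=(Y_1,\dots,Y_q)$ be a family of $N\times N$ random matrices independent of $\mathbf X_N=(X_1,\dots,X_p)$, whose entries have all moments, such that: 1. for every cyclic $*$-test graph $T$ in $\mathbf y=(y_1,\dots,y_q)$, $\mathbb E\,\tau^0_N[T(\mathbf Y_N)]$ converges to a limit $\tau^0_{\mathbf Y}[T]$; 2. for all cyclic $*$-test graphs $T_1,\dots,T_n$, $\mathbb E\prod_i\tau^0_N[T_i(\mathbf Y_N)]-\prod_i\mathbb E\,\tau^0_N[T_i(\mathbf Y_N)]\to0$; 3. for all (not necessarily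 cyclic) $*$-test graphs $T_1,\dots,T_n$, $\mathbb E\prod_i\tau^0_N[T_i(\mathbf Y_N)]=O\big(N^{\sum_{i=1}^n(\mathfrak r(T_i)/2-1)}\big)$. For a cyclic $*$-test graph $T$ in $x_1,\dots,x_p,\mathbf y$, let its *pieces* be the connected components, having at least one edge, of the subgraphs formed by the edges labelled in a same family among $(x_1),\dots,(x_p),(y_1,\dots,y_q)$. Let $G_{red}(T)$ be the graph whose vertices are the pieces and the vertices of $T$ belonging to at least two pieces, a piece being adjacent to the latter vertices that it contains. Say that $T$ is a *free product* if $G_{red}(T)$ is a tree (or if $T$ has no edge). Define $$\tau^0[T]=\prod_{S\text{ piece of }T}\tau^0_S\ \text{ if } T \text{ is a free product},\qquad \tau^0[T]=0\ \text{ otherwise,}$$ where $\tau^0_S=\tau^0_{\mathbf Y}[S]$ for a piece $S$ labelled in $\mathbf y$, and for a piece $S$ labelled by $x_j$, $\tau^0_S=\prod_{k\ge1}a_{j,k}^{q_k}$ if $S$ is a fat tree (it becomes a tree when multiplicities and orientations of its edges are forgotten) with exactly $q_k$ undirected edges of multiplicity $2k$ for each $k$ and none of odd multiplicity, and $\tau^0_S=0$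 otherwise. Then $(\mathbf X_N,\mathbf Y_N)$ has a limiting $*$-distribution: all its entries have all moments, and for every noncommutative $*$-polynomial $P$, $\mathbb E\big[\frac1N\mathrm{Tr}\,P(\mathbf X_N,\mathbf Y_N)\big]$ converges to a limit $\Phi(P)$. The limit is given by the traffic-free product: for every cyclic $*$-test graph $T$ in $x_1,\dots,x_p,\mathbf y$, $$\mathbb E\,\tau^0_N[T(\mathbf X_N,\mathbf Y_N)]\to\tau^0[T],\qquad \mathbb E\,\tau_N[T(\mathbf X_N,\mathbf Y_N)]\to\sum_{\pi\in\mathcal P(V)}\tau^0[T^\pi],$$ and $\Phi$ is the linear functional with $\Phi(P)=\sum_{\pi}\tau^0[T_P^\pi]$ for every $*$-monomial $P$, where $T_P$ is the oriented simple cycle whose successive edges are labelled by the letters of $P$ (a single vertex if $P=1$). In particular $\Phi$ depends only on the parameters $(a_{j,k})$ and on $\tau^0_{\mathbf Y}$ on cyclic $*$-test graphs. -/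

import Mathlib

open MeasureTheory ProbabilityTheory Filter Topology

/-- A finite oriented multigraph (loops and multiple edges allowed) whose edges `e` carry a label
`x_{var e}` (when `star e = false`) or `x_{var e}^*` (when `star e = true`), with variables
indexed by `L`.  Connectedness is the separate predicate `StarGraph.IsTestGraph`. -/
structure StarGraph (L : Type*) where
  V : Type
  E : Type
  [fintypeV : Fintype V]
  [fintypeE : Fintype E]
  src : E → V
  tgt : E → V
  var : E → L
  star : E → Bool

attribute [instance] StarGraph.fintypeV StarGraph.fintypeE

/-- The matrix `M` (for `false`) or its conjugate transpose `M^*` (for `true`). -/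
def starPow {N : ℕ} (M : Matrix (Fin N) (Fin N) ℂ) (s : Bool) : Matrix (Fin N) (Fin N) ℂ :=
  if s then M.conjTranspose else M

namespace StarGraph

/-- The simple graph on the vertices of `T` obtained from the edges of `T` that belong to `S`,
forgetting labels, orientations, multiplicities and loops. -/
def skeleton {L : Type*} (T : StarGraph L) (S : Set T.E) : SimpleGraph T.V :=
  SimpleGraph.fromRel fun v w => ∃ e ∈ S, T.src e = v ∧ T.tgt e = w

/-- A `*`-test graph is a connected labelled graph (in particular it has a vertex). -/
def IsTestGraph {L : Type*} (T : StarGraph L) : Prop := (T.skeleton Set.univ).Connected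

/-- A `*`-test graph is cyclic when a closed walk visits each edge exactly once, in the sense of
its orientation.  The graph with one vertex and no edge is cyclic. -/
def IsCyclic {L : Type*} (T : StarGraph L) : Prop :=
  T.IsTestGraph ∧
    ∃ c : Fin (Fintype.card T.E) ≃ T.E, ∀ i, T.tgt (c i) = T.src (c (finRotate _ i))

/-- Change the variables of a labelled graph. -/
def relabel {L L' : Type*} (f : L → L') (T : StarGraph L) : StarGraph L' where
  V := T.V
  E := T.E
  src := T.src
  tgt := T.tgt
  var e := f (T.var e)
  star := T.star

/-! ### Traces -/

/-- `∏_{e ∈ E} A_{γ(e)}^{ε(e)}(φ(e))` for a map `φ` from the vertices to the indices. -/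
noncomputable def weight {L : Type*} {N : ℕ} (T : StarGraph L)
    (A : L → Matrix (Fin N) (Fin N) ℂ) (φ : T.V → Fin N) : ℂ :=
  ∏ e : T.E, starPow (A (T.var e)) (T.star e) (φ (T.src e)) (φ (T.tgt e))

open Classical in
/-- The trace `τ_N[T(A)]`: sum over all maps `V → {1, …, N}`, divided by `N`. -/
noncomputable def trace {L : Type*} {N : ℕ} (T : StarGraph L)
    (A : L → Matrix (Fin N) (Fin N) ℂ) : ℂ :=
  (N : ℂ)⁻¹ * ∑ φ : T.V → Fin N, T.weight A φ

open Classical in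
/-- The injective trace `τ⁰_N[T(A)]`: sum over all injective maps `V → {1, …, N}`,
divided by `N`. -/
noncomputable def injTrace {L : Type*} {N : ℕ} (T : StarGraph L)
    (A : L → Matrix (Fin N) (Fin N) ℂ) : ℂ :=
  (N : ℂ)⁻¹ * ∑ φ : T.V ↪ Fin N, T.weight A φ

/-! ### Quotients by partitions of the vertices -/

open Classical in
/-- The graph `T^π` obtained by identifying the vertices in a same block of the partition `π`. -/
noncomputable def quot {L : Type*} (T : StarGraph L) (π : Setoid T.V) : StarGraph L where
  V := Quotient π
  E := T.E
  fintypeV := Fintype.ofFinite _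
  src e := Quotient.mk π (T.src e)
  tgt e := Quotient.mk π (T.tgt e)
  var := T.var
  star := T.star

/-- A finite type has finitely many partitions. -/
instance finiteSetoid {V : Type*} [Finite V] : Finite (Setoid V) :=
  Finite.of_injective (fun (π : Setoid V) (v w : V) => π v w)
    fun _ _ h => Setoid.ext fun v w => iff_of_eq (congrFun (congrFun h v) w)

noncomputable instance fintypeSetoid {V : Type*} [Finite V] : Fintype (Setoid V) :=
  Fintype.ofFinite _

/-- The functional `τ[T] = ∑_π τ⁰[T^π]` (sum over all partitions of the vertices of `T`) whose
injective version is `τ⁰`. -/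
noncomputable def plainOfInj {L : Type*} (τ0 : StarGraph L → ℂ) (T : StarGraph L) : ℂ :=
  ∑ π : Setoid T.V, τ0 (T.quot π)

/-! ### The number of leaves of the tree of two-edge connected components -/

/-- The cutting edges: those whose removal disconnects the graph. -/
def cutEdges {L : Type*} (T : StarGraph L) : Set T.E :=
  {e | ¬ (T.skeleton {e}ᶜ).Connected}

/-- The two-edge connected components: what remains connected after removing all cutting edges. -/
abbrev TwoEdgeComponent {L : Type*} (T : StarGraph L) : Type :=
  (T.skeleton T.cutEdgesᶜ).ConnectedComponent

/-- The tree of two-edge connected components: distinct components are adjacent when a cutting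
edge joins them. -/
def componentTree {L : Type*} (T : StarGraph L) : SimpleGraph T.TwoEdgeComponent :=
  SimpleGraph.fromRel fun c d => ∃ e ∈ T.cutEdges,
    (T.skeleton T.cutEdgesᶜ).connectedComponentMk (T.src e) = c ∧
      (T.skeleton T.cutEdgesᶜ).connectedComponentMk (T.tgt e) = d

open Classical in
/-- The number `𝔯(T)` of leaves of the tree of two-edge connected components, the trivial tree
having two leaves by convention. -/
noncomputable def numLeaves {L : Type*} (T : StarGraph L) : ℕ :=
  if Subsingleton T.TwoEdgeComponent then 2
  else {c : T.TwoEdgeComponent | (T.componentTree.neighborSet c).ncard = 1}.ncard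

/-! ### The traffic-free product

`fam : L → C` distributes the variables into families indexed by `C`. -/

/-- Two edges belong to the same piece when their variables are in the same family and they are
connected to each other through edges of that family. -/
def pieceSetoid {L C : Type*} (fam : L → C) (T : StarGraph L) : Setoid T.E where
  r e e' := fam (T.var e) = fam (T.var e') ∧
    (T.skeleton {f | fam (T.var f) = fam (T.var e)}).Reachable (T.src e) (T.src e')
  iseqv :=
    { refl := fun _ => ⟨rfl, SimpleGraph.Reachable.refl _⟩
      symm := fun h => ⟨h.1.symm, by rw [← h.1]; exact h.2.symm⟩
      trans := fun h h' => ⟨h.1.trans h'.1, h.2.trans (by rw [h.1]; exact h'.2)⟩ }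

/-- The connected components of `T` labelled by variables of a same family (those with at least
one edge). -/
abbrev Piece {L C : Type*} (fam : L → C) (T : StarGraph L) : Type :=
  Quotient (T.pieceSetoid fam)

/-- The family of the labels of a piece. -/
def pieceFamily {L C : Type*} (fam : L → C) (T : StarGraph L) (k : T.Piece fam) : C :=
  Quotient.lift (s := T.pieceSetoid fam) (fun e => fam (T.var e)) (fun _ _ h => And.left h) k

/-- The vertices of a piece: the end points of its edges. -/
def pieceVerts {L C : Type*} (fam : L → C) (T : StarGraph L) (k : T.Piece fam) : Set T.V :=
  {v | ∃ e, (Quotient.mk (T.pieceSetoid fam) e : T.Piece fam) = k ∧ (T.src e = v ∨ T.tgt e = v)}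

open Classical in
/-- A piece as a labelled graph in the variables of its family. -/
noncomputable def pieceGraph {L C : Type*} (fam : L → C) (T : StarGraph L) (k : T.Piece fam) :
    StarGraph {l : L // fam l = T.pieceFamily fam k} where
  V := T.pieceVerts fam k
  E := {e : T.E // (Quotient.mk (T.pieceSetoid fam) e : T.Piece fam) = k}
  fintypeV := Fintype.ofFinite _
  fintypeE := Fintype.ofFinite _
  src e := ⟨T.src e.1, e.1, e.2, Or.inl rfl⟩
  tgt e := ⟨T.tgt e.1, e.1, e.2, Or.inr rfl⟩
  var e := ⟨T.var e.1, congrArg (T.pieceFamily fam) e.2⟩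
  star e := T.star e.1

/-- The graph `G_red(T)`: its vertices are the pieces of `T` and the vertices of `T` common to
several pieces; a piece is adjacent to the latter vertices that it contains. -/
def reducedGraph {L C : Type*} (fam : L → C) (T : StarGraph L) :
    SimpleGraph (T.Piece fam ⊕
      {v : T.V // ∃ k k' : T.Piece fam, k ≠ k' ∧ v ∈ T.pieceVerts fam k ∧
        v ∈ T.pieceVerts fam k'}) :=
  SimpleGraph.fromRel fun x y =>
    match x, y with
    | Sum.inl k, Sum.inr v => v.1 ∈ T.pieceVerts fam k
    | _, _ => False

/-- `T` is a free product when `G_red(T)` is a tree.  (Preconnectedness is used in order to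
accept the empty graph `G_red(T)`, which arises exactly when `T` has no edge.) -/
def IsFreeProduct {L C : Type*} (fam : L → C) (T : StarGraph L) : Prop :=
  (T.reducedGraph fam).Preconnected ∧ (T.reducedGraph fam).IsAcyclic

open Classical in
/-- The (injective) traffic-free product of the injective distributions of traffics `μ c` of the
families `c : C`: the product over the pieces if `T` is a free product, and zero otherwise. -/
noncomputable def trafficFreeProduct {L C : Type*} (fam : L → C)
    (μ : (c : C) → StarGraph {l : L // fam l = c} → ℂ) (T : StarGraph L) : ℂ :=
  if T.IsFreeProduct fam then
    ∏ k : T.Piece fam, μ (T.pieceFamily fam k) (T.pieceGraph fam k)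
  else 0

/-! ### Fat trees -/

/-- A fat tree becomes a tree when multiplicities and orientations of its edges are forgotten;
in particular it has no loop. -/
def IsFatTree {L : Type*} (T : StarGraph L) : Prop :=
  (∀ e, T.src e ≠ T.tgt e) ∧ (T.skeleton Set.univ).IsTree

/-- The number of edges of `T` joining the two ends of `s`, in any direction. -/
noncomputable def edgeMultiplicity {L : Type*} (T : StarGraph L) (s : Sym2 T.V) : ℕ :=
  {e : T.E | s(T.src e, T.tgt e) = s}.ncard

open Classical in
/-- The limiting injective distribution of traffics of a heavy Wigner matrix with parameter `a`:
`∏_k a_k^{q_k}` on a fat tree with `q_k` undirected edges of multiplicity `2k` for each `k` (and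
no undirected edge of odd multiplicity), and zero otherwise. -/
noncomputable def heavyWignerTraffic {L : Type*} (a : ℕ → ℝ) (T : StarGraph L) : ℂ :=
  if T.IsFatTree ∧ ∀ s : (T.skeleton Set.univ).edgeSet, Even (T.edgeMultiplicity s) then
    ∏ s : (T.skeleton Set.univ).edgeSet, (a (T.edgeMultiplicity s / 2) : ℂ)
  else 0

/-! ### Words as cyclic graphs -/

/-- The oriented simple cycle with edges labelled successively by the letters of a `*`-monomial;
the empty monomial gives the graph with one vertex and no edge. -/
def ofWord {L : Type*} : List (L × Bool) → StarGraph L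
  | [] =>
    { V := Unit
      E := Empty
      src := Empty.elim
      tgt := Empty.elim
      var := Empty.elim
      star := Empty.elim }
  | x :: w =>
    { V := Fin (w.length + 1)
      E := Fin (w.length + 1)
      src := fun i => i
      tgt := fun i => i + 1
      var := fun i => ((x :: w).get i).1
      star := fun i => ((x :: w).get i).2 }

end StarGraph

/-! ### Noncommutative `*`-polynomials and `*`-distributions

A `*`-polynomial is an element of the free algebra on the letters `(l, false)` and `(l, true)`,
which stand for `x_l` and `x_l^*`. -/

/-- The value of a `*`-polynomial at a family of matrices. -/
noncomputable def evalStarPoly {L : Type*} {N : ℕ} (A : L → Matrix (Fin N) (Fin N) ℂ) :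
    FreeAlgebra ℂ (L × Bool) →ₐ[ℂ] Matrix (Fin N) (Fin N) ℂ :=
  FreeAlgebra.lift ℂ fun x => starPow (A x.1) x.2

/-- The `*`-distribution read off from an injective distribution of traffics `τ⁰`: on a
`*`-monomial it is `τ[T] = ∑_π τ⁰[T^π]` for the cycle `T` of this monomial, and it is extended
linearly. -/
noncomputable def starDistributionOf {L : Type*} (τ0 : StarGraph L → ℂ)
    (Q : FreeAlgebra ℂ (L × Bool)) : ℂ :=
  (FreeAlgebra.equivMonoidAlgebraFreeMonoid Q).coeff.sum fun w c =>
    c * StarGraph.plainOfInj τ0 (StarGraph.ofWord w.toList)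

/-! ### Random matrices

A sequence of families of random matrices is a map `A` with `A N ω l` of size `N` by `N`, the
probability space `(Ω N, P N)` being allowed to depend on `N`. -/

/-- All entries have finite moments of all orders. -/
def HasAllMoments {L : Type*} {Ω : ℕ → Type*} [∀ N, MeasurableSpace (Ω N)]
    (P : ∀ N, Measure (Ω N)) (A : ∀ N, Ω N → L → Matrix (Fin N) (Fin N) ℂ) : Prop :=
  ∀ (N : ℕ) (l : L) (i j : Fin N) (r : ℕ), MemLp (fun ω => A N ω l i j) r (P N)

/-- `Φ` is the (mean) limiting `*`-distribution. -/
def HasLimitingStarDistribution {L : Type*} {Ω : ℕ → Type*} [∀ N, MeasurableSpace (Ω N)]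
    (P : ∀ N, Measure (Ω N)) (A : ∀ N, Ω N → L → Matrix (Fin N) (Fin N) ℂ)
    (Φ : FreeAlgebra ℂ (L × Bool) → ℂ) : Prop :=
  HasAllMoments P A ∧
  ∀ Q : FreeAlgebra ℂ (L × Bool),
    Tendsto (fun N => ∫ ω, (N : ℂ)⁻¹ * (evalStarPoly (A N ω) Q).trace ∂(P N)) atTop (𝓝 (Φ Q))

/-- Convergence in distribution of traffics on cyclic `*`-test graphs, with limit given by the
injective functional `τ⁰`. -/
def ConvergesInTraffics {L : Type*} {Ω : ℕ → Type*} [∀ N, MeasurableSpace (Ω N)]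
    (P : ∀ N, Measure (Ω N)) (A : ∀ N, Ω N → L → Matrix (Fin N) (Fin N) ℂ)
    (τ0 : StarGraph L → ℂ) : Prop :=
  HasAllMoments P A ∧
  ∀ T : StarGraph L, T.IsCyclic →
    Tendsto (fun N => ∫ ω, T.injTrace (A N ω) ∂(P N)) atTop (𝓝 (τ0 T))

/-- Concentration: asymptotic factorization on cyclic `*`-test graphs. -/
def TrafficConcentration {L : Type*} {Ω : ℕ → Type*} [∀ N, MeasurableSpace (Ω N)]
    (P : ∀ N, Measure (Ω N)) (A : ∀ N, Ω N → L → Matrix (Fin N) (Fin N) ℂ) : Prop :=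
  ∀ (n : ℕ) (T : Fin n → StarGraph L), (∀ i, (T i).IsCyclic) →
    Tendsto (fun N => (∫ ω, ∏ i, (T i).injTrace (A N ω) ∂(P N)) -
      ∏ i, ∫ ω, (T i).injTrace (A N ω) ∂(P N)) atTop (𝓝 0)

/-- Control of growth on all (not necessarily cyclic) `*`-test graphs. -/
def TrafficGrowthBound {L : Type*} {Ω : ℕ → Type*} [∀ N, MeasurableSpace (Ω N)]
    (P : ∀ N, Measure (Ω N)) (A : ∀ N, Ω N → L → Matrix (Fin N) (Fin N) ℂ) : Prop :=
  ∀ (n : ℕ) (T : Fin n → StarGraph L), (∀ i, (T i).IsTestGraph) →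
    (fun N : ℕ => ∫ ω, ∏ i, (T i).injTrace (A N ω) ∂(P N)) =O[atTop]
      fun N : ℕ => (N : ℝ) ^ (∑ i, (((T i).numLeaves : ℝ) / 2 - 1))

/-- `X N` is an `N` by `N` heavy Wigner matrix, and `(a k)_{k ≥ 1}` is the parameter of the
sequence.  The value `a 0` is irrelevant. -/
structure IsHeavyWigner {Ω : ℕ → Type*} [∀ N, MeasurableSpace (Ω N)]
    (P : ∀ N, Measure (Ω N)) (X : ∀ N, Ω N → Matrix (Fin N) (Fin N) ℂ) (a : ℕ → ℝ) : Prop where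
  measurable : ∀ N (i j : Fin N), Measurable fun ω => X N ω i j
  hermitian : ∀ N, ∀ᵐ ω ∂(P N), (X N ω).IsHermitian
  indep : ∀ N, iIndepFun
    (fun (ij : {ij : Fin N × Fin N // ij.2 ≤ ij.1}) ω => X N ω ij.1.1 ij.1.2) (P N)
  centered : ∀ N (i j : Fin N), j ≤ i → ∫ ω, X N ω i j ∂(P N) = 0
  /-- The laws `μ N` and `ν N` of the strictly sub-diagonal and diagonal entries of `√N X N`. -/
  laws : ∃ (μ : ℕ → Measure ℂ) (ν : ℕ → Measure ℝ),
    (∀ N, IsProbabilityMeasure (μ N)) ∧ (∀ N, IsProbabilityMeasure (ν N)) ∧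
    (∀ N (i : Fin N), (P N).map (fun ω => ((√(N : ℝ) : ℝ) : ℂ) * X N ω i i) =
      (ν N).map Complex.ofReal) ∧
    (∀ N (i j : Fin N), j < i →
      (P N).map (fun ω => ((√(N : ℝ) : ℝ) : ℂ) * X N ω i j) = μ N) ∧
    (∀ N, (μ N).map (starRingEnd ℂ) = μ N) ∧
    (∀ N (k : ℕ), Integrable (fun z : ℂ => ‖z‖ ^ k) (μ N)) ∧
    (∀ N (k : ℕ), Integrable (fun t : ℝ => |t| ^ k) (ν N)) ∧
    (∀ k : ℕ, 1 ≤ k → Tendsto (fun N : ℕ => (∫ z, ‖z‖ ^ (2 * k) ∂(μ N)) / (N : ℝ) ^ (k - 1))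
      atTop (𝓝 (a k))) ∧
    (∀ k : ℕ, 1 ≤ k → (fun N : ℕ => (∫ t, t ^ (2 * k) ∂(ν N)) / (N : ℝ) ^ (k - 1)) =O[atTop]
      fun _ => (1 : ℝ))

/-- The variables `x_1, …, x_p` form `p` families with one element each (`some j`), and the
variables `y_1, …, y_q` form one family (`none`). -/
def familyOf {p q : ℕ} : Fin p ⊕ Fin q → Option (Fin p) :=
  Sum.elim some fun _ => none

/-- A variable of the family `none` is one of the `y_k`. -/
def toY {p q : ℕ} : {l : Fin p ⊕ Fin q // familyOf l = none} → Fin q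
  | ⟨Sum.inr k, _⟩ => k
  | ⟨Sum.inl _, h⟩ => nomatch h

/-- The injective distributions of traffics of the families `(x_1), …, (x_p), (y_1, …, y_q)`,
from the parameters `a j` of the heavy Wigner matrices and from the limit `τY` for the `y`'s. -/
noncomputable def marginalTraffics {p q : ℕ} (a : Fin p → ℕ → ℝ) (τY : StarGraph (Fin q) → ℂ) :
    (c : Option (Fin p)) → StarGraph {l : Fin p ⊕ Fin q // familyOf l = c} → ℂ
  | some j, T => T.heavyWignerTraffic (a j)
  | none, T => τY (T.relabel toY)

/-- The injective distribution of traffics of the traffic-free product of heavy Wigner variables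
with parameters `a j` and of a family with injective distribution of traffics `τY`. -/
noncomputable def heavyWignerFreeProduct {p q : ℕ} (a : Fin p → ℕ → ℝ)
    (τY : StarGraph (Fin q) → ℂ) : StarGraph (Fin p ⊕ Fin q) → ℂ :=
  StarGraph.trafficFreeProduct familyOf (marginalTraffics a τY)

/-! Fix a cyclic graph `T`. Group its x-labelled edges into undirected ones, let `u` be the number
of pairs (label, unordered pair of ends) that occur, and let `c` be the number of components of the
graph formed by the y-labelled edges on all vertices of `T`, isolated vertices included. For an
injective map `φ`, distinct undirected edges with the same label read entries at distinct undirected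
positions. By independence, the expected weight is a product of entry moments `K x`, which do not
depend on `φ`, and of the expected weight of the y-graph (`integral_weight_eq`,
`exists_edge_moments`). Thus the expected injective trace is `N⁻¹ · ∏ K x · E[injSum of the
y-graph]`, where every `K x` is `O(1/N)`: in the heavy regime all moments of an entry of order at
least two have at most this size, and the first one vanishes. Connectedness of `T` gives `c ≤ u +
1`.

If `c ≤ u`, the whole quantity is `O(1/N)`. An injective sum over a disconnected graph is the
product of the sums over its components minus sums over quotients that merge components
(`injSum_eq_prod_sub`), so the growth hypothesis bounds it by `N` to half the total number of
leaves. The key is the inequality `sum_numLeaves_le`: the total number of leaves is at most `2u`. A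
cyclic graph has no cutting edge, so each leaf of a y-component must be reached by a second crossing
edge, necessarily an undirected edge that is not a bridge, and such an edge has only two ends to
offer. The bridges pay for the components that receive no such end.

If `c = u + 1`, contracting the y-components turns the undirected edges into a tree. Each undirected
edge is then a bridge, so balance of `T` across it forces equally many edges in both directions
(`IsCyclic.fwd_eq_bwd`), and `N · K x` tends to the corresponding parameter. Removing these balanced
bundles leaves balanced y-components, which are cyclic by Euler's theorem
(`isCyclic_of_isBalanced`), so convergence and concentration apply to their product. The correction
quotients have at most `u` components and are negligible by the first case.

It remains to recognize the limit. Counting incidences between pieces and vertices shows that `c = u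
+ 1` holds exactly when `T` is a free product all of whose x-pieces are fat trees
(`IsTestGraph.isFreeProduct_and_isFatTree_iff`). Plain traces, and then `*`-moments, follow by
summing over partitions. -/

/-! ### Connectivity of multigraphs through sets of edges. -/

/-- Two vertices of a multigraph are equivalent when they are connected through edges in `F`. -/
def edgeConn {V E : Type*} (s t : E → V) (F : Set E) : Setoid V :=
  Relation.EqvGen.setoid fun v w => ∃ e ∈ F, s e = v ∧ t e = w

section EdgeConn

variable {V E : Type*} {s t : E → V} {F F' : Set E}

theorem edgeConn_of_mem {e : E} (he : e ∈ F) : edgeConn s t F (s e) (t e) :=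
  Relation.EqvGen.rel _ _ ⟨e, he, rfl, rfl⟩

theorem edgeConn_le {r : Setoid V} (h : ∀ e ∈ F, r (s e) (t e)) : edgeConn s t F ≤ r := by
  refine Setoid.eqvGen_le ?_
  rintro _ _ ⟨e, he, rfl, rfl⟩
  exact h e he

theorem edgeConn_mono (h : F ⊆ F') : edgeConn s t F ≤ edgeConn s t F' :=
  edgeConn_le fun _ he => edgeConn_of_mem (h he)

theorem edgeConn_invariant {p : V → Prop} (h : ∀ e ∈ F, p (s e) ↔ p (t e)) {v w : V}
    (hvw : edgeConn s t F v w) : p v ↔ p w := by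
  let r : Setoid V := ⟨fun v w => p v ↔ p w, fun _ => Iff.rfl, Iff.symm, Iff.trans⟩
  exact edgeConn_le (r := r) h hvw

/-- An edge set connecting two vertices on both sides of a cut contains an edge of the cut. -/
theorem exists_crossing {p : V → Prop} {v w : V} (hvw : edgeConn s t F v w) (h : ¬(p v ↔ p w)) :
    ∃ e ∈ F, ¬(p (s e) ↔ p (t e)) := by
  by_contra! hc
  exact h (edgeConn_invariant hc hvw)

theorem edgeConn_map {W : Type*} (f : V → W) {v w : V} (h : edgeConn s t F v w) :
    edgeConn (f ∘ s) (f ∘ t) F (f v) (f w) := by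
  have : edgeConn s t F ≤ Setoid.comap f (edgeConn (f ∘ s) (f ∘ t) F) :=
    edgeConn_le fun e he => edgeConn_of_mem (s := f ∘ s) (t := f ∘ t) he
  exact this h

/-- A path that uses `b` several times can be shortened to use it at most once. Formally, the
right-hand side is already an equivalence relation containing the edges of `insert b F`. -/
theorem edgeConn_insert {b : E} {v w : V} (h : edgeConn s t (insert b F) v w) :
    edgeConn s t F v w ∨ (edgeConn s t F v (s b) ∧ edgeConn s t F (t b) w) ∨
      (edgeConn s t F v (t b) ∧ edgeConn s t F (s b) w) := by
  set R := edgeConn s t F with hR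
  have hs : ∀ {x y}, R x y → R y x := fun h => R.symm' h
  have ht : ∀ {x y z}, R x y → R y z → R x z := fun h h' => R.trans' h h'
  let r : Setoid V := ⟨fun v w => R v w ∨ (R v (s b) ∧ R (t b) w) ∨ (R v (t b) ∧ R (s b) w),
    fun x => Or.inl (R.refl' x), by
      rintro x y (h | ⟨h, h'⟩ | ⟨h, h'⟩)
      · exact Or.inl (hs h)
      · exact Or.inr (Or.inr ⟨hs h', hs h⟩)
      · exact Or.inr (Or.inl ⟨hs h', hs h⟩), by
      rintro x y z (h | ⟨h, h'⟩ | ⟨h, h'⟩) (k | ⟨k, k'⟩ | ⟨k, k'⟩)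
      · exact Or.inl (ht h k)
      · exact Or.inr (Or.inl ⟨ht h k, k'⟩)
      · exact Or.inr (Or.inr ⟨ht h k, k'⟩)
      · exact Or.inr (Or.inl ⟨h, ht h' k⟩)
      · exact Or.inr (Or.inl ⟨h, k'⟩)
      · exact Or.inl (ht h k')
      · exact Or.inr (Or.inr ⟨h, ht h' k⟩)
      · exact Or.inl (ht h k')
      · exact Or.inr (Or.inr ⟨h, k'⟩)⟩
  refine edgeConn_le (r := r) ?_ h
  rintro e (rfl | he)
  · exact Or.inr (Or.inl ⟨R.refl' _, R.refl' _⟩)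
  · exact Or.inl (edgeConn_of_mem he)

/-- Adding `b` can merge only the class of `s b` with the class of `t b`. Once the latter is sent to
`none`, the map on classes becomes injective. -/
theorem card_edgeConn_insert [Finite V] (b : E) :
    Nat.card (Quotient (edgeConn s t F)) ≤ Nat.card (Quotient (edgeConn s t (insert b F))) + 1 := by
  classical
  have hmono : edgeConn s t F ≤ edgeConn s t (insert b F) := edgeConn_mono (Set.subset_insert _ _)
  let g : Quotient (edgeConn s t F) → Option (Quotient (edgeConn s t (insert b F))) := fun q =>
    if q = Quotient.mk _ (t b) then none else some (Quotient.map' id hmono q)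
  have hg : Function.Injective g := by
    intro q q'
    induction q, q' using Quotient.inductionOn₂ with | _ v w
    intro h
    by_cases hv : (Quotient.mk (edgeConn s t F) v) = Quotient.mk _ (t b)
    · by_cases hw : (Quotient.mk (edgeConn s t F) w) = Quotient.mk _ (t b)
      · rw [hv, hw]
      · simp [g, hv, hw] at h
    · by_cases hw : (Quotient.mk (edgeConn s t F) w) = Quotient.mk _ (t b)
      · simp [g, hv, hw] at h
      · simp only [g, hv, hw, if_false, Option.some.injEq] at h
        have h' : edgeConn s t (insert b F) v w := Quotient.exact h
        rcases edgeConn_insert h' with h | ⟨_, h⟩ | ⟨h, _⟩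
        · exact Quotient.sound h
        · exact absurd (Quotient.sound ((edgeConn s t F).symm' h)) hw
        · exact absurd (Quotient.sound h) hv
  have := Nat.card_le_card_of_injective g hg
  rwa [Finite.card_option] at this

theorem card_edgeConn_union [Finite V] (B : Finset E) :
    Nat.card (Quotient (edgeConn s t F)) ≤
      Nat.card (Quotient (edgeConn s t (F ∪ B))) + B.card := by
  classical
  induction B using Finset.induction_on with
  | empty => simp
  | insert b B hb ih =>
    rw [Finset.card_insert_of_notMem hb, Finset.coe_insert, Set.union_insert]
    have := card_edgeConn_insert (s := s) (t := t) (F := F ∪ B) b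
    omega

/-- Removing bridges does not separate the ends of an edge that is not a bridge. -/
theorem edgeConn_diff_bridges {e : E} (he : edgeConn s t {e}ᶜ (s e) (t e)) (B : Finset E)
    (hB : ∀ b ∈ B, ¬ edgeConn s t {b}ᶜ (s b) (t b)) :
    edgeConn s t (({e} ∪ B)ᶜ : Set E) (s e) (t e) := by
  classical
  induction B using Finset.induction_on with
  | empty =>
    rw [Finset.coe_empty, Set.union_empty]
    exact he
  | insert b B hb ih =>
    have ih := ih fun x hx => hB x (Finset.mem_insert_of_mem hx)
    have hbr := hB b (Finset.mem_insert_self _ _)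
    have hne : e ≠ b := by rintro rfl; exact hbr he
    have hsub : (({e} ∪ B)ᶜ : Set E) ⊆ insert b (({e} ∪ (insert b B : Finset E))ᶜ : Set E) := by
      intro x hx
      by_cases hxb : x = b
      · exact Or.inl hxb
      · right
        simp_all
    have hsub' : (({e} ∪ (insert b B : Finset E))ᶜ : Set E) ⊆ {b}ᶜ := by
      intro x hx
      simp_all
    have heb : edgeConn s t {b}ᶜ (s e) (t e) := edgeConn_of_mem (by simpa using hne)
    -- If the connection had to use `b`, its two halves together with the edge `e`, which differs
    -- from `b`, would join the ends of `b` without `b`, and `b` would not be a bridge.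
    rcases edgeConn_insert (edgeConn_mono hsub ih) with h | ⟨h, h'⟩ | ⟨h, h'⟩
    · exact h
    · have h := edgeConn_mono hsub' h
      have h' := edgeConn_mono hsub' h'
      exact absurd (Setoid.trans' _ (Setoid.trans' _ (Setoid.symm' _ h) heb) (Setoid.symm' _ h')) hbr
    · have h := edgeConn_mono hsub' h
      have h' := edgeConn_mono hsub' h'
      refine absurd (Setoid.trans' _ h' (Setoid.trans' _ (Setoid.symm' _ heb) h)) hbr

end EdgeConn

/-! ### Components of a labelled graph. -/

namespace StarGraph

variable {L : Type*} (T : StarGraph L)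

theorem skeleton_reachable_iff {S : Set T.E} {v w : T.V} :
    (T.skeleton S).Reachable v w ↔ edgeConn T.src T.tgt S v w := by
  constructor
  · rintro ⟨p⟩
    induction p with
    | nil => exact Setoid.refl' _ _
    | cons h _ ih =>
      refine Setoid.trans' _ ?_ ih
      rw [skeleton, SimpleGraph.fromRel_adj] at h
      rcases h.2 with ⟨e, he, rfl, rfl⟩ | ⟨e, he, rfl, rfl⟩
      · exact edgeConn_of_mem he
      · exact Setoid.symm' _ (edgeConn_of_mem he)
  · intro h
    have : edgeConn T.src T.tgt S ≤ (T.skeleton S).reachableSetoid := by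
      refine edgeConn_le fun e he => ?_
      change (T.skeleton S).Reachable _ _
      by_cases hl : T.src e = T.tgt e
      · rw [hl]
      · refine SimpleGraph.Adj.reachable ?_
        rw [skeleton, SimpleGraph.fromRel_adj]
        exact ⟨hl, Or.inl ⟨e, he, rfl, rfl⟩⟩
    exact this h

theorem skeleton_connected_iff {S : Set T.E} :
    (T.skeleton S).Connected ↔ Nonempty T.V ∧ ∀ v w, edgeConn T.src T.tgt S v w := by
  rw [SimpleGraph.connected_iff, and_comm]
  simp only [SimpleGraph.Preconnected, skeleton_reachable_iff]

/-- The graph obtained by applying a map to the vertices. -/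
def mapVerts {W : Type} [Fintype W] (f : T.V → W) : StarGraph L where
  V := W
  E := T.E
  src := f ∘ T.src
  tgt := f ∘ T.tgt
  var := T.var
  star := T.star

/-- The equivalence relation whose classes are the connected components. -/
abbrev conn : Setoid T.V := edgeConn T.src T.tgt Set.univ

theorem mk_src_eq_mk_tgt (e : T.E) : Quotient.mk T.conn (T.src e) = Quotient.mk T.conn (T.tgt e) :=
  Quotient.sound (edgeConn_of_mem (Set.mem_univ _))

open Classical in
/-- A connected component of a labelled graph. -/
noncomputable def component (c : Quotient T.conn) : StarGraph L where
  V := {v // Quotient.mk T.conn v = c}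
  E := {e // Quotient.mk T.conn (T.src e) = c}
  fintypeV := Fintype.ofFinite _
  fintypeE := Fintype.ofFinite _
  src e := ⟨T.src e.1, e.2⟩
  tgt e := ⟨T.tgt e.1, (T.mk_src_eq_mk_tgt e.1).symm.trans e.2⟩
  var e := T.var e.1
  star e := T.star e.1

theorem component_isTestGraph (c : Quotient T.conn) : (T.component c).IsTestGraph := by
  rw [IsTestGraph, skeleton_connected_iff]
  refine ⟨⟨⟨c.out, Quotient.out_eq c⟩⟩, ?_⟩
  let r : Setoid T.V := 
    ⟨fun v w => v = w ∨ ∃ (hv : Quotient.mk T.conn v = c) (hw : Quotient.mk T.conn w = c),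
      (T.component c).conn ⟨v, hv⟩ ⟨w, hw⟩, fun _ => Or.inl rfl, by
        rintro x y (rfl | ⟨hx, hy, h⟩)
        · exact Or.inl rfl
        · exact Or.inr ⟨hy, hx, Setoid.symm' _ h⟩, by
        rintro x y z (rfl | ⟨hx, hy, h⟩) (rfl | ⟨hy', hz, h'⟩)
        · exact Or.inl rfl
        · exact Or.inr ⟨hy', hz, h'⟩
        · exact Or.inr ⟨hx, hy, h⟩
        · exact Or.inr ⟨hx, hz, Setoid.trans' _ h h'⟩⟩
  -- Edges away from `c` do not satisfy `r`. The relation `r'` demands `r` only when one of the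
  -- vertices lies in `c`, so it contains every edge; it stays transitive because `r` preserves
  -- membership in `c`.
  let r' : Setoid T.V := 
    ⟨fun v w => (Quotient.mk T.conn v = c → r v w) ∧ (Quotient.mk T.conn w = c → r v w),
      fun _ => ⟨fun _ => r.refl' _, fun _ => r.refl' _⟩,
      fun h => ⟨fun h' => r.symm' (h.2 h'), fun h' => r.symm' (h.1 h')⟩, by
        have aux : ∀ {x y}, r x y → Quotient.mk T.conn x = c → Quotient.mk T.conn y = c := by
          rintro x y (rfl | ⟨_, h, _⟩) h' <;> assumption
        rintro x y z h h'
        refine ⟨fun hx => ?_, fun hz => ?_⟩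
        · exact r.trans' (h.1 hx) (h'.1 (aux (h.1 hx) hx))
        · have := h'.2 hz
          exact r.trans' (h.2 (aux (r.symm' this) hz)) this⟩
  have key : T.conn ≤ r' := by
    refine edgeConn_le fun e _ => ?_
    have h1 : Quotient.mk T.conn (T.src e) = c → r (T.src e) (T.tgt e) := fun h =>
      Or.inr ⟨h, (T.mk_src_eq_mk_tgt e).symm.trans h,
        edgeConn_of_mem (s := (T.component c).src) (t := (T.component c).tgt) (F := Set.univ)
          (e := ⟨e, h⟩) (Set.mem_univ _)⟩
    exact ⟨h1, fun h => h1 ((T.mk_src_eq_mk_tgt e).trans h)⟩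
  rintro ⟨v, hv⟩ ⟨w, hw⟩
  have hvw : T.conn v w := Quotient.exact (hv.trans hw.symm)
  rcases (key hvw).1 hv with h | ⟨_, _, h⟩
  · subst h
    exact Setoid.refl' _ _
  · exact h

end StarGraph

/-! ### The leaf inequality. -/

namespace StarGraph

variable {L : Type*}

theorem mk_eq_mk_iff (T : StarGraph L) {v w : T.V} :
    (T.skeleton T.cutEdgesᶜ).connectedComponentMk v = (T.skeleton T.cutEdgesᶜ).connectedComponentMk w
      ↔ edgeConn T.src T.tgt T.cutEdgesᶜ v w := by
  rw [SimpleGraph.ConnectedComponent.eq, skeleton_reachable_iff]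

/-- A leaf of the tree of two-edge connected components is attached by a single edge. -/
theorem existsUnique_edge_of_leaf (T : StarGraph L) (hT : T.IsTestGraph) (C : T.TwoEdgeComponent)
    (hC : (T.componentTree.neighborSet C).ncard = 1) :
    ∃ e, ¬((T.skeleton T.cutEdgesᶜ).connectedComponentMk (T.src e) = C ↔
        (T.skeleton T.cutEdgesᶜ).connectedComponentMk (T.tgt e) = C) ∧
      ∀ f, ¬((T.skeleton T.cutEdgesᶜ).connectedComponentMk (T.src f) = C ↔
        (T.skeleton T.cutEdgesᶜ).connectedComponentMk (T.tgt f) = C) → f = e := by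
  obtain ⟨D, hD⟩ := Set.ncard_eq_one.1 hC
  have hCD : T.componentTree.Adj C D := by
    have : D ∈ T.componentTree.neighborSet C := by rw [hD]; rfl
    exact this
  set m := (T.skeleton T.cutEdgesᶜ).connectedComponentMk with hm
  have hcut : ∀ f, ¬(m (T.src f) = C ↔ m (T.tgt f) = C) → f ∈ T.cutEdges := by
    intro f hf
    by_contra hfc
    have : m (T.src f) = m (T.tgt f) := (T.mk_eq_mk_iff).2 (edgeConn_of_mem hfc)
    exact hf (by rw [this])
  have hends : ∀ f, ¬(m (T.src f) = C ↔ m (T.tgt f) = C) →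
      (m (T.src f) = C ∧ m (T.tgt f) = D) ∨ (m (T.tgt f) = C ∧ m (T.src f) = D) := by
    intro f hf
    have hfc := hcut f hf
    by_cases h : m (T.src f) = C
    · left
      have h2 : m (T.tgt f) ≠ C := fun h' => hf (iff_of_true h h')
      refine ⟨h, ?_⟩
      have : m (T.tgt f) ∈ T.componentTree.neighborSet C := by
        change T.componentTree.Adj _ _
        rw [componentTree, SimpleGraph.fromRel_adj]
        exact ⟨h2.symm, Or.inl ⟨f, hfc, h, rfl⟩⟩
      rw [hD] at this
      exact this
    · right
      have h2 : m (T.tgt f) = C := by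
        by_contra h'
        exact hf (iff_of_false h h')
      refine ⟨h2, ?_⟩
      have : m (T.src f) ∈ T.componentTree.neighborSet C := by
        change T.componentTree.Adj _ _
        rw [componentTree, SimpleGraph.fromRel_adj]
        exact ⟨Ne.symm h, Or.inr ⟨f, hfc, rfl, h2⟩⟩
      rw [hD] at this
      exact this
  have hex : ∃ e, ¬(m (T.src e) = C ↔ m (T.tgt e) = C) := by
    rw [componentTree, SimpleGraph.fromRel_adj] at hCD
    obtain ⟨hne, ⟨e, he, h1, h2⟩ | ⟨e, he, h1, h2⟩⟩ := hCD
    · exact ⟨e, fun h => hne ((h.1 h1).symm.trans h2)⟩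
    · exact ⟨e, fun h => hne ((h.2 h2).symm.trans h1)⟩
  obtain ⟨e, he⟩ := hex
  refine ⟨e, he, fun f hf => ?_⟩
  -- A second edge `f` between `C` and its only neighbour `D`, completed by connections inside `C`
  -- and inside `D`, would join the ends of `e` while avoiding `e`, so `e` would not be cutting.
  by_contra hfe
  have hec := hcut e he
  refine hec ?_
  rw [IsTestGraph, skeleton_connected_iff] at hT
  rw [skeleton_connected_iff]
  refine ⟨hT.1, fun v w => ?_⟩
  have hsub : edgeConn T.src T.tgt T.cutEdgesᶜ ≤ edgeConn T.src T.tgt {e}ᶜ :=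
    edgeConn_mono fun x hx hxe => hx (by rw [Set.mem_singleton_iff.1 hxe]; exact hec)
  have hmm : ∀ {x y}, m x = m y → edgeConn T.src T.tgt {e}ᶜ x y := fun h =>
    hsub ((T.mk_eq_mk_iff).1 h)
  have hff : edgeConn T.src T.tgt {e}ᶜ (T.src f) (T.tgt f) := edgeConn_of_mem hfe
  have hee : edgeConn T.src T.tgt {e}ᶜ (T.src e) (T.tgt e) := by
    rcases hends e he with ⟨h1, h2⟩ | ⟨h1, h2⟩ <;> rcases hends f hf with ⟨h3, h4⟩ | ⟨h3, h4⟩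
    · exact Setoid.trans' _ (hmm (h1.trans h3.symm)) (Setoid.trans' _ hff (hmm (h4.trans h2.symm)))
    · exact Setoid.trans' _ (hmm (h1.trans h3.symm))
        (Setoid.trans' _ (Setoid.symm' _ hff) (hmm (h4.trans h2.symm)))
    · exact Setoid.trans' _ (hmm (h2.trans h4.symm))
        (Setoid.trans' _ (Setoid.symm' _ hff) (hmm (h3.trans h1.symm)))
    · exact Setoid.trans' _ (hmm (h2.trans h4.symm)) (Setoid.trans' _ hff (hmm (h3.trans h1.symm)))
  have : edgeConn T.src T.tgt Set.univ ≤ edgeConn T.src T.tgt {e}ᶜ := by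
    refine edgeConn_le fun g _ => ?_
    by_cases hg : g = e
    · rw [hg]; exact hee
    · exact edgeConn_of_mem hg
  exact this (hT.2 v w)

section LeafInequality

variable (G : StarGraph L) {EX : Type*} [Fintype EX] (sx tx : EX → G.V)

open scoped Classical in
/-- The added edges that are bridges. -/
noncomputable def bridges : Finset EX := Finset.univ.filter fun x =>
  ¬ edgeConn (Sum.elim G.src sx) (Sum.elim G.tgt tx) {Sum.inr x}ᶜ (sx x) (tx x)

/-- The half-edges of the added edges that are not bridges. -/
abbrev HalfEdge : Type _ := {x : EX // x ∉ G.bridges sx tx} × Bool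

/-- The vertex of a half-edge. -/
def HalfEdge.vert (h : G.HalfEdge sx tx) : G.V := if h.2 then sx h.1.1 else tx h.1.1

/-- The half-edges attached to a component. -/
abbrev HalfEdgeAt (c : Quotient G.conn) : Type _ :=
  {h : G.HalfEdge sx tx // Quotient.mk G.conn (HalfEdge.vert G sx tx h) = c}

variable {G sx tx}

theorem exists_halfEdge {x : EX} (hx : x ∉ G.bridges sx tx) {p : G.V → Prop}
    (h : ¬(p (sx x) ↔ p (tx x))) :
    ∃ h : G.HalfEdge sx tx, h.1.1 = x ∧ p (HalfEdge.vert G sx tx h) := by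
  by_cases h1 : p (sx x)
  · exact ⟨(⟨x, hx⟩, true), rfl, h1⟩
  · have h2 : p (tx x) := by
      by_contra h2
      exact h (iff_of_false h1 h2)
    exact ⟨(⟨x, hx⟩, false), rfl, h2⟩

open scoped Classical in
/-- An edge that is not a bridge and crosses a cut comes with another edge of this cut that is not
a bridge. -/
theorem exists_other_crossing {e : G.E ⊕ EX}
    (hY : ∀ e : G.E, edgeConn (Sum.elim G.src sx) (Sum.elim G.tgt tx) {Sum.inl e}ᶜ
      (G.src e) (G.tgt e))
    (he : ∀ x, e = Sum.inr x → x ∉ G.bridges sx tx) {p : G.V → Prop}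
    (hp : ¬(p (Sum.elim G.src sx e) ↔ p (Sum.elim G.tgt tx e))) :
    ∃ f, f ≠ e ∧ (∀ x, f = Sum.inr x → x ∉ G.bridges sx tx) ∧
      ¬(p (Sum.elim G.src sx f) ↔ p (Sum.elim G.tgt tx f)) := by
  have h1 : edgeConn (Sum.elim G.src sx) (Sum.elim G.tgt tx) {e}ᶜ (Sum.elim G.src sx e)
      (Sum.elim G.tgt tx e) := by
    rcases e with e | x
    · exact hY e
    · have := he x rfl
      simp only [bridges, Finset.mem_filter, Finset.mem_univ, true_and, not_not] at this
      exact this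
  have h2 := edgeConn_diff_bridges h1 ((G.bridges sx tx).map ⟨Sum.inr, Sum.inr_injective⟩) (by
    intro b hb
    obtain ⟨x, hx, rfl⟩ := Finset.mem_map.1 hb
    simp only [bridges, Finset.mem_filter, Finset.mem_univ, true_and] at hx
    exact hx)
  obtain ⟨f, hf, hfp⟩ := exists_crossing h2 hp
  refine ⟨f, fun h => hf (Or.inl h), ?_, hfp⟩
  rintro x rfl hx
  exact hf (Or.inr (by simpa using hx))

-- The edge attaching a leaf is not a bridge of the whole graph, so another non-bridge crosses the
-- boundary of the leaf. It cannot come from `G`, since the attaching edge is unique there, so it is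
-- an added edge with a half-edge inside the leaf; distinct leaves receive distinct half-edges. For
-- a trivial component tree, the conventional value 2 is matched as soon as one half-edge is
-- present: either its opposite half is attached to `c` too, or the edge leaves `c` and a second
-- non-bridge must do the same. Only components without any half-edge escape the bound.
open scoped Classical in
theorem numLeaves_component_le (c : Quotient G.conn)
    (hY : ∀ e : G.E, edgeConn (Sum.elim G.src sx) (Sum.elim G.tgt tx) {Sum.inl e}ᶜ
      (G.src e) (G.tgt e)) :
    (G.component c).numLeaves ≤ 2 ∧ Nat.card (G.HalfEdgeAt sx tx c) = 0 ∨
      (G.component c).numLeaves ≤ Nat.card (G.HalfEdgeAt sx tx c) := by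
  by_cases hsub : Subsingleton (G.component c).TwoEdgeComponent
  · have h2 : (G.component c).numLeaves = 2 := by rw [numLeaves, if_pos hsub]
    rw [h2]
    rcases Nat.eq_zero_or_pos (Nat.card (G.HalfEdgeAt sx tx c)) with h0 | hpos
    · exact Or.inl ⟨le_rfl, h0⟩
    right
    obtain ⟨⟨h, hc⟩⟩ := (Nat.card_pos_iff.1 hpos).1
    suffices ∃ h' : G.HalfEdgeAt sx tx c, h' ≠ ⟨h, hc⟩ by
      obtain ⟨h', hne⟩ := this
      have : Nontrivial (G.HalfEdgeAt sx tx c) := ⟨h', _, hne⟩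
      exact Finite.one_lt_card
    by_cases ho : Quotient.mk G.conn (HalfEdge.vert G sx tx (h.1, !h.2)) = c
    · refine ⟨⟨(h.1, !h.2), ho⟩, fun hh => ?_⟩
      have := congrArg (fun z => z.1.2) hh
      simp at this
    · have hp : ¬(Quotient.mk G.conn (sx h.1.1) = c ↔ Quotient.mk G.conn (tx h.1.1) = c) := by
        obtain ⟨x, b⟩ := h
        cases b
        · simp only [HalfEdge.vert] at hc ho
          simp at hc ho
          simp [hc, ho]
        · simp only [HalfEdge.vert] at hc ho
          simp at hc ho
          simp [hc, ho]
      obtain ⟨f, hne, hfb, hfp⟩ := exists_other_crossing (e := Sum.inr h.1.1)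
        (p := fun v => Quotient.mk G.conn v = c) hY
        (by rintro x hx; rw [← Sum.inr_injective hx]; exact h.1.2) hp
      rcases f with f | x
      · exact absurd (by simp [mk_src_eq_mk_tgt]) hfp
      · obtain ⟨h', hx', hh'⟩ := exists_halfEdge (p := fun v => Quotient.mk G.conn v = c)
          (hfb x rfl) hfp
        refine ⟨⟨h', hh'⟩, fun hh => hne ?_⟩
        rw [← hx', ← congrArg (fun z => z.1.1.1) hh]
  · right
    rw [numLeaves, if_neg hsub]
    set S := G.component c with hS
    set m := (S.skeleton S.cutEdgesᶜ).connectedComponentMk with hm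
    have key : ∀ C : S.TwoEdgeComponent, (S.componentTree.neighborSet C).ncard = 1 →
        ∃ h : G.HalfEdgeAt sx tx c, m ⟨HalfEdge.vert G sx tx h.1, h.2⟩ = C := by
      intro C hC
      obtain ⟨e, he, hu⟩ := S.existsUnique_edge_of_leaf (G.component_isTestGraph c) C hC
      let p : G.V → Prop := fun v => ∃ hv : Quotient.mk G.conn v = c, m ⟨v, hv⟩ = C
      have hpS : ∀ v : S.V, p v.1 ↔ m v = C := fun v =>
        ⟨fun ⟨_, h⟩ => h, fun h => ⟨v.2, h⟩⟩
      have hpe : ¬(p (G.src e.1) ↔ p (G.tgt e.1)) := fun h =>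
        he (((hpS (S.src e)).symm.trans h).trans (hpS (S.tgt e)))
      obtain ⟨f, hne, hfb, hfp⟩ := exists_other_crossing (e := Sum.inl e.1) (p := p) hY
        (by rintro x ⟨⟩) hpe
      rcases f with f | x
      · exfalso
        have hfc : Quotient.mk G.conn (G.src f) = c := by
          by_contra hfc
          refine hfp (iff_of_false (fun h => hfc h.1) fun h => hfc ?_)
          exact (G.mk_src_eq_mk_tgt f).trans h.1
        have := hu ⟨f, hfc⟩ fun h =>
          hfp (((hpS (S.src ⟨f, hfc⟩)).trans h).trans (hpS (S.tgt ⟨f, hfc⟩)).symm)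
        exact hne (congrArg (fun z => Sum.inl z.1) this)
      · obtain ⟨h', _, hv, hC'⟩ := exists_halfEdge (hfb x rfl) hfp
        exact ⟨⟨h', hv⟩, hC'⟩
    choose g hg using key
    rw [← Nat.card_coe_set_eq]
    refine Nat.card_le_card_of_injective
      (fun C : {C : S.TwoEdgeComponent | (S.componentTree.neighborSet C).ncard = 1} => g C.1 C.2) ?_
    intro C C' h
    have h1 := hg C.1 C.2
    have h2 := hg C'.1 C'.2
    simp only at h
    rw [h] at h1
    exact Subtype.ext (h1.symm.trans h2)

variable (sx tx) in
open scoped Classical in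
theorem sum_card_halfEdgeAt : ∑ c : Quotient G.conn, Nat.card (G.HalfEdgeAt sx tx c) =
    2 * (Fintype.card EX - (G.bridges sx tx).card) := by
  rw [← Nat.card_sigma, Nat.card_congr (Equiv.sigmaFiberEquiv fun h : G.HalfEdge sx tx =>
    Quotient.mk G.conn (HalfEdge.vert G sx tx h)), Nat.card_prod, Nat.card_eq_fintype_card,
    Nat.card_eq_fintype_card, Fintype.card_bool, mul_comm, Fintype.card_subtype_compl,
    Fintype.card_coe]

variable (sx tx) in
/-- The components with no non-bridge edge attached are separated by the bridges. -/
theorem card_isolated_le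
    (hconn : ∀ v w, edgeConn (Sum.elim G.src sx) (Sum.elim G.tgt tx) Set.univ v w)
    (hlt : (G.bridges sx tx).card < Fintype.card EX) :
    Nat.card {c : Quotient G.conn // Nat.card (G.HalfEdgeAt sx tx c) = 0} ≤
      (G.bridges sx tx).card := by
  classical
  set B := (G.bridges sx tx).map ⟨(Sum.inr : EX → G.E ⊕ EX), Sum.inr_injective⟩ with hB
  set F : Set (G.E ⊕ EX) := (B : Set (G.E ⊕ EX))ᶜ with hF
  have hle := card_edgeConn_union (s := Sum.elim G.src sx) (t := Sum.elim G.tgt tx) (F := F) B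
  have huniv : F ∪ B = Set.univ := by rw [hF, Set.compl_union_self]
  have hone : Nat.card (Quotient (edgeConn (Sum.elim G.src sx) (Sum.elim G.tgt tx) (F ∪ B))) ≤ 1 := by
    rw [huniv]
    have : Subsingleton (Quotient (edgeConn (Sum.elim G.src sx) (Sum.elim G.tgt tx) Set.univ)) :=
      ⟨fun a b => Quotient.inductionOn₂ a b fun v w => Quotient.sound (hconn v w)⟩
    exact Finite.card_le_one_iff_subsingleton.2 this
  have hBc : B.card = (G.bridges sx tx).card := Finset.card_map _
  obtain ⟨x, hx⟩ : ∃ x, x ∉ G.bridges sx tx := by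
    by_contra! h
    rw [Finset.eq_univ_of_forall h, Finset.card_univ] at hlt
    exact lt_irrefl _ hlt
  have hiso : ∀ c : {c : Quotient G.conn // Nat.card (G.HalfEdgeAt sx tx c) = 0}, ∀ v w,
      edgeConn (Sum.elim G.src sx) (Sum.elim G.tgt tx) F v w →
        (Quotient.mk G.conn v = c.1 ↔ Quotient.mk G.conn w = c.1) := by
    intro c v w h
    refine edgeConn_invariant (p := fun v => Quotient.mk G.conn v = c.1) ?_ h
    rintro (e | y) hy
    · simp [mk_src_eq_mk_tgt]
    · have hy' : y ∉ G.bridges sx tx := fun h => hy (by simpa [hB] using h)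
      have hempty : IsEmpty (G.HalfEdgeAt sx tx c.1) := by
        have := c.2
        rw [Finite.card_eq_zero_iff] at this
        exact this
      refine iff_of_false (fun h => ?_) (fun h => ?_)
      · exact hempty.false ⟨(⟨y, hy'⟩, true), h⟩
      · exact hempty.false ⟨(⟨y, hy'⟩, false), h⟩
  -- Without the bridges, each isolated component is a class by itself, and an end of the non-bridge
  -- `x` lies in yet another class, represented by `none`. Since at most one more class than there
  -- are bridges can occur, this extra class gives the bound without the `+ 1`.
  let g : Option {c : Quotient G.conn // Nat.card (G.HalfEdgeAt sx tx c) = 0} →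
      Quotient (edgeConn (Sum.elim G.src sx) (Sum.elim G.tgt tx) F) := fun o =>
    Quotient.mk _ (o.elim (sx x) fun c => c.1.out)
  have hg : Function.Injective g := by
    have hx' : ∀ c : {c : Quotient G.conn // Nat.card (G.HalfEdgeAt sx tx c) = 0},
        Quotient.mk G.conn (sx x) ≠ c.1 := by
      intro c h
      have := c.2
      rw [Finite.card_eq_zero_iff] at this
      exact this.false ⟨(⟨x, hx⟩, true), h⟩
    rintro (_ | c) (_ | c') h
    · rfl
    · exact absurd ((hiso c' _ _ (Quotient.exact h)).2 (Quotient.out_eq _)) (hx' c')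
    · exact absurd ((hiso c _ _ (Quotient.exact h)).1 (Quotient.out_eq _)) (hx' c)
    · have := (hiso c _ _ (Quotient.exact h)).1 (Quotient.out_eq _)
      simp only [Option.elim, Quotient.out_eq] at this
      rw [Subtype.ext this]
  have := Nat.card_le_card_of_injective g hg
  rw [Finite.card_option] at this
  omega

-- With `b` bridges, the non-bridges offer `2 (|EX| - b)` half-edges, and each component without
-- half-edges costs 2. There are at most `b` such components: this is `card_isolated_le` when some
-- added edge is not a bridge, and otherwise it is the hypothesis `hn` on the number of components,
-- which excludes the case of a tree.
open scoped Classical in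
theorem sum_numLeaves_le
    (hconn : ∀ v w, edgeConn (Sum.elim G.src sx) (Sum.elim G.tgt tx) Set.univ v w)
    (hY : ∀ e : G.E, edgeConn (Sum.elim G.src sx) (Sum.elim G.tgt tx) {Sum.inl e}ᶜ
      (G.src e) (G.tgt e))
    (hn : Nat.card (Quotient G.conn) ≤ Fintype.card EX) :
    ∑ c : Quotient G.conn, (G.component c).numLeaves ≤ 2 * Fintype.card EX := by
  have hterm : ∀ c : Quotient G.conn, (G.component c).numLeaves ≤
      Nat.card (G.HalfEdgeAt sx tx c) + if Nat.card (G.HalfEdgeAt sx tx c) = 0 then 2 else 0 := by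
    intro c
    rcases numLeaves_component_le c hY with ⟨h, h0⟩ | h
    · rw [if_pos h0]
      omega
    · omega
  have hBle : (G.bridges sx tx).card ≤ Fintype.card EX := Finset.card_le_univ _
  have hs := sum_card_halfEdgeAt (G := G) sx tx
  refine (Finset.sum_le_sum fun c _ => hterm c).trans ?_
  rw [Finset.sum_add_distrib, hs, ← Finset.sum_filter, Finset.sum_const, smul_eq_mul,
    ← Fintype.card_subtype]
  have hc := Nat.card_eq_fintype_card
    (α := {c : Quotient G.conn // Nat.card (G.HalfEdgeAt sx tx c) = 0})
  rcases hBle.lt_or_eq with hlt | heq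
  · have := card_isolated_le sx tx hconn hlt
    omega
  · have h1 := Finite.card_subtype_le
      (fun c : Quotient G.conn => Nat.card (G.HalfEdgeAt sx tx c) = 0)
    omega

end LeafInequality

end StarGraph

/-! ### Balanced graphs and Eulerian circuits. -/

theorem finRotate_val_modEq (n : ℕ) (i : Fin n) :
    ((finRotate n i : Fin n) : ℕ) ≡ i + 1 [MOD n] := by
  obtain _ | n := n
  · exact i.elim0
  · rw [finRotate_apply, Fin.val_add, Nat.ModEq, Nat.mod_mod, Fin.val_one']
    simp

namespace StarGraph

variable {L : Type*}

/-- As many edges enter each vertex as leave it. -/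
def IsBalanced (T : StarGraph L) : Prop :=
  ∀ v, Nat.card {e // T.tgt e = v} = Nat.card {e // T.src e = v}

/-- Taking the successor along the circuit matches the edges entering a vertex with those leaving
it. -/
theorem IsCyclic.isBalanced {T : StarGraph L} (hT : T.IsCyclic) : T.IsBalanced := by
  obtain ⟨c, hc⟩ := hT.2
  intro v
  refine Nat.card_congr (Equiv.subtypeEquiv ((c.symm.trans (finRotate _)).trans c) fun e => ?_)
  have := hc (c.symm e)
  rw [Equiv.apply_symm_apply] at this
  rw [this]
  rfl

theorem isCyclic_of_perm {T : StarGraph L} (hT : T.IsTestGraph) (ρ : Equiv.Perm T.E)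
    (hρ : ∀ e, T.src (ρ e) = T.tgt e) (hcyc : ∀ e f, ρ.SameCycle e f) : T.IsCyclic := by
  refine ⟨hT, ?_⟩
  rcases isEmpty_or_nonempty T.E with hE | ⟨⟨e₀⟩⟩
  · exact ⟨(Fintype.equivFin T.E).symm, fun i => (hE.false ((Fintype.equivFin T.E).symm i)).elim⟩
  have hon : ρ.IsCycleOn ((Finset.univ : Finset T.E) : Set T.E) :=
    ⟨by simp, fun e _ f _ => hcyc e f⟩
  have hpow : ∀ {m n : ℕ}, (ρ ^ m) e₀ = (ρ ^ n) e₀ ↔ m ≡ n [MOD Fintype.card T.E] := fun {m n} =>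
    hon.pow_apply_eq_pow_apply (Finset.mem_univ e₀)
  have hinj : Function.Injective fun i : Fin (Fintype.card T.E) => (ρ ^ (i : ℕ)) e₀ := by
    intro i j h
    exact Fin.ext (Nat.ModEq.eq_of_lt_of_lt (hpow.1 h) i.2 j.2)
  refine ⟨Equiv.ofBijective _ ((Fintype.bijective_iff_injective_and_card _).2 ⟨hinj, by simp⟩),
    fun i => ?_⟩
  rw [Equiv.ofBijective_apply, Equiv.ofBijective_apply, hpow.2 (finRotate_val_modEq _ i),
    pow_succ', Equiv.Perm.mul_apply, hρ]

/-- Match incoming with outgoing edges arbitrarily at each vertex. The cycles of the resulting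
permutation are closed walks that together cover every edge once. -/
theorem exists_perm_of_isBalanced {T : StarGraph L} (hb : T.IsBalanced) :
    ∃ ρ : Equiv.Perm T.E, ∀ e, T.src (ρ e) = T.tgt e := by
  have hv : ∀ v, Nonempty ({e // T.tgt e = v} ≃ {e // T.src e = v}) := fun v =>
    by
    classical
    rw [← Fintype.card_eq]
    simpa only [Nat.card_eq_fintype_card] using hb v
  let g := fun v => (hv v).some
  refine ⟨((Equiv.sigmaFiberEquiv T.tgt).symm.trans (Equiv.sigmaCongrRight g)).trans
    (Equiv.sigmaFiberEquiv T.src), fun e => ?_⟩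
  exact (g (T.tgt e) ⟨e, rfl⟩).2

-- Composing with the transposition of elements of two different cycles merges these cycles. Along
-- the cycle of `e` the new permutation agrees with `ρ` until `ρ` would return to `e`, where it goes
-- to `f` instead. Reaching `f` and all of the old cycle is enough to produce a strictly larger one.
open scoped Classical in
theorem sameCycle_swap_mul {E : Type*} {ρ : Equiv.Perm E} [Finite E] {e f : E}
    (hef : ¬ρ.SameCycle e f) {x : E} (hx : x = f ∨ ρ.SameCycle e x) :
    (Equiv.swap e f * ρ).SameCycle e x := by
  have key : ∀ k : ℕ, (Equiv.swap e f * ρ).SameCycle e ((ρ ^ k) e) := by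
    intro k
    induction k with
    | zero => exact Equiv.Perm.SameCycle.refl _ _
    | succ k ih =>
      by_cases h1 : (ρ ^ (k + 1)) e = e
      · rw [h1]
      · have h2 : (ρ ^ (k + 1)) e ≠ f := fun h => hef ⟨(k + 1 : ℕ), by rw [zpow_natCast, h]⟩
        have h3 : (Equiv.swap e f * ρ) ((ρ ^ k) e) = (ρ ^ (k + 1)) e := by
          rw [Equiv.Perm.mul_apply, ← Equiv.Perm.mul_apply ρ, ← pow_succ',
            Equiv.swap_apply_of_ne_of_ne h1 h2]
        rw [← h3, Equiv.Perm.sameCycle_apply_right]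
        exact ih
  rcases hx with rfl | hx
  · have he : (Equiv.swap e x * ρ).SameCycle e (ρ⁻¹ e) := by
      obtain ⟨k, -, hk⟩ := (Equiv.Perm.SameCycle.exists_pow_eq' (f := ρ) (x := e) (y := ρ⁻¹ e)
        ⟨-1, by rw [zpow_neg_one]⟩)
      rw [← hk]
      exact key k
    have : (Equiv.swap e x * ρ) (ρ⁻¹ e) = x := by simp
    have he' := Equiv.Perm.sameCycle_apply_right.2 he
    rwa [this] at he'
  · obtain ⟨k, -, hk⟩ := hx.exists_pow_eq'
    rw [← hk]
    exact key k

/-- Euler's theorem: a connected balanced graph has an Eulerian circuit. -/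
theorem isCyclic_of_isBalanced {T : StarGraph L} (hT : T.IsTestGraph) (hb : T.IsBalanced) :
    T.IsCyclic := by
  classical
  rcases isEmpty_or_nonempty T.E with hE | ⟨⟨e₀⟩⟩
  · exact isCyclic_of_perm hT 1 (fun e => (hE.false e).elim) fun e => (hE.false e).elim
  obtain ⟨ρ₀, hρ₀⟩ := exists_perm_of_isBalanced hb
  obtain ⟨ρ, hρ, hmax⟩ := Finset.exists_max_image
    (Finset.univ.filter fun ρ : Equiv.Perm T.E => ∀ e, T.src (ρ e) = T.tgt e)
    (fun ρ => (Finset.univ.filter fun f => ρ.SameCycle e₀ f).card) ⟨ρ₀, by simpa using hρ₀⟩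
  simp only [Finset.mem_filter, Finset.mem_univ, true_and] at hρ hmax
  suffices h : ∀ f, ρ.SameCycle e₀ f from
    isCyclic_of_perm hT ρ hρ fun e f => (h e).symm.trans (h f)
  by_contra! hf
  obtain ⟨g, hg⟩ := hf
  -- Otherwise the sources of the edges of the cycle form a set of vertices that no edge crosses. By
  -- connectedness it contains every vertex, and then every edge belongs to the cycle.
  obtain ⟨e, f, he, hf, hef⟩ : ∃ e f, ρ.SameCycle e₀ e ∧ ¬ρ.SameCycle e₀ f ∧
      T.src e = T.src f := by
    by_contra! hno
    have hno' : ∀ f, (∃ e, ρ.SameCycle e₀ e ∧ T.src e = T.src f) → ρ.SameCycle e₀ f := by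
      rintro f ⟨e, he, hef⟩
      by_contra hf
      exact hno e f he hf hef
    let p : T.V → Prop := fun v => ∃ e, ρ.SameCycle e₀ e ∧ T.src e = v
    have hinv : ∀ f ∈ Set.univ, p (T.src f) ↔ p (T.tgt f) := by
      intro f _
      constructor
      · intro h
        exact ⟨ρ f, (hno' f h).apply_right, hρ f⟩
      · intro h
        refine ⟨f, ?_, rfl⟩
        rw [← Equiv.Perm.sameCycle_apply_right]
        refine hno' _ ?_
        rw [hρ]
        exact h
    rw [IsTestGraph, skeleton_connected_iff] at hT
    exact hg (hno' g ((edgeConn_invariant hinv (hT.2 (T.src e₀) (T.src g))).1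
      ⟨e₀, Equiv.Perm.SameCycle.refl _ _, rfl⟩))
  have hnef : ¬ρ.SameCycle e f := fun h => hf (he.trans h)
  -- Since `e` and `f` have the same source, exchanging them as successors still follows edges head
  -- to tail.
  have h1 := hmax (Equiv.swap e f * ρ) (by
    intro x
    rw [← hρ x, Equiv.Perm.mul_apply]
    rcases eq_or_ne (ρ x) e with h | h
    · rw [h, Equiv.swap_apply_left, hef]
    rcases eq_or_ne (ρ x) f with h' | h'
    · rw [h', Equiv.swap_apply_right, hef]
    · rw [Equiv.swap_apply_of_ne_of_ne h h'])
  refine absurd h1 (not_le.2 (Finset.card_lt_card ?_))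
  have h0 := sameCycle_swap_mul hnef (Or.inr he.symm)
  rw [Finset.ssubset_iff_of_subset]
  · exact ⟨f, by simpa using h0.symm.trans (sameCycle_swap_mul hnef (Or.inl rfl)), by simpa using hf⟩
  · intro x hx
    simp only [Finset.mem_filter, Finset.mem_univ, true_and] at hx ⊢
    exact h0.symm.trans (sameCycle_swap_mul hnef (Or.inr (he.symm.trans hx)))

/-- In a balanced graph as many edges enter a set of vertices as leave it. -/
theorem IsBalanced.card_out_eq_card_in {T : StarGraph L} (hb : T.IsBalanced) (p : T.V → Prop) :
    Nat.card {e // p (T.src e) ∧ ¬p (T.tgt e)} = Nat.card {e // ¬p (T.src e) ∧ p (T.tgt e)} := by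
  classical
  have hsum : ∀ g : T.E → T.V, Nat.card {e // p (g e)} =
      ∑ v ∈ Finset.univ.filter p, Nat.card {e // g e = v} := by
    intro g
    simp only [Nat.card_eq_fintype_card, Fintype.card_subtype]
    rw [Finset.card_eq_sum_card_fiberwise (f := g) (t := Finset.univ.filter p)]
    · refine Finset.sum_congr rfl fun v hv => ?_
      congr 1
      ext e
      simp only [Finset.mem_filter, Finset.mem_univ, true_and] at hv ⊢
      exact ⟨fun h => h.2, fun h => ⟨h ▸ hv, h⟩⟩
    · intro e he
      simpa using he
  have h1 : Nat.card {e // p (T.src e)} = Nat.card {e // p (T.tgt e)} := by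
    rw [hsum, hsum]
    exact Finset.sum_congr rfl fun v _ => (hb v).symm
  have h2 : ∀ a b : T.E → Prop,
      Nat.card {e // a e} = Nat.card {e // a e ∧ b e} + Nat.card {e // a e ∧ ¬b e} := by
    intro a b
    simp only [Nat.card_eq_fintype_card, Fintype.card_subtype, ← Finset.filter_filter]
    rw [Finset.card_filter_add_card_filter_not]
  have h3 := h2 (fun e => p (T.src e)) fun e => p (T.tgt e)
  have h4 := h2 (fun e => p (T.tgt e)) fun e => p (T.src e)
  have h5 : Nat.card {e // p (T.src e) ∧ p (T.tgt e)} =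
      Nat.card {e // p (T.tgt e) ∧ p (T.src e)} :=
    Nat.card_congr (Equiv.subtypeEquivRight fun _ => and_comm)
  have h6 : Nat.card {e // ¬p (T.src e) ∧ p (T.tgt e)} =
      Nat.card {e // p (T.tgt e) ∧ ¬p (T.src e)} :=
    Nat.card_congr (Equiv.subtypeEquivRight fun _ => and_comm)
  omega

/-- A cyclic graph has no cutting edge. -/
theorem IsCyclic.edgeConn_compl {T : StarGraph L} (hT : T.IsCyclic) (e : T.E) :
    edgeConn T.src T.tgt {e}ᶜ (T.src e) (T.tgt e) := by
  by_contra hne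
  -- If `e` were cutting, it would be the only edge crossing the boundary of this set; it leaves the
  -- set and nothing returns, against balance.
  let p : T.V → Prop := fun v => edgeConn T.src T.tgt {e}ᶜ (T.src e) v
  have hcross : ∀ f, f ≠ e → (p (T.src f) ↔ p (T.tgt f)) := fun f hf =>
    ⟨fun h => Setoid.trans' _ h (edgeConn_of_mem hf),
      fun h => Setoid.trans' _ h (Setoid.symm' _ (edgeConn_of_mem hf))⟩
  have h := hT.isBalanced.card_out_eq_card_in p
  have h1 : Nonempty {f // p (T.src f) ∧ ¬p (T.tgt f)} := ⟨⟨e, Setoid.refl' _ _, hne⟩⟩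
  have h2 : IsEmpty {f // ¬p (T.src f) ∧ p (T.tgt f)} := by
    refine ⟨fun ⟨f, h1, h2⟩ => ?_⟩
    by_cases hf : f = e
    · subst hf
      exact h1 (Setoid.refl' _ _)
    · exact h1 ((hcross f hf).2 h2)
  rw [Nat.card_of_isEmpty (α := {f // ¬p (T.src f) ∧ p (T.tgt f)})] at h
  exact absurd h (Nat.card_pos (α := {f // p (T.src f) ∧ ¬p (T.tgt f)})).ne'

end StarGraph

/-! ### Injective traces of disconnected graphs. -/

theorem sum_embedding_eq {V κ M : Type*} [Fintype (V → κ)] [AddCommMonoid M]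
    [DecidablePred (Function.Injective : (V → κ) → Prop)] [Fintype (V ↪ κ)] (f : (V → κ) → M) :
    ∑ φ : V ↪ κ, f φ = ∑ φ : V → κ, if Function.Injective φ then f φ else 0 := by
  rw [← Finset.sum_filter, Finset.sum_subtype (p := Function.Injective) _ (by simp)]
  exact (Fintype.sum_equiv (Equiv.subtypeInjectiveEquivEmbedding V κ) _ _ fun _ => rfl).symm

/-- A map is the same as a partition of its source and an injection of the quotient. -/
noncomputable def mapsEquivSigma (V κ : Type*) : (V → κ) ≃ Σ σ : Setoid V, (Quotient σ ↪ κ) where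
  toFun φ := ⟨Setoid.ker φ, ⟨Setoid.kerLift φ, Setoid.kerLift_injective φ⟩⟩
  invFun x := x.2 ∘ Quotient.mk x.1
  left_inv φ := rfl
  right_inv := by
    rintro ⟨σ, ψ⟩
    have h : Setoid.ker (ψ ∘ Quotient.mk σ) = σ := by
      ext v w
      rw [Setoid.ker_def]
      simp only [Function.comp_apply, ψ.injective.eq_iff]
      exact Quotient.eq
    refine Sigma.ext h ?_
    have aux : ∀ (τ : Setoid V) (_ : τ = σ) (χ : Quotient τ ↪ κ),
        χ ∘ Quotient.mk τ = ψ ∘ Quotient.mk σ → HEq χ ψ := by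
      rintro τ rfl χ hχ
      refine heq_of_eq (DFunLike.ext _ _ fun q => ?_)
      induction q using Quotient.inductionOn with | _ v
      exact congrFun hχ v
    exact aux _ h _ rfl

theorem sum_maps_eq {V κ M : Type*} [Finite V] [Fintype (V → κ)]
    [∀ σ : Setoid V, Fintype (Quotient σ ↪ κ)] [AddCommMonoid M] (f : (V → κ) → M) :
    ∑ φ : V → κ, f φ = ∑ σ : Setoid V, ∑ ψ : Quotient σ ↪ κ, f (ψ ∘ Quotient.mk σ) := by
  rw [← Fintype.sum_sigma']
  exact Fintype.sum_equiv (mapsEquivSigma V κ) _ _ fun _ => rfl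

/-- A map is a family of maps on the fibres of `g`. -/
def mapsEquivFiber {V C : Type*} (κ : Type*) (g : V → C) :
    (V → κ) ≃ ∀ c, ({v // g v = c} → κ) where
  toFun φ _ v := φ v.1
  invFun Φ v := Φ (g v) ⟨v, rfl⟩
  left_inv _ := rfl
  right_inv Φ := by
    funext c ⟨v, hv⟩
    subst hv
    rfl

theorem prod_sum_fiber_eq {V C κ M : Type*} [Fintype C] [CommSemiring M] (g : V → C)
    [Fintype (V → κ)] [∀ c, Fintype ({v // g v = c} → κ)]
    (F : ∀ c, ({v // g v = c} → κ) → M) :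
    ∏ c, ∑ φ : {v // g v = c} → κ, F c φ = ∑ φ : V → κ, ∏ c, F c fun v => φ v.1 := by
  classical
  rw [Finset.prod_univ_sum, Fintype.piFinset_univ]
  exact (Fintype.sum_equiv (mapsEquivFiber κ g) _ _ fun φ => rfl).symm

theorem prod_fiber_eq {E C M : Type*} [Fintype E] [Fintype C] [CommMonoid M] (g : E → C)
    [∀ c, Fintype {e // g e = c}] (h : E → M) :
    ∏ c, ∏ e : {e // g e = c}, h e.1 = ∏ e, h e := by
  rw [← Fintype.prod_sigma' (fun c (e : {e // g e = c}) => h e.1)]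
  exact Fintype.prod_equiv (Equiv.sigmaFiberEquiv g) _ _ fun _ => rfl

namespace StarGraph

variable {L : Type*} {N : ℕ}

open Classical in
/-- The sum defining the injective trace, without normalization. -/
noncomputable def injSum (T : StarGraph L) (A : L → Matrix (Fin N) (Fin N) ℂ) : ℂ :=
  ∑ φ : T.V ↪ Fin N, T.weight A φ

theorem injTrace_eq (T : StarGraph L) (A : L → Matrix (Fin N) (Fin N) ℂ) :
    T.injTrace A = (N : ℂ)⁻¹ * T.injSum A := rfl

theorem injSum_eq (T : StarGraph L) (A : L → Matrix (Fin N) (Fin N) ℂ) (hN : N ≠ 0) :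
    T.injSum A = N * T.injTrace A := by
  rw [injTrace_eq, mul_inv_cancel_left₀ (Nat.cast_ne_zero.2 hN)]

/-- An isomorphism of labelled graphs. -/
structure Iso (T T' : StarGraph L) where
  v : T.V ≃ T'.V
  e : T.E ≃ T'.E
  src : ∀ x, T'.src (e x) = v (T.src x)
  tgt : ∀ x, T'.tgt (e x) = v (T.tgt x)
  var : ∀ x, T'.var (e x) = T.var x
  star : ∀ x, T'.star (e x) = T.star x

theorem Iso.injSum_eq {T T' : StarGraph L} (i : T.Iso T') (A : L → Matrix (Fin N) (Fin N) ℂ) :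
    T.injSum A = T'.injSum A := by
  classical
  refine Fintype.sum_equiv (Equiv.embeddingCongr i.v (Equiv.refl _)) _ _ fun φ => ?_
  refine Fintype.prod_equiv i.e _ _ fun x => ?_
  rw [i.src, i.tgt, i.var, i.star]
  simp [Equiv.embeddingCongr]

theorem Iso.isBalanced {T T' : StarGraph L} (i : T.Iso T') (h : T.IsBalanced) : T'.IsBalanced := by
  intro v
  obtain ⟨v, rfl⟩ := i.v.surjective v
  have := h v
  rwa [Nat.card_congr (i.e.subtypeEquiv (q := fun x => T'.tgt x = i.v v) fun x => by
    rw [i.tgt, i.v.apply_eq_iff_eq]), Nat.card_congr (i.e.subtypeEquiv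
    (q := fun x => T'.src x = i.v v) fun x => by rw [i.src, i.v.apply_eq_iff_eq])] at this

theorem Iso.isTestGraph {T T' : StarGraph L} (i : T.Iso T') (h : T.IsTestGraph) :
    T'.IsTestGraph := by
  rw [IsTestGraph, skeleton_connected_iff] at h ⊢
  refine ⟨h.1.map i.v, fun v w => ?_⟩
  obtain ⟨v, rfl⟩ := i.v.surjective v
  obtain ⟨w, rfl⟩ := i.v.surjective w
  have hle : T.conn ≤ Setoid.comap i.v T'.conn := by
    refine edgeConn_le fun e _ => ?_
    rw [Setoid.comap_rel, ← i.src, ← i.tgt]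
    exact edgeConn_of_mem (Set.mem_univ _)
  exact hle (h.2 v w)

theorem Iso.isCyclic {T T' : StarGraph L} (i : T.Iso T') (h : T.IsCyclic) : T'.IsCyclic :=
  isCyclic_of_isBalanced (i.isTestGraph h.1) (i.isBalanced h.isBalanced)

-- Sort the maps on vertices by their kernel.
open Classical in
theorem trace_eq_sum_quot (T : StarGraph L) (A : L → Matrix (Fin N) (Fin N) ℂ) :
    T.trace A = ∑ σ : Setoid T.V, (T.quot σ).injTrace A := by
  let _ : ∀ σ : Setoid T.V, Fintype (Quotient σ ↪ Fin N) := fun σ =>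
    (inferInstance : Fintype ((T.quot σ).V ↪ Fin N))
  rw [trace, sum_maps_eq (fun φ => T.weight A φ), Finset.mul_sum]
  exact Finset.sum_congr rfl fun σ _ => rfl

/-- A partition that does not identify vertices of a same component. -/
def Separates (T : StarGraph L) (σ : Setoid T.V) : Prop := ∀ v w, σ v w → T.conn v w → v = w

open Classical in
/-- The weight of an injective map, zero for other maps. -/
noncomputable def injWeight (T : StarGraph L) (A : L → Matrix (Fin N) (Fin N) ℂ)
    (φ : T.V → Fin N) : ℂ :=
  if Function.Injective φ then T.weight A φ else 0

open Classical in
theorem injSum_eq_sum_injWeight (T : StarGraph L) (A : L → Matrix (Fin N) (Fin N) ℂ) :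
    T.injSum A = ∑ φ : T.V → Fin N, T.injWeight A φ :=
  (sum_embedding_eq fun φ : T.V → Fin N => T.weight A φ).trans
    (Finset.sum_congr rfl fun φ _ => by simp only [injWeight])

-- Expanded, the product sums over the maps that are injective on each component separately. Whether
-- a map has this property depends only on its kernel, which must not identify two vertices of one
-- component.
open Classical in
theorem prod_injSum_component (T : StarGraph L) (A : L → Matrix (Fin N) (Fin N) ℂ) :
    ∏ c : Quotient T.conn, (T.component c).injSum A =
      ∑ σ : Setoid T.V, if T.Separates σ then (T.quot σ).injSum A else 0 := by
  have h2 : ∏ c : Quotient T.conn, (T.component c).injSum A = ∑ φ : T.V → Fin N,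
      if ∀ v w, T.conn v w → φ v = φ w → v = w then T.weight A φ else 0 := by
    let _ : ∀ c, Fintype ({v // Quotient.mk T.conn v = c} → Fin N) := fun c =>
      (inferInstance : Fintype ((T.component c).V → Fin N))
    have h := prod_sum_fiber_eq (κ := Fin N) (Quotient.mk T.conn)
      fun c (φ : {v // Quotient.mk T.conn v = c} → Fin N) =>
        (T.component c).injWeight A φ
    refine (Finset.prod_congr rfl fun c _ => (T.component c).injSum_eq_sum_injWeight A).trans
      (h.trans ?_)
    refine Finset.sum_congr rfl fun φ _ => ?_
    have hinj : (∀ c, Function.Injective fun v : {v // Quotient.mk T.conn v = c} => φ v.1) ↔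
        ∀ v w, T.conn v w → φ v = φ w → v = w := by
      constructor
      · intro h v w hvw hφ
        have := @h (Quotient.mk T.conn w) ⟨v, Quotient.sound hvw⟩ ⟨w, rfl⟩ hφ
        exact congrArg Subtype.val this
      · rintro h c ⟨v, hv⟩ ⟨w, hw⟩ hvw
        exact Subtype.ext (h v w (Quotient.exact (hv.trans hw.symm)) hvw)
    by_cases hφ : ∀ v w, T.conn v w → φ v = φ w → v = w
    · rw [if_pos hφ]
      refine (Finset.prod_congr rfl fun c _ => if_pos (hinj.2 hφ c)).trans ?_
      let _ : ∀ c, Fintype {e // Quotient.mk T.conn (T.src e) = c} := fun c =>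
        (T.component c).fintypeE
      exact prod_fiber_eq (fun e => Quotient.mk T.conn (T.src e)) fun e =>
        starPow (A (T.var e)) (T.star e) (φ (T.src e)) (φ (T.tgt e))
    · rw [if_neg hφ]
      rw [← hinj, not_forall] at hφ
      obtain ⟨c, hc⟩ := hφ
      exact Finset.prod_eq_zero (Finset.mem_univ c) (if_neg hc)
  let _ : ∀ σ : Setoid T.V, Fintype (Quotient σ ↪ Fin N) := fun σ =>
    (inferInstance : Fintype ((T.quot σ).V ↪ Fin N))
  rw [h2, sum_maps_eq]
  refine Finset.sum_congr rfl fun σ _ => ?_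
  have h3 : ∀ ψ : Quotient σ ↪ Fin N,
      (∀ v w, T.conn v w → (ψ ∘ Quotient.mk σ) v = (ψ ∘ Quotient.mk σ) w → v = w) ↔
        T.Separates σ := by
    intro ψ
    simp only [Function.comp_apply, ψ.injective.eq_iff]
    exact ⟨fun h v w hσ hc => h v w hc (Quotient.sound hσ), fun h v w hc hσ =>
      h v w (Quotient.exact hσ) hc⟩
  simp only [h3]
  split_ifs with h
  · rfl
  · simp

/-- The quotient by the trivial partition. -/
noncomputable def isoQuotBot (T : StarGraph L) : T.Iso (T.quot ⊥) where
  v := Equiv.ofBijective (Quotient.mk ⊥) ⟨fun _ _ h => Quotient.exact h, Quotient.mk_surjective⟩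
  e := Equiv.refl _
  src _ := rfl
  tgt _ := rfl
  var _ := rfl
  star _ := rfl

theorem separates_bot (T : StarGraph L) : T.Separates ⊥ := fun _ _ h _ => h

-- Isolating the trivial partition expresses the injective sum through a product over connected
-- graphs, where the hypotheses on test graphs apply, and through quotients with strictly fewer
-- vertices and components, which are lower-order or handled by induction.
open Classical in
theorem injSum_eq_prod_sub (T : StarGraph L) (A : L → Matrix (Fin N) (Fin N) ℂ) :
    T.injSum A = ∏ c : Quotient T.conn, (T.component c).injSum A -
      ∑ σ ∈ Finset.univ.filter fun σ : Setoid T.V => σ ≠ ⊥ ∧ T.Separates σ,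
        (T.quot σ).injSum A := by
  rw [prod_injSum_component, T.isoQuotBot.injSum_eq, ← Finset.sum_filter, eq_sub_iff_add_eq,
    add_comm]
  have : (Finset.univ.filter fun σ : Setoid T.V => σ ≠ ⊥ ∧ T.Separates σ) =
      (Finset.univ.filter fun σ : Setoid T.V => T.Separates σ).erase ⊥ := by
    ext σ
    simp
  rw [this]
  exact Finset.sum_erase_add _ _ (by simp [separates_bot])

end StarGraph

/-! ### Integrability, and asymptotics of expected injective sums. -/

section Moments

variable {Ω ι : Type*} [MeasurableSpace Ω] {μ : Measure Ω}

theorem memLp_mul_of_forall {f g : Ω → ℂ} (hf : ∀ r : ℕ, MemLp f r μ) (hg : ∀ r : ℕ, MemLp g r μ)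
    (r : ℕ) : MemLp (fun ω => f ω * g ω) r μ := by
  have : ENNReal.HolderTriple ((2 * r : ℕ) : ENNReal) ((2 * r : ℕ) : ENNReal) (r : ENNReal) := by
    refine ⟨?_⟩
    push_cast
    rw [ENNReal.mul_inv (Or.inl two_ne_zero) (Or.inl (by simp)), ← add_mul,
      ENNReal.inv_two_add_inv_two, one_mul]
  exact (hg (2 * r)).mul' (hf (2 * r))

theorem memLp_prod_of_forall [IsProbabilityMeasure μ] (s : Finset ι) {f : ι → Ω → ℂ}
    (hf : ∀ i ∈ s, ∀ r : ℕ, MemLp (f i) r μ) (r : ℕ) : MemLp (fun ω => ∏ i ∈ s, f i ω) r μ := by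
  classical
  induction s using Finset.induction_on generalizing r with
  | empty => simpa using memLp_const (1 : ℂ)
  | insert i s hi ih =>
    simp only [Finset.prod_insert hi]
    exact memLp_mul_of_forall (hf i (Finset.mem_insert_self _ _))
      (fun r => ih (fun j hj => hf j (Finset.mem_insert_of_mem hj)) r) r

theorem memLp_sum_of_forall (s : Finset ι) {f : ι → Ω → ℂ} (hf : ∀ i ∈ s, ∀ r : ℕ, MemLp (f i) r μ)
    (r : ℕ) : MemLp (fun ω => ∑ i ∈ s, f i ω) r μ :=
  memLp_finsetSum s fun i hi => hf i hi r

theorem integrable_of_forall {f : Ω → ℂ} (hf : ∀ r : ℕ, MemLp f r μ) : Integrable f μ := by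
  have := hf 1
  rw [Nat.cast_one] at this
  exact memLp_one_iff_integrable.1 this

end Moments

section Random

variable {L : Type*} {Ω : ℕ → Type*} [∀ N, MeasurableSpace (Ω N)] {P : ∀ N, Measure (Ω N)}
  [∀ N, IsProbabilityMeasure (P N)] {A : ∀ N, Ω N → L → Matrix (Fin N) (Fin N) ℂ}

omit [∀ N, IsProbabilityMeasure (P N)] in
theorem HasAllMoments.starPow (hA : HasAllMoments P A) (N : ℕ) (l : L) (s : Bool) (i j : Fin N)
    (r : ℕ) : MemLp (fun ω => starPow (A N ω l) s i j) r (P N) := by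
  cases s
  · exact hA N l i j r
  · exact (hA N l j i r).star

theorem HasAllMoments.weight (hA : HasAllMoments P A) (T : StarGraph L) (N : ℕ)
    (φ : T.V → Fin N) (r : ℕ) : MemLp (fun ω => T.weight (A N ω) φ) r (P N) :=
  memLp_prod_of_forall _ (fun _ _ => hA.starPow N _ _ _ _) r

theorem HasAllMoments.injSum (hA : HasAllMoments P A) (T : StarGraph L) (N : ℕ) (r : ℕ) :
    MemLp (fun ω => T.injSum (A N ω)) r (P N) := by
  simp only [StarGraph.injSum]
  exact memLp_sum_of_forall (f := fun (φ : T.V ↪ Fin N) ω => T.weight (A N ω) φ) _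
    (fun φ _ => hA.weight T N φ) r

theorem HasAllMoments.injTrace (hA : HasAllMoments P A) (T : StarGraph L) (N : ℕ) (r : ℕ) :
    MemLp (fun ω => T.injTrace (A N ω)) r (P N) :=
  (hA.injSum T N r).const_mul _

open scoped Classical in
theorem integral_injSum_eq (hA : HasAllMoments P A) (T : StarGraph L) (N : ℕ) :
    ∫ ω, T.injSum (A N ω) ∂(P N) =
      ∫ ω, ∏ c : Quotient T.conn, (T.component c).injSum (A N ω) ∂(P N) -
      ∑ σ ∈ Finset.univ.filter fun σ : Setoid T.V => σ ≠ ⊥ ∧ T.Separates σ,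
        ∫ ω, (T.quot σ).injSum (A N ω) ∂(P N) := by
  rw [← integral_finsetSum _ fun σ _ => integrable_of_forall (hA.injSum (T.quot σ) N),
    ← integral_sub]
  · exact integral_congr_ae (Eventually.of_forall fun ω => T.injSum_eq_prod_sub (A N ω))
  · exact integrable_of_forall (memLp_prod_of_forall _ fun c _ => hA.injSum _ N)
  · exact integrable_finsetSum _ fun σ _ => integrable_of_forall (hA.injSum (T.quot σ) N)

theorem prod_injSum_eq {C : Type*} [Fintype C] (S : C → StarGraph L) {N : ℕ} (hN : N ≠ 0)
    (B : L → Matrix (Fin N) (Fin N) ℂ) :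
    ∏ c, (S c).injSum B = (N : ℂ) ^ Fintype.card C *
      ∏ i : Fin (Fintype.card C), (S ((Fintype.equivFin C).symm i)).injTrace B := by
  rw [Fintype.prod_equiv (Fintype.equivFin C).symm _ (fun c => (S c).injTrace B) fun _ => rfl,
    Finset.prod_congr rfl fun c _ => (S c).injSum_eq B hN, Finset.prod_mul_distrib,
    Finset.prod_const, Finset.card_univ]

-- Each unnormalized sum is `N` times an injective trace, which cancels the `-1` in the exponent of
-- the growth hypothesis and leaves half the total number of leaves.
omit [∀ N, IsProbabilityMeasure (P N)] in
theorem isBigO_integral_prod_injSum (h3 : TrafficGrowthBound P A) {C : Type*} [Fintype C]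
    (S : C → StarGraph L) (hS : ∀ c, (S c).IsTestGraph) (s : ℕ)
    (hs : ∑ c, (S c).numLeaves ≤ 2 * s) :
    (fun N : ℕ => ∫ ω, ∏ c, (S c).injSum (A N ω) ∂(P N)) =O[atTop] fun N : ℕ => (N : ℝ) ^ s := by
  have h := h3 _ (fun i => S ((Fintype.equivFin C).symm i)) fun i => hS _
  have h1 : (fun N : ℕ => ∫ ω, ∏ c, (S c).injSum (A N ω) ∂(P N)) =ᶠ[atTop] fun N : ℕ =>
      (N : ℂ) ^ Fintype.card C * ∫ ω, ∏ i : Fin (Fintype.card C),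
        (S ((Fintype.equivFin C).symm i)).injTrace (A N ω) ∂(P N) := by
    filter_upwards [eventually_ne_atTop 0] with N hN
    rw [← integral_const_mul]
    exact integral_congr_ae (Eventually.of_forall fun ω => prod_injSum_eq S hN (A N ω))
  have h2 : (fun N : ℕ => (N : ℂ) ^ Fintype.card C) =O[atTop]
      fun N : ℕ => (N : ℝ) ^ Fintype.card C :=
    Asymptotics.isBigO_of_le _ fun N => by simp
  refine h1.trans_isBigO ((h2.mul h).trans (Asymptotics.IsBigO.of_bound 1 ?_))
  filter_upwards [eventually_ge_atTop 1] with N hN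
  have hN0 : (0 : ℝ) < N := by exact_mod_cast hN
  rw [one_mul, ← Real.rpow_natCast, ← Real.rpow_natCast, ← Real.rpow_add hN0,
    Real.norm_of_nonneg (Real.rpow_nonneg hN0.le _), Real.norm_of_nonneg (Real.rpow_nonneg hN0.le _)]
  refine Real.rpow_le_rpow_of_exponent_le (by exact_mod_cast hN) ?_
  rw [Fintype.sum_equiv (Fintype.equivFin C).symm _ (fun c => ((S c).numLeaves : ℝ) / 2 - 1)
    fun _ => rfl, Finset.sum_sub_distrib, Finset.sum_const, Finset.card_univ, ← Finset.sum_div]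
  have : ((∑ c, (S c).numLeaves : ℕ) : ℝ) ≤ ((2 * s : ℕ) : ℝ) := by exact_mod_cast hs
  push_cast at this
  simp only [nsmul_eq_mul, mul_one]
  linarith

open scoped Classical in
/-- Growth of injective traces of graphs that are not necessarily connected. -/
theorem isBigO_integral_injSum (hA : HasAllMoments P A) (h3 : TrafficGrowthBound P A) (s : ℕ)
    (T : StarGraph L)
    (hT : ∀ (W : Type) [Fintype W] (f : T.V → W), Function.Surjective f →
      ∑ c, ((T.mapVerts f).component c).numLeaves ≤ 2 * s) :
    (fun N : ℕ => ∫ ω, T.injSum (A N ω) ∂(P N)) =O[atTop] fun N : ℕ => (N : ℝ) ^ s := by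
  -- The correction terms are quotients with fewer vertices. The leaf bound is assumed for every
  -- image of `T` under a surjection precisely so that these quotients inherit it.
  induction hn : Fintype.card T.V using Nat.strong_induction_on generalizing T with
  | _ n ih =>
  simp only [integral_injSum_eq hA T]
  refine Asymptotics.IsBigO.sub ?_ ?_
  · exact isBigO_integral_prod_injSum h3 _ (fun c => T.component_isTestGraph c) s
      (hT T.V id Function.surjective_id)
  · refine Asymptotics.IsBigO.fun_sum fun σ hσ => ?_
    simp only [Finset.mem_filter, Finset.mem_univ, true_and] at hσ
    refine ih (Fintype.card (T.quot σ).V) ?_ (T.quot σ) ?_ rfl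
    · rw [← hn]
      refine Fintype.card_lt_of_surjective_not_injective (Quotient.mk σ : T.V → (T.quot σ).V)
        Quotient.mk_surjective fun hinj => hσ.1 ?_
      ext v w
      exact ⟨fun h => hinj (Quotient.sound h), fun h => by rw [(h : v = w)]⟩
    · intro W _ f hf
      exact hT W (f ∘ (Quotient.mk σ : T.V → (T.quot σ).V)) (hf.comp Quotient.mk_surjective)

omit [∀ N, IsProbabilityMeasure (P N)] in
theorem tendsto_integral_injTrace_prod {τ : StarGraph L → ℂ} (h1 : ConvergesInTraffics P A τ)
    (h2 : TrafficConcentration P A) {n : ℕ} (S : Fin n → StarGraph L) (hS : ∀ i, (S i).IsCyclic) :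
    Tendsto (fun N => ∫ ω, ∏ i, (S i).injTrace (A N ω) ∂(P N)) atTop (𝓝 (∏ i, τ (S i))) := by
  have := (h2 n S hS).add (tendsto_finsetProd Finset.univ fun i _ => h1.2 (S i) (hS i))
  simpa using this

open scoped Classical in
/-- Leading order of the injective trace of a union of cyclic graphs. -/
theorem tendsto_integral_injSum {τ : StarGraph L → ℂ} (h1 : ConvergesInTraffics P A τ)
    (h2 : TrafficConcentration P A) (T : StarGraph L) (hcyc : ∀ c, (T.component c).IsCyclic)
    {m : ℕ} (hm : Nat.card (Quotient T.conn) = m + 1)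
    (hσ : ∀ σ : Setoid T.V, σ ≠ ⊥ → T.Separates σ →
      (fun N : ℕ => ∫ ω, (T.quot σ).injSum (A N ω) ∂(P N)) =O[atTop] fun N : ℕ => (N : ℝ) ^ m) :
    Tendsto (fun N : ℕ => ((N : ℂ) ^ (m + 1))⁻¹ * ∫ ω, T.injSum (A N ω) ∂(P N)) atTop
      (𝓝 (∏ c, τ (T.component c))) := by
  have hlim := tendsto_integral_injTrace_prod h1 h2
    (fun i => T.component ((Fintype.equivFin (Quotient T.conn)).symm i)) fun i => hcyc _
  rw [Fintype.prod_equiv (Fintype.equivFin (Quotient T.conn)).symm _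
    (fun c => τ (T.component c)) fun _ => rfl] at hlim
  -- The corrections are one power of `N` below the normalization.
  have herr : Tendsto (fun N : ℕ => ((N : ℂ) ^ (m + 1))⁻¹ *
      ∑ σ ∈ Finset.univ.filter fun σ : Setoid T.V => σ ≠ ⊥ ∧ T.Separates σ,
        ∫ ω, (T.quot σ).injSum (A N ω) ∂(P N)) atTop (𝓝 0) := by
    have hb : (fun N : ℕ => ∑ σ ∈ Finset.univ.filter fun σ : Setoid T.V => σ ≠ ⊥ ∧ T.Separates σ,
        ∫ ω, (T.quot σ).injSum (A N ω) ∂(P N)) =O[atTop] fun N : ℕ => (N : ℝ) ^ m := by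
      refine Asymptotics.IsBigO.fun_sum fun σ hs => ?_
      simp only [Finset.mem_filter, Finset.mem_univ, true_and] at hs
      exact hσ σ hs.1 hs.2
    have hc : (fun N : ℕ => ((N : ℂ) ^ (m + 1))⁻¹) =O[atTop] fun N : ℕ => ((N : ℝ) ^ (m + 1))⁻¹ :=
      Asymptotics.isBigO_of_le _ fun N => by simp
    refine (hc.mul hb).trans_tendsto ?_
    refine (tendsto_inv_atTop_nhds_zero_nat (𝕜 := ℝ)).congr' ?_
    filter_upwards [eventually_ne_atTop 0] with N hN
    have : (N : ℝ) ≠ 0 := Nat.cast_ne_zero.2 hN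
    rw [pow_succ]
    field_simp
  have := hlim.sub herr
  rw [sub_zero] at this
  refine this.congr' ?_
  filter_upwards [eventually_ne_atTop 0] with N hN
  rw [integral_injSum_eq h1.1 T N, mul_sub]
  congr 1
  have hm' : Fintype.card (Quotient T.conn) = m + 1 := by rw [← hm, Nat.card_eq_fintype_card]
  rw [integral_congr_ae (Eventually.of_forall fun ω => prod_injSum_eq T.component hN (A N ω)),
    integral_const_mul, ← mul_assoc, ← hm', inv_mul_cancel₀, one_mul]
  exact pow_ne_zero _ (Nat.cast_ne_zero.2 hN)

end Random

/-! ### Moments of the entries of a heavy Wigner matrix. -/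

/-- For even order `2k` the scaling factor `N⁻ᵏ` meets a moment of size `N^(k-1)`, so all these
moments have the same order `1/N`. An odd order lies between two even ones: `u^(2k+1) ≤ u^(2k) +
u^(2k+2)`, where `n ≥ 2` ensures `k ≥ 1`. -/
theorem isBigO_scaledMoment {E : Type*} [NormedAddCommGroup E] [MeasurableSpace E]
    (ρ : ℕ → Measure E) (hint : ∀ N (k : ℕ), Integrable (fun z : E => ‖z‖ ^ k) (ρ N))
    (hO : ∀ k : ℕ, 1 ≤ k → (fun N : ℕ => (∫ z, ‖z‖ ^ (2 * k) ∂(ρ N)) / (N : ℝ) ^ (k - 1)) =O[atTop]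
      fun _ => (1 : ℝ)) {n : ℕ} (hn : 2 ≤ n) :
    (fun N : ℕ => ∫ z, ((√(N : ℝ))⁻¹ * ‖z‖) ^ n ∂(ρ N)) =O[atTop] fun N : ℕ => (N : ℝ)⁻¹ := by
  have heven : ∀ k : ℕ, 1 ≤ k → (fun N : ℕ => ∫ z, ((√(N : ℝ))⁻¹ * ‖z‖) ^ (2 * k) ∂(ρ N)) =O[atTop]
      fun N : ℕ => (N : ℝ)⁻¹ := by
    intro k hk
    have := (hO k hk).mul (Asymptotics.isBigO_refl (fun N : ℕ => (N : ℝ)⁻¹) atTop)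
    simp only [one_mul] at this
    refine (Asymptotics.isBigO_congr ?_ EventuallyEq.rfl).2 this
    filter_upwards [eventually_ne_atTop 0] with N hN
    have hN' : (N : ℝ) ≠ 0 := Nat.cast_ne_zero.2 hN
    simp only [mul_pow]
    rw [integral_const_mul, pow_mul, inv_pow, Real.sq_sqrt (Nat.cast_nonneg N)]
    obtain ⟨k, rfl⟩ := Nat.exists_eq_add_of_le' hk
    rw [Nat.add_sub_cancel, inv_pow, pow_succ]
    field_simp
  obtain ⟨k, hk | hk⟩ := Nat.even_or_odd' n
  · rw [hk]
    exact heven k (by omega)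
  · have hk1 : 1 ≤ k := by omega
    refine Asymptotics.IsBigO.trans (Asymptotics.IsBigO.of_bound 1 (Eventually.of_forall fun N => ?_))
      ((heven k hk1).add (heven (k + 1) (by omega)))
    have hi : ∀ m : ℕ, Integrable (fun z : E => ((√(N : ℝ))⁻¹ * ‖z‖) ^ m) (ρ N) := by
      intro m
      simp only [mul_pow]
      exact (hint N m).const_mul _
    have h0 : ∀ z : E, 0 ≤ (√(N : ℝ))⁻¹ * ‖z‖ := fun z => by positivity
    rw [one_mul, ← integral_add (hi _) (hi _), Real.norm_of_nonneg
      (integral_nonneg fun z => pow_nonneg (h0 z) _), Real.norm_of_nonneg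
      (integral_nonneg fun z => add_nonneg (pow_nonneg (h0 z) _) (pow_nonneg (h0 z) _))]
    refine integral_mono (hi n) ((hi _).add (hi _)) fun z => ?_
    set u := (√(N : ℝ))⁻¹ * ‖z‖ with hu
    have hu0 : 0 ≤ u ^ (2 * k) := pow_nonneg (h0 z) _
    change u ^ n ≤ u ^ (2 * k) + u ^ (2 * (k + 1))
    have e1 : u ^ n = u ^ (2 * k) * u := by rw [hk, pow_succ]
    have e2 : u ^ (2 * (k + 1)) = u ^ (2 * k) * u ^ 2 := by rw [← pow_add]; ring_nf
    rw [e1, e2]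
    nlinarith [sq_nonneg (u - 1), mul_nonneg hu0 (sq_nonneg (u - 1)), mul_nonneg hu0 (sq_nonneg u)]

namespace IsHeavyWigner

variable {Ω : ℕ → Type*} [∀ N, MeasurableSpace (Ω N)] {P : ∀ N, Measure (Ω N)}
  {X : ∀ N, Ω N → Matrix (Fin N) (Fin N) ℂ} {a : ℕ → ℝ}

theorem ae_apply (hX : IsHeavyWigner P X a) (N : ℕ) :
    ∀ᵐ ω ∂(P N), ∀ i j, X N ω i j = (starRingEnd ℂ) (X N ω j i) := by
  filter_upwards [hX.hermitian N] with ω hω i j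
  exact (hω.apply i j).symm

theorem ae_starPow (hX : IsHeavyWigner P X a) (N : ℕ) :
    ∀ᵐ ω ∂(P N), ∀ s i j, starPow (X N ω) s i j = X N ω i j := by
  filter_upwards [hX.hermitian N] with ω hω s i j
  cases s
  · rfl
  · exact hω.apply i j

/-- The mixed moments of the entries, by position, and their asymptotics. -/
theorem exists_moments [∀ N, IsProbabilityMeasure (P N)] (hX : IsHeavyWigner P X a) :
    ∃ (mm : ℕ → ℕ → ℕ → ℂ) (md : ℕ → ℕ → ℂ),
      (∀ (N : ℕ) (i j : Fin N), i ≠ j → ∀ m m',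
        ∫ ω, X N ω i j ^ m * X N ω j i ^ m' ∂(P N) = mm N m m') ∧
      (∀ (N : ℕ) (i : Fin N) m, ∫ ω, X N ω i i ^ m ∂(P N) = md N m) ∧
      (∀ m m', 1 ≤ m + m' → (fun N => mm N m m') =O[atTop] fun N : ℕ => (N : ℝ)⁻¹) ∧
      (∀ m, 1 ≤ m → (fun N => md N m) =O[atTop] fun N : ℕ => (N : ℝ)⁻¹) ∧
      (∀ k, 1 ≤ k → Tendsto (fun N : ℕ => (N : ℂ) * mm N k k) atTop (𝓝 (a k))) ∧
      ∀ (N : ℕ) (i j : Fin N) (r : ℕ), MemLp (fun ω => X N ω i j) r (P N) := by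
  obtain ⟨μ, ν, hμ, hν, hdiag, hoff, hconj, hμint, hνint, hμlim, hνO⟩ := hX.laws
  set c : ℕ → ℂ := fun N => (((√(N : ℝ) : ℝ) : ℂ))⁻¹ with hc
  have hc0 : ∀ {N : ℕ}, Fin N → ((√(N : ℝ) : ℝ) : ℂ) ≠ 0 := by
    intro N i
    rw [Complex.ofReal_ne_zero, Real.sqrt_ne_zero (Nat.cast_nonneg N)]
    exact_mod_cast (Nat.pos_of_ne_zero fun h => by subst h; exact i.elim0).ne'
  have hcX : ∀ {N : ℕ} (i j : Fin N) (ω : Ω N), X N ω i j =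
      c N * (((√(N : ℝ) : ℝ) : ℂ) * X N ω i j) := fun i j ω => by
    rw [hc, inv_mul_cancel_left₀ (hc0 i)]
  have hcc : ∀ N, (starRingEnd ℂ) (c N) = c N := fun N => by
    rw [hc, map_inv₀, Complex.conj_ofReal]
  have hcn : ∀ N, ‖c N‖ = (√(N : ℝ))⁻¹ := fun N => by
    rw [hc, norm_inv, Complex.norm_real, Real.norm_of_nonneg (Real.sqrt_nonneg _)]
  have hmX : ∀ {N : ℕ} (i j : Fin N),
      AEMeasurable (fun ω => ((√(N : ℝ) : ℝ) : ℂ) * X N ω i j) (P N) := fun {N} i j =>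
    ((hX.measurable N i j).const_mul _).aemeasurable
  have hlow : ∀ {N : ℕ} (i j : Fin N), j < i → ∀ g : ℂ → ℂ, Measurable g →
      ∫ ω, g (X N ω i j) ∂(P N) = ∫ z, g (c N * z) ∂(μ N) := by
    intro N i j hij g hg
    have hg' : Measurable fun z : ℂ => g (c N * z) := hg.comp (measurable_const_mul _)
    rw [← hoff N i j hij, integral_map (hmX i j) hg'.aestronglyMeasurable]
    exact integral_congr_ae (Eventually.of_forall fun ω => congrArg g (hcX i j ω))
  have hdia : ∀ {N : ℕ} (i : Fin N), ∀ g : ℂ → ℂ, Measurable g →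
      ∫ ω, g (X N ω i i) ∂(P N) = ∫ t : ℝ, g (c N * t) ∂(ν N) := by
    intro N i g hg
    have hg' : Measurable fun z : ℂ => g (c N * z) := hg.comp (measurable_const_mul _)
    rw [← integral_map (φ := Complex.ofReal) (f := fun z => g (c N * z))
      Complex.measurable_ofReal.aemeasurable hg'.aestronglyMeasurable,
      ← hdiag N i, integral_map (hmX i i) hg'.aestronglyMeasurable]
    exact integral_congr_ae (Eventually.of_forall fun ω => congrArg g (hcX i i ω))
  have hpoly : ∀ m m' : ℕ, Measurable fun z : ℂ => z ^ m * (starRingEnd ℂ) z ^ m' := fun m m' =>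
    (by fun_prop : Continuous fun z : ℂ => z ^ m * (starRingEnd ℂ) z ^ m').measurable
  let mm : ℕ → ℕ → ℕ → ℂ := fun N m m' =>
    ∫ z, (c N * z) ^ m * (starRingEnd ℂ) (c N * z) ^ m' ∂(μ N)
  let md : ℕ → ℕ → ℂ := fun N m => ∫ t : ℝ, (c N * t) ^ m ∂(ν N)
  have hmm : ∀ (N : ℕ) (i j : Fin N), i ≠ j → ∀ m m',
      ∫ ω, X N ω i j ^ m * X N ω j i ^ m' ∂(P N) = mm N m m' := by
    intro N i j hij m m'
    rcases lt_or_gt_of_ne hij with h | h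
    -- Above the diagonal the entry is the conjugate of the one below, which exchanges the two
    -- exponents. Invariance of `μ N` under conjugation exchanges them back, so the moment does not
    -- depend on the order of `i` and `j`.
    · have h1 : ∫ ω, X N ω i j ^ m * X N ω j i ^ m' ∂(P N) =
          ∫ ω, X N ω j i ^ m' * (starRingEnd ℂ) (X N ω j i) ^ m ∂(P N) := by
        refine integral_congr_ae ?_
        filter_upwards [hX.ae_apply N] with ω hω
        rw [hω i j, mul_comm]
      rw [h1, hlow j i h (fun z => z ^ m' * (starRingEnd ℂ) z ^ m) (hpoly _ _), ← hconj N,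
        integral_map (f := fun z => (c N * z) ^ m' * (starRingEnd ℂ) (c N * z) ^ m)
          Complex.continuous_conj.measurable.aemeasurable
          ((hpoly m' m).comp (measurable_const_mul (c N))).aestronglyMeasurable]
      refine integral_congr_ae (Eventually.of_forall fun z => ?_)
      simp only [map_mul, hcc, Complex.conj_conj]
      ring
    · refine (integral_congr_ae ?_).trans
        (hlow i j h (fun z => z ^ m * (starRingEnd ℂ) z ^ m') (hpoly _ _))
      filter_upwards [hX.ae_apply N] with ω hω
      rw [hω j i]
  have hmd : ∀ (N : ℕ) (i : Fin N) m, ∫ ω, X N ω i i ^ m ∂(P N) = md N m := fun N i m =>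
    hdia i (fun z => z ^ m) (by fun_prop)
  have hμO : ∀ k : ℕ, 1 ≤ k → (fun N : ℕ => (∫ z, ‖z‖ ^ (2 * k) ∂(μ N)) / (N : ℝ) ^ (k - 1))
      =O[atTop] fun _ => (1 : ℝ) := fun k hk => (hμlim k hk).isBigO_one ℝ
  have hνO' : ∀ k : ℕ, 1 ≤ k → (fun N : ℕ => (∫ t : ℝ, ‖t‖ ^ (2 * k) ∂(ν N)) / (N : ℝ) ^ (k - 1))
      =O[atTop] fun _ => (1 : ℝ) := by
    intro k hk
    simpa only [pow_mul, Real.norm_eq_abs, sq_abs] using hνO k hk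
  refine ⟨mm, md, hmm, hmd, ?_, ?_, ?_, ?_⟩
  · intro m m' h1
    -- In total degree one the size alone would not suffice: centering makes the moment zero. This
    -- uses an actual off-diagonal entry, hence `N ≥ 2`.
    rcases h1.eq_or_lt with h1 | h2
    · refine (Asymptotics.isBigO_congr ?_ EventuallyEq.rfl).2 (Asymptotics.isBigO_zero _ _)
      filter_upwards [eventually_ge_atTop 2] with N hN
      let i : Fin N := ⟨0, by omega⟩
      let j : Fin N := ⟨1, by omega⟩
      have hij : i < j := by simp [i, j, Fin.lt_def]
      have hz := hX.centered N j i hij.le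
      rcases Nat.eq_zero_or_pos m with rfl | hm
      · obtain rfl : m' = 1 := by omega
        rw [← hmm N i j hij.ne]
        simpa using hz
      · obtain rfl : m = 1 := by omega
        obtain rfl : m' = 0 := by omega
        rw [← hmm N j i hij.ne']
        simpa using hz
    · refine Asymptotics.IsBigO.trans (Asymptotics.IsBigO.of_bound 1
        (Eventually.of_forall fun N => ?_)) (isBigO_scaledMoment μ hμint hμO (n := m + m') h2)
      rw [one_mul]
      refine (norm_integral_le_integral_norm _).trans ((le_of_eq ?_).trans (le_abs_self _))
      refine integral_congr_ae (Eventually.of_forall fun z => ?_)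
      simp only [norm_mul, norm_pow, RCLike.norm_conj, hcn, pow_add]
  · intro m h1
    rcases h1.eq_or_lt with h1 | h2
    · subst h1
      refine (Asymptotics.isBigO_congr ?_ EventuallyEq.rfl).2 (Asymptotics.isBigO_zero _ _)
      filter_upwards [eventually_ge_atTop 1] with N hN
      let i : Fin N := ⟨0, by omega⟩
      rw [← hmd N i]
      simpa using hX.centered N i i le_rfl
    · refine Asymptotics.IsBigO.trans (Asymptotics.IsBigO.of_bound 1
        (Eventually.of_forall fun N => ?_)) (isBigO_scaledMoment ν hνint hνO' (n := m) h2)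
      rw [one_mul]
      refine (norm_integral_le_integral_norm _).trans ((le_of_eq ?_).trans (le_abs_self _))
      refine integral_congr_ae (Eventually.of_forall fun z => ?_)
      simp only [norm_mul, norm_pow, hcn, Complex.norm_real]
  · intro k hk
    have hlim := (Complex.continuous_ofReal.tendsto _).comp (hμlim k hk)
    refine hlim.congr' ?_
    filter_upwards [eventually_ne_atTop 0] with N hN
    have hN' : (N : ℝ) ≠ 0 := Nat.cast_ne_zero.2 hN
    have h1 : ∀ z : ℂ, (c N * z) ^ k * (starRingEnd ℂ) (c N * z) ^ k =
        ((((N : ℝ)⁻¹ ^ k * ‖z‖ ^ (2 * k) : ℝ)) : ℂ) := by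
      intro z
      rw [← mul_pow, Complex.mul_conj, Complex.normSq_eq_norm_sq, norm_mul, hcn, mul_pow, inv_pow,
        Real.sq_sqrt (Nat.cast_nonneg N), pow_mul, ← mul_pow, Complex.ofReal_pow]
    simp only [mm, h1, Function.comp_apply]
    rw [integral_complex_ofReal, integral_const_mul]
    obtain ⟨k, rfl⟩ := Nat.exists_eq_add_of_le' hk
    rw [← Complex.ofReal_natCast, ← Complex.ofReal_mul, Nat.add_sub_cancel, inv_pow, pow_succ]
    congr 1
    field_simp
  · have hid : ∀ N (r : ℕ), MemLp (fun z : ℂ => c N * z) r (μ N) := by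
      intro N r
      have : MemLp (fun z : ℂ => z) r (μ N) := by
        rcases Nat.eq_zero_or_pos r with rfl | hr
        · rw [Nat.cast_zero, memLp_zero_iff_aestronglyMeasurable]
          exact measurable_id.aestronglyMeasurable
        · rw [← integrable_norm_rpow_iff measurable_id'.aestronglyMeasurable
            (Nat.cast_ne_zero.2 hr.ne') (ENNReal.natCast_ne_top r)]
          simpa using hμint N r
      exact this.const_mul _
    have hid' : ∀ N (r : ℕ), MemLp (fun t : ℝ => c N * (t : ℂ)) r (ν N) := by
      intro N r
      have : MemLp (fun t : ℝ => (t : ℂ)) r (ν N) := by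
        have hm : Measurable fun t : ℝ => (t : ℂ) := Complex.measurable_ofReal
        rcases Nat.eq_zero_or_pos r with rfl | hr
        · rw [Nat.cast_zero, memLp_zero_iff_aestronglyMeasurable]
          exact hm.aestronglyMeasurable
        · rw [← integrable_norm_rpow_iff hm.aestronglyMeasurable
            (Nat.cast_ne_zero.2 hr.ne') (ENNReal.natCast_ne_top r)]
          simpa using hνint N r
      exact this.const_mul _
    have hlow' : ∀ (N : ℕ) (i j : Fin N) (r : ℕ), j < i → MemLp (fun ω => X N ω i j) r (P N) := by
      intro N i j r hij
      have h := hid N r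
      rw [← hoff N i j hij] at h
      exact (h.comp_of_map (hmX i j)).ae_eq (Eventually.of_forall fun ω => (hcX i j ω).symm)
    intro N i j r
    rcases lt_trichotomy i j with h | rfl | h
    · refine ((hlow' N j i r h).star).ae_eq ?_
      filter_upwards [hX.ae_apply N] with ω hω
      exact (hω i j).symm
    · have h : MemLp (fun z : ℂ => c N * z) r ((ν N).map Complex.ofReal) := by
        rw [memLp_map_measure_iff (measurable_const_mul _).aestronglyMeasurable
          Complex.measurable_ofReal.aemeasurable]
        exact hid' N r
      rw [← hdiag N i] at h
      exact (h.comp_of_map (hmX i i)).ae_eq (Eventually.of_forall fun ω => (hcX i i ω).symm)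
    · exact hlow' N i j r h

/-- Entries at distinct undirected positions are independent. -/
theorem integral_prod (hX : IsHeavyWigner P X a) {N : ℕ} {ι : Type*} [Fintype ι]
    (u w : ι → Fin N) (hinj : Function.Injective fun x => s(u x, w x)) (m m' : ι → ℕ) :
    ∫ ω, ∏ x, (X N ω (u x) (w x) ^ m x * X N ω (w x) (u x) ^ m' x) ∂(P N) =
      ∏ x, ∫ ω, X N ω (u x) (w x) ^ m x * X N ω (w x) (u x) ^ m' x ∂(P N) := by
  -- Each unordered position is represented by its entry on or below the diagonal, where
  -- independence is assumed. By the Hermitian symmetry each factor is almost surely a function `g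
  -- x` of this single entry.
  let idx : ι → {ij : Fin N × Fin N // ij.2 ≤ ij.1} := fun x =>
    if h : w x ≤ u x then ⟨(u x, w x), h⟩ else ⟨(w x, u x), (not_le.1 h).le⟩
  have hidx : ∀ x, s((idx x).1.1, (idx x).1.2) = s(u x, w x) := by
    intro x
    by_cases h : w x ≤ u x
    · simp [idx, h]
    · simp [idx, h, Sym2.eq_swap]
  have hidxinj : Function.Injective idx := fun x y hxy => hinj (by
    change s(u x, w x) = s(u y, w y)
    rw [← hidx, ← hidx, hxy])
  let g : ι → ℂ → ℂ := fun x z =>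
    if w x ≤ u x then z ^ m x * (starRingEnd ℂ) z ^ m' x
    else (starRingEnd ℂ) z ^ m x * z ^ m' x
  have hg : ∀ x, Measurable (g x) := by
    intro x
    by_cases h : w x ≤ u x
    · simp only [g, h, if_true]
      exact (by fun_prop : Continuous fun z : ℂ => z ^ m x * (starRingEnd ℂ) z ^ m' x).measurable
    · simp only [g, h, if_false]
      exact (by fun_prop : Continuous fun z : ℂ => (starRingEnd ℂ) z ^ m x * z ^ m' x).measurable
  have hae : ∀ᵐ ω ∂(P N), ∀ x, X N ω (u x) (w x) ^ m x * X N ω (w x) (u x) ^ m' x =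
      g x (X N ω (idx x).1.1 (idx x).1.2) := by
    filter_upwards [hX.ae_apply N] with ω hω x
    by_cases h : w x ≤ u x
    · simp only [g, idx, h, if_true, dif_pos]
      rw [hω (w x) (u x)]
    · simp only [g, idx, h, if_false, dif_neg, not_false_eq_true]
      rw [hω (u x) (w x)]
  have hind := (hX.indep N).precomp hidxinj
  have hprod := hind.integral_fun_prod_comp (f := g)
    (fun x => (hX.measurable N _ _).aemeasurable) fun x => (hg x).aestronglyMeasurable
  rw [integral_congr_ae (g := fun ω => ∏ x, g x (X N ω (idx x).1.1 (idx x).1.2)), hprod]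
  · refine Finset.prod_congr rfl fun x _ => integral_congr_ae ?_
    filter_upwards [hae] with ω hω
    exact (hω x).symm
  · filter_upwards [hae] with ω hω
    exact Finset.prod_congr rfl fun x _ => hω x

end IsHeavyWigner

/-! ### Undirected x-edges and the graph of the y-edges. -/

namespace StarGraph

variable {p q : ℕ} (T : StarGraph (Fin p ⊕ Fin q))

/-- The edges labelled by one of the `x_j`. -/
abbrev LeftEdge : Type := {e : T.E // (T.var e).isLeft}

/-- The label and the unordered pair of ends of an edge. -/
def undirect (e : T.LeftEdge) : Fin p × Sym2 T.V :=
  ((T.var e.1).getLeft e.2, s(T.src e.1, T.tgt e.1))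

/-- The undirected edges labelled by one of the `x_j`, without multiplicity. -/
abbrev UEdge : Type := Set.range T.undirect

open Classical in
noncomputable instance : Fintype T.UEdge := Fintype.ofFinite _

/-- The undirected edge under an edge. -/
def toUEdge (e : T.LeftEdge) : T.UEdge := Set.rangeFactorization T.undirect e

/-- An edge above an undirected edge. -/
noncomputable def rep (x : T.UEdge) : T.LeftEdge := x.2.choose

theorem undirect_rep (x : T.UEdge) : T.undirect (T.rep x) = x.1 := x.2.choose_spec

theorem toUEdge_rep (x : T.UEdge) : T.toUEdge (T.rep x) = x := Subtype.ext (T.undirect_rep x)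

/-- The label of an undirected edge. -/
def color (x : T.UEdge) : Fin p := x.1.1

/-- The first end of an undirected edge. -/
noncomputable def fstEnd (x : T.UEdge) : T.V := T.src (T.rep x).1

/-- The second end of an undirected edge. -/
noncomputable def sndEnd (x : T.UEdge) : T.V := T.tgt (T.rep x).1

theorem mk_fstEnd_sndEnd (x : T.UEdge) : s(T.fstEnd x, T.sndEnd x) = x.1.2 :=
  congrArg Prod.snd (T.undirect_rep x)

/-- The edges above an undirected edge. -/
abbrev Above (x : T.UEdge) : Type := {e : T.LeftEdge // T.toUEdge e = x}

theorem Above.var {T : StarGraph (Fin p ⊕ Fin q)} {x : T.UEdge} (e : T.Above x) :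
    T.var e.1.1 = Sum.inl (T.color x) := by
  have h : (T.var e.1.1).getLeft e.1.2 = T.color x :=
    congrArg (fun y : T.UEdge => y.1.1) e.2
  rw [← h, Sum.inl_getLeft]

theorem Above.ends {T : StarGraph (Fin p ⊕ Fin q)} {x : T.UEdge} (e : T.Above x) :
    (T.src e.1.1 = T.fstEnd x ∧ T.tgt e.1.1 = T.sndEnd x) ∨
      (T.src e.1.1 = T.sndEnd x ∧ T.tgt e.1.1 = T.fstEnd x) := by
  have h : s(T.src e.1.1, T.tgt e.1.1) = s(T.fstEnd x, T.sndEnd x) := by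
    rw [mk_fstEnd_sndEnd]
    exact congrArg (fun y : T.UEdge => y.1.2) e.2
  simpa using h

/-- The edge goes from the first end to the second end. -/
def IsForward {x : T.UEdge} (e : T.Above x) : Prop :=
  T.src e.1.1 = T.fstEnd x ∧ T.tgt e.1.1 = T.sndEnd x

/-- The number of edges in the first direction. -/
noncomputable def fwd (x : T.UEdge) : ℕ := Nat.card {e : T.Above x // T.IsForward e}

/-- The number of edges in the second direction. -/
noncomputable def bwd (x : T.UEdge) : ℕ := Nat.card {e : T.Above x // ¬T.IsForward e}

theorem one_le_fwd (x : T.UEdge) : 1 ≤ T.fwd x := by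
  have : Nonempty {e : T.Above x // T.IsForward e} := ⟨⟨⟨T.rep x, T.toUEdge_rep x⟩, rfl, rfl⟩⟩
  exact Nat.card_pos

/-- The graph of the edges labelled by the `y_k`, on the same vertices. -/
def yGraph : StarGraph (Fin q) where
  V := T.V
  E := {e : T.E // ¬(T.var e).isLeft}
  src e := T.src e.1
  tgt e := T.tgt e.1
  var e := (T.var e.1).getRight (by simpa using e.2)
  star e := T.star e.1

/-- The contribution of an undirected edge. -/
noncomputable def uWeight {N : ℕ} (x : T.UEdge) (φ : T.V → Fin N)
    (M : Fin N × Fin N → ℂ) : ℂ :=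
  M (φ (T.fstEnd x), φ (T.sndEnd x)) ^ T.fwd x * M (φ (T.sndEnd x), φ (T.fstEnd x)) ^ T.bwd x

theorem measurable_uWeight {N : ℕ} (x : T.UEdge) (φ : T.V → Fin N) :
    Measurable (T.uWeight x φ) := by
  unfold uWeight
  fun_prop

/-- For Hermitian matrices the stars on x-edges do not matter, so all edges above one undirected
edge read the same entry or its transposed one, according to their direction. -/
theorem weight_eq {N : ℕ} (X : Fin p → Matrix (Fin N) (Fin N) ℂ)
    (Y : Fin q → Matrix (Fin N) (Fin N) ℂ) (hX : ∀ j s i i', starPow (X j) s i i' = X j i i')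
    (φ : T.V → Fin N) :
    T.weight (Sum.elim X Y) φ =
      (∏ x, T.uWeight x φ fun ij => X (T.color x) ij.1 ij.2) * T.yGraph.weight Y φ := by
  classical
  rw [weight, ← Fintype.prod_subtype_mul_prod_subtype (fun e => (T.var e).isLeft = true)]
  congr 1
  · rw [← prod_fiber_eq T.toUEdge fun e : T.LeftEdge =>
      starPow (Sum.elim X Y (T.var e.1)) (T.star e.1) (φ (T.src e.1)) (φ (T.tgt e.1))]
    refine Finset.prod_congr rfl fun x _ => ?_
    rw [← Fintype.prod_subtype_mul_prod_subtype T.IsForward, uWeight]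
    have h1 : ∀ e : T.Above x, starPow (Sum.elim X Y (T.var e.1.1)) (T.star e.1.1)
        (φ (T.src e.1.1)) (φ (T.tgt e.1.1)) = X (T.color x) (φ (T.src e.1.1)) (φ (T.tgt e.1.1)) := by
      intro e
      rw [e.var, Sum.elim_inl, hX]
    congr 1
    · rw [Finset.prod_congr rfl fun e _ => (h1 e.1).trans
        (by rw [e.2.1, e.2.2] : _ = X (T.color x) (φ (T.fstEnd x)) (φ (T.sndEnd x))),
        Finset.prod_const, Finset.card_univ, fwd, Nat.card_eq_fintype_card]
    · have h2 : ∀ e : {e : T.Above x // ¬T.IsForward e}, X (T.color x) (φ (T.src e.1.1.1))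
          (φ (T.tgt e.1.1.1)) = X (T.color x) (φ (T.sndEnd x)) (φ (T.fstEnd x)) := by
        intro e
        rcases e.1.ends with h | h
        · exact absurd h e.2
        · rw [h.1, h.2]
      rw [Finset.prod_congr rfl fun e _ => (h1 e.1).trans (h2 e),
        Finset.prod_const, Finset.card_univ, bwd, Nat.card_eq_fintype_card]
  · change _ = ∏ e : {e : T.E // ¬(T.var e).isLeft}, _
    refine Fintype.prod_congr _ _ fun e => ?_
    have : T.var e.1 = Sum.inr (T.yGraph.var e) := by
      simp [yGraph]
    rw [this]
    rfl

end StarGraph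

/-! ### Factorization of the expected weight. -/

section Factorization

variable {p q : ℕ} {a : Fin p → ℕ → ℝ} {Ω : ℕ → Type*} [∀ N, MeasurableSpace (Ω N)]
  {P : ∀ N, Measure (Ω N)} [∀ N, IsProbabilityMeasure (P N)]
  {X : ∀ N, Ω N → Fin p → Matrix (Fin N) (Fin N) ℂ}
  {Y : ∀ N, Ω N → Fin q → Matrix (Fin N) (Fin N) ℂ}

omit [∀ N, IsProbabilityMeasure (P N)] in
/-- The expectation of the weight of an injective map is the product of the expectations of the
contributions of the undirected edges and of the graph in the `y_k`. -/
theorem integral_weight_eq (hX : ∀ j, IsHeavyWigner P (fun N ω => X N ω j) (a j))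
    (hYmeas : ∀ N k (i j : Fin N), Measurable fun ω => Y N ω k i j)
    (hXindep : ∀ N, iIndepFun (fun (l : Fin p) ω (ij : Fin N × Fin N) => X N ω l ij.1 ij.2) (P N))
    (hXY : ∀ N, IndepFun
      (fun ω (lij : Fin p × Fin N × Fin N) => X N ω lij.1 lij.2.1 lij.2.2)
      (fun ω (kij : Fin q × Fin N × Fin N) => Y N ω kij.1 kij.2.1 kij.2.2) (P N))
    (T : StarGraph (Fin p ⊕ Fin q)) {N : ℕ} (φ : T.V ↪ Fin N) :
    ∫ ω, T.weight (Sum.elim (X N ω) (Y N ω)) φ ∂(P N) =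
      (∏ x, ∫ ω, T.uWeight x φ (fun ij => X N ω (T.color x) ij.1 ij.2) ∂(P N)) *
        ∫ ω, T.yGraph.weight (Y N ω) φ ∂(P N) := by
  classical
  have hae : ∀ᵐ ω ∂(P N), ∀ j s i i', starPow (X N ω j) s i i' = X N ω j i i' :=
    ae_all_iff.2 fun j => (hX j).ae_starPow N
  have h1 : ∫ ω, T.weight (Sum.elim (X N ω) (Y N ω)) φ ∂(P N) =
      ∫ ω, (∏ x, T.uWeight x φ fun ij => X N ω (T.color x) ij.1 ij.2) *
        T.yGraph.weight (Y N ω) φ ∂(P N) := by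
    refine integral_congr_ae ?_
    filter_upwards [hae] with ω hω
    exact T.weight_eq _ _ hω φ
  let F : (Fin p × Fin N × Fin N → ℂ) → ℂ := fun M =>
    ∏ x, T.uWeight x φ fun ij => M (T.color x, ij.1, ij.2)
  have hF : Measurable F := by
    refine Finset.measurable_fun_prod _ fun x _ => (T.measurable_uWeight x φ).comp ?_
    fun_prop
  let G : (Fin q × Fin N × Fin N → ℂ) → ℂ := fun M =>
    T.yGraph.weight (fun k => Matrix.of fun i j => M (k, i, j)) φ
  have hG : Measurable G := by
    refine Finset.measurable_fun_prod _ fun e _ => ?_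
    unfold starPow
    split_ifs
    · simp only [Matrix.conjTranspose_apply, Matrix.of_apply]
      exact Complex.continuous_conj.measurable.comp (measurable_pi_apply _)
    · exact measurable_pi_apply _
  have hXm : ∀ j, Measurable fun ω (ij : Fin N × Fin N) => X N ω j ij.1 ij.2 := fun j =>
    measurable_pi_iff.2 fun ij => (hX j).measurable N ij.1 ij.2
  have hXm' : Measurable fun ω (lij : Fin p × Fin N × Fin N) => X N ω lij.1 lij.2.1 lij.2.2 :=
    measurable_pi_iff.2 fun lij => (hX lij.1).measurable N _ _
  have hYm : Measurable fun ω (kij : Fin q × Fin N × Fin N) => Y N ω kij.1 kij.2.1 kij.2.2 :=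
    measurable_pi_iff.2 fun kij => hYmeas N _ _ _
  have h2 := ((hXY N).comp hF hG).integral_fun_mul_eq_mul_integral
    (hF.comp hXm').aestronglyMeasurable (hG.comp hYm).aestronglyMeasurable
  rw [h1]
  refine h2.trans ?_
  congr 1
  let H : ∀ j : Fin p, (Fin N × Fin N → ℂ) → ℂ := fun j M =>
    ∏ x : {x : T.UEdge // T.color x = j}, T.uWeight x.1 φ M
  have hH : ∀ j, Measurable (H j) := fun j =>
    Finset.measurable_fun_prod _ fun x _ => T.measurable_uWeight x.1 φ
  have h3 := (hXindep N).integral_fun_prod_comp (f := H) (fun j => (hXm j).aemeasurable)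
    fun j => (hH j).aestronglyMeasurable
  have h4 : ∀ ω, F (fun lij : Fin p × Fin N × Fin N => X N ω lij.1 lij.2.1 lij.2.2) =
      ∏ j, H j fun ij => X N ω j ij.1 ij.2 := by
    intro ω
    change ∏ x, (T.uWeight x φ fun ij => X N ω (T.color x) ij.1 ij.2) = _
    rw [← prod_fiber_eq T.color]
    refine Finset.prod_congr rfl fun j _ => Finset.prod_congr rfl fun x _ => ?_
    rw [x.2]
  refine (integral_congr_ae (Eventually.of_forall h4)).trans (h3.trans ?_)
  rw [← prod_fiber_eq T.color]
  refine Finset.prod_congr rfl fun j _ => ?_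
  -- This is where injectivity of `φ` enters: undirected edges with the same label have different
  -- pairs of ends, hence occupy different unordered positions of the matrix.
  have hinj : Function.Injective fun x : {x : T.UEdge // T.color x = j} =>
      s(φ (T.fstEnd x.1), φ (T.sndEnd x.1)) := by
    intro x y h
    have h' : Sym2.map φ s(T.fstEnd x.1, T.sndEnd x.1) = Sym2.map φ s(T.fstEnd y.1, T.sndEnd y.1) := h
    have h'' := Sym2.map.injective φ.injective h'
    rw [T.mk_fstEnd_sndEnd, T.mk_fstEnd_sndEnd] at h''
    refine Subtype.ext (Subtype.ext (Prod.ext ?_ h''))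
    exact x.2.trans y.2.symm
  refine ((hX j).integral_prod (fun x : {x : T.UEdge // T.color x = j} => φ (T.fstEnd x.1))
    (fun x => φ (T.sndEnd x.1)) hinj (fun x => T.fwd x.1) fun x => T.bwd x.1).trans ?_
  refine Finset.prod_congr rfl fun x _ => ?_
  rw [x.2]
  rfl

/-- The expectation of the injective trace, as a product of quantities attached to the undirected
edges in the `x_j` and of the expectation for the graph in the `y_k`. -/
theorem exists_edge_moments (hX : ∀ j, IsHeavyWigner P (fun N ω => X N ω j) (a j))
    (hYmeas : ∀ N k (i j : Fin N), Measurable fun ω => Y N ω k i j)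
    (hXindep : ∀ N, iIndepFun (fun (l : Fin p) ω (ij : Fin N × Fin N) => X N ω l ij.1 ij.2) (P N))
    (hXY : ∀ N, IndepFun
      (fun ω (lij : Fin p × Fin N × Fin N) => X N ω lij.1 lij.2.1 lij.2.2)
      (fun ω (kij : Fin q × Fin N × Fin N) => Y N ω kij.1 kij.2.1 kij.2.2) (P N))
    (hY : HasAllMoments P Y) (hXYm : HasAllMoments P fun N ω => Sum.elim (X N ω) (Y N ω))
    (T : StarGraph (Fin p ⊕ Fin q)) :
    ∃ K : T.UEdge → ℕ → ℂ,
      (∀ N, ∫ ω, T.injTrace (Sum.elim (X N ω) (Y N ω)) ∂(P N) =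
        (N : ℂ)⁻¹ * ((∏ x, K x N) * ∫ ω, T.yGraph.injSum (Y N ω) ∂(P N))) ∧
      (∀ x, (fun N => K x N) =O[atTop] fun N : ℕ => (N : ℝ)⁻¹) ∧
      ∀ x, T.fstEnd x ≠ T.sndEnd x → T.fwd x = T.bwd x →
        Tendsto (fun N : ℕ => (N : ℂ) * K x N) atTop (𝓝 (a (T.color x) (T.fwd x))) := by
  classical
  choose mm md h1 h2 h3 h4 h5 _ using fun j => (hX j).exists_moments
  -- A loop reads a diagonal entry, where both directions coincide and the exponents add up.
  -- Otherwise `φ` sends the two ends to distinct indices, and the moment depends on the exponents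
  -- but not on `φ`.
  refine ⟨fun x N => if T.fstEnd x = T.sndEnd x then md (T.color x) N (T.fwd x + T.bwd x)
    else mm (T.color x) N (T.fwd x) (T.bwd x), ?_, ?_, ?_⟩
  · intro N
    simp only [StarGraph.injTrace_eq, integral_const_mul]
    congr 1
    have e1 := integral_finsetSum Finset.univ fun (φ : T.V ↪ Fin N) _ =>
      integrable_of_forall (hXYm.weight T N φ)
    have e2 := integral_finsetSum Finset.univ fun (φ : T.V ↪ Fin N) _ =>
      integrable_of_forall (hY.weight T.yGraph N φ)
    refine e1.trans (Eq.trans ?_ (congrArg _ e2.symm))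
    rw [Finset.mul_sum]
    refine Finset.sum_congr rfl fun φ _ => ?_
    rw [integral_weight_eq hX hYmeas hXindep hXY T φ]
    congr 1
    refine Finset.prod_congr rfl fun x _ => ?_
    split_ifs with h
    · rw [← h2 (T.color x) N (φ (T.fstEnd x))]
      simp only [StarGraph.uWeight, ← h, pow_add]
    · rw [← h1 (T.color x) N (φ (T.fstEnd x)) (φ (T.sndEnd x)) (φ.injective.ne h)]
      rfl
  · intro x
    have := T.one_le_fwd x
    beta_reduce
    split_ifs with h
    · exact h4 _ _ (by omega)
    · exact h3 _ _ _ (by omega)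
  · intro x hne hfb
    simp only [if_neg hne, ← hfb]
    exact h5 _ _ (T.one_le_fwd x)

end Factorization

theorem Nat.card_subtype_split {E : Type*} [Finite E] (a b : E → Prop) :
    Nat.card {e // a e} = Nat.card {e : {e // b e} // a e.1} + Nat.card {e : {e // ¬b e} // a e.1} := by
  classical
  rw [Nat.card_congr (Equiv.sumCompl fun e : {e // a e} => b e.1).symm, Nat.card_sum]
  congr 1
  · exact Nat.card_congr ⟨fun e => ⟨⟨e.1.1, e.2⟩, e.1.2⟩, fun e => ⟨⟨e.1.1, e.2⟩, e.1.2⟩,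
      fun _ => rfl, fun _ => rfl⟩
  · exact Nat.card_congr ⟨fun e => ⟨⟨e.1.1, e.2⟩, e.1.2⟩, fun e => ⟨⟨e.1.1, e.2⟩, e.1.2⟩,
      fun _ => rfl, fun _ => rfl⟩

/-! ### Components after identification of vertices. -/

namespace StarGraph

section MapVerts

variable {L : Type*} (G : StarGraph L) {W : Type} [Fintype W]

/-- The map on components induced by a map on the vertices. -/
def mapComponents (f : G.V → W) : Quotient G.conn → Quotient (G.mapVerts f).conn :=
  Quotient.map' (s₁ := G.conn) (s₂ := (G.mapVerts f).conn) f fun _ _ h => edgeConn_map f h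

theorem mapComponents_surjective {f : G.V → W} (hf : Function.Surjective f) :
    Function.Surjective (G.mapComponents f) := by
  intro c
  induction c using Quotient.inductionOn with | _ w
  obtain ⟨v, rfl⟩ := hf w
  exact ⟨Quotient.mk _ v, rfl⟩

theorem card_components_mapVerts_le {f : G.V → W} (hf : Function.Surjective f) :
    Nat.card (Quotient (G.mapVerts f).conn) ≤ Nat.card (Quotient G.conn) :=
  Nat.card_le_card_of_surjective _ (G.mapComponents_surjective hf)

theorem card_components_mapVerts_lt {f : G.V → W} (hf : Function.Surjective f) {v w : G.V}
    (hvw : f v = f w) (hc : ¬G.conn v w) :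
    Nat.card (Quotient (G.mapVerts f).conn) < Nat.card (Quotient G.conn) := by
  classical
  have : Fintype (Quotient (G.mapVerts f).conn) :=
    @Quotient.fintype W _ _ fun _ _ => Classical.propDecidable _
  simp only [Nat.card_eq_fintype_card]
  refine Fintype.card_lt_of_surjective_not_injective _ (G.mapComponents_surjective hf) fun h => hc ?_
  refine Quotient.exact (h (a₁ := Quotient.mk _ v) (a₂ := Quotient.mk _ w) ?_)
  exact congrArg (Quotient.mk (G.mapVerts f).conn) hvw

theorem IsBalanced.component {G : StarGraph L} (h : G.IsBalanced) (c : Quotient G.conn) :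
    (G.component c).IsBalanced := by
  rintro ⟨v, hv⟩
  have h1 : Nat.card {e // (G.component c).tgt e = ⟨v, hv⟩} = Nat.card {e // G.tgt e = v} :=
    Nat.card_congr
      ⟨fun e => ⟨e.1.1, congrArg Subtype.val e.2⟩,
        fun e => ⟨⟨e.1, by rw [mk_src_eq_mk_tgt, e.2, hv]⟩, Subtype.ext e.2⟩,
        fun _ => rfl, fun _ => rfl⟩
  have h2 : Nat.card {e // (G.component c).src e = ⟨v, hv⟩} = Nat.card {e // G.src e = v} :=
    Nat.card_congr
      ⟨fun e => ⟨e.1.1, congrArg Subtype.val e.2⟩,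
        fun e => ⟨⟨e.1, by rw [e.2, hv]⟩, Subtype.ext e.2⟩,
        fun _ => rfl, fun _ => rfl⟩
  rw [h1, h2]
  exact h v

end MapVerts

/-! ### Counting y-components against undirected x-edges. -/

section Mixed

variable {p q : ℕ} (T : StarGraph (Fin p ⊕ Fin q))

/-- The first ends of the edges in the `y_k` and of the undirected edges. -/
noncomputable def mixSrc : T.yGraph.E ⊕ T.UEdge → T.V := Sum.elim T.yGraph.src T.fstEnd

/-- The second ends of the edges in the `y_k` and of the undirected edges. -/
noncomputable def mixTgt : T.yGraph.E ⊕ T.UEdge → T.V := Sum.elim T.yGraph.tgt T.sndEnd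

open Classical in
/-- The edge in a `y_k`, or the undirected edge, given by an edge. -/
noncomputable def toMix (e : T.E) : T.yGraph.E ⊕ T.UEdge :=
  if h : (T.var e).isLeft then Sum.inr (T.toUEdge ⟨e, h⟩) else Sum.inl ⟨e, h⟩

theorem toMix_ends (e : T.E) :
    (T.src e = T.mixSrc (T.toMix e) ∧ T.tgt e = T.mixTgt (T.toMix e)) ∨
      (T.src e = T.mixTgt (T.toMix e) ∧ T.tgt e = T.mixSrc (T.toMix e)) := by
  by_cases h : (T.var e).isLeft
  · simp only [toMix, h, dif_pos]
    exact Above.ends (⟨⟨e, h⟩, rfl⟩ : T.Above (T.toUEdge ⟨e, h⟩))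
  · simp only [toMix, h]
    exact Or.inl ⟨rfl, rfl⟩

theorem edgeConn_toMix {S : Set T.E} {F : Set (T.yGraph.E ⊕ T.UEdge)}
    (h : ∀ e ∈ S, T.toMix e ∈ F) : edgeConn T.src T.tgt S ≤ edgeConn T.mixSrc T.mixTgt F := by
  refine edgeConn_le fun e he => ?_
  rcases T.toMix_ends e with ⟨h1, h2⟩ | ⟨h1, h2⟩
  · rw [h1, h2]
    exact edgeConn_of_mem (h e he)
  · rw [h1, h2]
    exact Setoid.symm' _ (edgeConn_of_mem (h e he))

theorem edgeConn_range_inl :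
    edgeConn T.mixSrc T.mixTgt (Set.range Sum.inl) = T.yGraph.conn := by
  refine le_antisymm (edgeConn_le ?_) (edgeConn_le fun e _ => ?_)
  · rintro _ ⟨e, rfl⟩
    exact edgeConn_of_mem (s := T.yGraph.src) (t := T.yGraph.tgt) (Set.mem_univ e)
  · exact edgeConn_of_mem (s := T.mixSrc) (t := T.mixTgt) (Set.mem_range_self (f := Sum.inl) e)

variable {T}

theorem IsTestGraph.edgeConn_mix (hT : T.IsTestGraph) (v w : T.V) :
    edgeConn T.mixSrc T.mixTgt Set.univ v w := by
  rw [IsTestGraph, skeleton_connected_iff] at hT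
  exact T.edgeConn_toMix (fun _ _ => Set.mem_univ _) (hT.2 v w)

/-- A y-edge is alone above its image, so a path of `T` avoiding it stays a path avoiding it here.
Undirected x-edges can be bridges even though `T` has no cutting edge, because multiplicities have
been forgotten. -/
theorem IsCyclic.edgeConn_mix_compl (hT : T.IsCyclic) (e : T.yGraph.E) :
    edgeConn T.mixSrc T.mixTgt {Sum.inl e}ᶜ (T.yGraph.src e) (T.yGraph.tgt e) := by
  refine T.edgeConn_toMix ?_ (hT.edgeConn_compl e.1)
  intro f hf hfe
  refine hf ?_
  rw [Set.mem_singleton_iff] at hfe ⊢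
  unfold toMix at hfe
  split_ifs at hfe
  exact congrArg Subtype.val (Sum.inl_injective hfe)

/-- Connectedness and the absence of bridges among the y-edges both survive identification of
vertices, so the leaf inequality applies to every image of the y-graph. -/
theorem IsCyclic.sum_numLeaves_mapVerts_le (hT : T.IsCyclic) {W : Type} [Fintype W]
    {f : T.V → W} (hf : Function.Surjective f)
    (hn : Nat.card (Quotient (T.yGraph.mapVerts f).conn) ≤ Fintype.card T.UEdge)
    [Fintype (Quotient (T.yGraph.mapVerts f).conn)] :
    ∑ c, ((T.yGraph.mapVerts f).component c).numLeaves ≤ 2 * Fintype.card T.UEdge := by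
  have hs : Sum.elim (T.yGraph.mapVerts f).src (f ∘ T.fstEnd) = f ∘ T.mixSrc := by
    funext x; cases x <;> rfl
  have ht : Sum.elim (T.yGraph.mapVerts f).tgt (f ∘ T.sndEnd) = f ∘ T.mixTgt := by
    funext x; cases x <;> rfl
  have := sum_numLeaves_le (G := T.yGraph.mapVerts f) (sx := f ∘ T.fstEnd) (tx := f ∘ T.sndEnd)
    (by
      intro v w
      obtain ⟨v, rfl⟩ := hf v
      obtain ⟨w, rfl⟩ := hf w
      rw [hs, ht]
      exact edgeConn_map f (hT.1.edgeConn_mix v w))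
    (by
      intro e
      rw [hs, ht]
      exact edgeConn_map f (hT.edgeConn_mix_compl e)) hn
  convert this

/-- The y-components are joined into one by the undirected edges, and each of these lowers the
number of components by at most one. -/
theorem IsTestGraph.card_components_le (hT : T.IsTestGraph) :
    Nat.card (Quotient T.yGraph.conn) ≤ Fintype.card T.UEdge + 1 := by
  classical
  have h := card_edgeConn_union (s := T.mixSrc) (t := T.mixTgt) (F := Set.range Sum.inl)
    (Finset.univ.map ⟨Sum.inr, Sum.inr_injective⟩)
  rw [edgeConn_range_inl, Finset.card_map, Finset.card_univ] at h
  have hsub : Subsingleton (Quotient (edgeConn T.mixSrc T.mixTgt (Set.range Sum.inl ∪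
      ((Finset.univ.map ⟨Sum.inr, Sum.inr_injective⟩ : Finset (T.yGraph.E ⊕ T.UEdge)) :
        Set (T.yGraph.E ⊕ T.UEdge))))) := by
    have huniv : (Set.range Sum.inl ∪
      ((Finset.univ.map ⟨Sum.inr, Sum.inr_injective⟩ : Finset (T.yGraph.E ⊕ T.UEdge)) :
        Set (T.yGraph.E ⊕ T.UEdge))) = Set.univ := by
      ext x
      cases x <;> simp
    rw [huniv]
    exact ⟨fun a b => Quotient.inductionOn₂ a b fun v w => Quotient.sound (hT.edgeConn_mix v w)⟩
  have := Finite.card_le_one_iff_subsingleton.2 hsub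
  refine le_trans (show Nat.card (Quotient T.yGraph.conn) ≤ _ from h) ?_
  omega

/-- When the graph of components is a tree, all the undirected edges are bridges. -/
theorem IsTestGraph.not_edgeConn_of_card_eq (hT : T.IsTestGraph)
    (hn : Nat.card (Quotient T.yGraph.conn) = Fintype.card T.UEdge + 1) (x : T.UEdge) :
    ¬edgeConn T.mixSrc T.mixTgt {Sum.inr x}ᶜ (T.fstEnd x) (T.sndEnd x) := by
  classical
  intro hx
  -- If `x` could be bypassed, the other undirected edges alone would connect the y-components, with
  -- one edge too few.
  have hle : edgeConn T.mixSrc T.mixTgt Set.univ ≤ edgeConn T.mixSrc T.mixTgt {Sum.inr x}ᶜ := by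
    refine edgeConn_le fun e _ => ?_
    by_cases he : e = Sum.inr x
    · rw [he]; exact hx
    · exact edgeConn_of_mem he
  have h := card_edgeConn_union (s := T.mixSrc) (t := T.mixTgt) (F := Set.range Sum.inl)
    ((Finset.univ.erase x).map ⟨Sum.inr, Sum.inr_injective⟩)
  rw [edgeConn_range_inl, Finset.card_map, Finset.card_erase_of_mem (Finset.mem_univ x),
    Finset.card_univ] at h
  have hset : (Set.range Sum.inl ∪
      (((Finset.univ.erase x).map ⟨Sum.inr, Sum.inr_injective⟩ : Finset (T.yGraph.E ⊕ T.UEdge)) :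
        Set (T.yGraph.E ⊕ T.UEdge))) = {Sum.inr x}ᶜ := by
    ext y
    cases y <;> simp
  rw [hset] at h
  have hsub : Subsingleton (Quotient (edgeConn T.mixSrc T.mixTgt {Sum.inr x}ᶜ)) :=
    ⟨fun a b => Quotient.inductionOn₂ a b fun v w => Quotient.sound (hle (hT.edgeConn_mix v w))⟩
  have := Finite.card_le_one_iff_subsingleton.2 hsub
  have : 0 < Fintype.card T.UEdge := Fintype.card_pos_iff.2 ⟨x⟩
  have h' : Nat.card (Quotient T.yGraph.conn) ≤ _ := h
  omega

theorem IsTestGraph.fstEnd_ne_sndEnd (hT : T.IsTestGraph)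
    (hn : Nat.card (Quotient T.yGraph.conn) = Fintype.card T.UEdge + 1) (x : T.UEdge) :
    T.fstEnd x ≠ T.sndEnd x := fun h =>
  hT.not_edgeConn_of_card_eq hn x (by rw [h])

/-- As `x` is a bridge, the edges of `T` crossing the cut that it defines are exactly those above
`x`, and a balanced graph crosses a cut equally often in both directions. -/
theorem IsCyclic.fwd_eq_bwd (hT : T.IsCyclic)
    (hn : Nat.card (Quotient T.yGraph.conn) = Fintype.card T.UEdge + 1) (x : T.UEdge) :
    T.fwd x = T.bwd x := by
  let r : T.V → Prop := fun v => edgeConn T.mixSrc T.mixTgt {Sum.inr x}ᶜ (T.fstEnd x) v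
  have h1 : r (T.fstEnd x) := Setoid.refl' _ _
  have h2 : ¬r (T.sndEnd x) := hT.1.not_edgeConn_of_card_eq hn x
  have habove : ∀ e : T.E, ¬(r (T.src e) ↔ r (T.tgt e)) → ∃ h, T.toUEdge ⟨e, h⟩ = x := by
    intro e he
    by_contra hno
    refine he ?_
    have hne : T.toMix e ≠ Sum.inr x := by
      intro h
      unfold toMix at h
      split_ifs at h with hl
      exact hno ⟨hl, Sum.inr_injective h⟩
    have hconn : edgeConn T.mixSrc T.mixTgt {Sum.inr x}ᶜ (T.src e) (T.tgt e) := by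
      refine T.edgeConn_toMix (S := {e}) ?_ (edgeConn_of_mem rfl)
      rintro f rfl
      exact hne
    exact ⟨fun h => Setoid.trans' _ h hconn, fun h => Setoid.trans' _ h (Setoid.symm' _ hconn)⟩
  have h := hT.isBalanced.card_out_eq_card_in r
  have hf : Nat.card {e // r (T.src e) ∧ ¬r (T.tgt e)} = T.fwd x := by
    refine Nat.card_congr (Equiv.ofBijective (fun e => ?_) ⟨?_, ?_⟩ : _ ≃ _)
    · have h3 := habove e.1 fun h => e.2.2 (h.1 e.2.1)
      refine ⟨⟨⟨e.1, h3.choose⟩, h3.choose_spec⟩, ?_⟩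
      rcases Above.ends (⟨⟨e.1, h3.choose⟩, h3.choose_spec⟩ : T.Above x) with h4 | h4
      · exact h4
      · exact absurd (h4.1 ▸ e.2.1) h2
    · intro e e' hee
      exact Subtype.ext (congrArg (fun z => z.1.1.1) hee)
    · rintro ⟨e, he⟩
      exact ⟨⟨e.1.1, by rw [he.1], by rwa [he.2]⟩, rfl⟩
  have hb : Nat.card {e // ¬r (T.src e) ∧ r (T.tgt e)} = T.bwd x := by
    refine Nat.card_congr (Equiv.ofBijective (fun e => ?_) ⟨?_, ?_⟩ : _ ≃ _)
    · have h3 := habove e.1 fun h => e.2.1 (h.2 e.2.2)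
      refine ⟨⟨⟨e.1, h3.choose⟩, h3.choose_spec⟩, fun h5 => ?_⟩
      exact e.2.1 (by rw [show T.src e.1 = T.fstEnd x from h5.1])
    · intro e e' hee
      exact Subtype.ext (congrArg (fun z => z.1.1.1) hee)
    · rintro ⟨e, he⟩
      rcases e.ends with h4 | h4
      · exact absurd h4 he
      · exact ⟨⟨e.1.1, by rwa [h4.1], by rw [h4.2]⟩, rfl⟩
  rw [← hf, h, hb]

/-- Pairing forward with backward edges above each `x` gives a permutation of the x-edges that turns
targets into sources. The x-edges are therefore balanced on their own at every vertex, and so are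
the remaining edges. -/
theorem IsCyclic.isBalanced_yGraph (hT : T.IsCyclic) (hfb : ∀ x, T.fwd x = T.bwd x) :
    T.yGraph.IsBalanced := by
  classical
  have hθ : ∀ x : T.UEdge, ∃ θ : T.Above x ≃ T.Above x, ∀ e, T.src (θ e).1.1 = T.tgt e.1.1 := by
    intro x
    have hcard : Fintype.card {e : T.Above x // T.IsForward e} =
        Fintype.card {e : T.Above x // ¬T.IsForward e} := by
      have := hfb x
      rwa [fwd, bwd, Nat.card_eq_fintype_card, Nat.card_eq_fintype_card] at this
    obtain ⟨g⟩ := Fintype.card_eq.1 hcard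
    have hbw : ∀ e : {e : T.Above x // ¬T.IsForward e},
        T.src e.1.1.1 = T.sndEnd x ∧ T.tgt e.1.1.1 = T.fstEnd x := fun e =>
      e.1.ends.resolve_left e.2
    refine ⟨(Equiv.sumCompl T.IsForward).symm.trans ((Equiv.sumCongr g g.symm).trans
      ((Equiv.sumComm _ _).trans (Equiv.sumCompl T.IsForward))), fun e => ?_⟩
    by_cases he : T.IsForward e
    · simp only [Equiv.trans_apply, Equiv.sumCompl_symm_apply_of_pos he, Equiv.sumCongr_apply,
        Sum.map_inl, Equiv.sumComm_apply, Sum.swap_inl, Equiv.sumCompl_apply_inr]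
      rw [(hbw _).1, he.2]
    · simp only [Equiv.trans_apply, Equiv.sumCompl_symm_apply_of_neg he, Equiv.sumCongr_apply,
        Sum.map_inr, Equiv.sumComm_apply, Sum.swap_inr, Equiv.sumCompl_apply_inl]
      rw [(g.symm _).2.1, (hbw ⟨e, he⟩).2]
  choose θ hθ using hθ
  let Θ : T.LeftEdge ≃ T.LeftEdge := ((Equiv.sigmaFiberEquiv T.toUEdge).symm.trans
    (Equiv.sigmaCongrRight θ)).trans (Equiv.sigmaFiberEquiv T.toUEdge)
  have hΘ : ∀ e : T.LeftEdge, T.src (Θ e).1 = T.tgt e.1 := fun e => hθ (T.toUEdge e) ⟨e, rfl⟩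
  intro v
  have h := hT.isBalanced v
  rw [Nat.card_subtype_split (fun e => T.tgt e = v) fun e => (T.var e).isLeft = true,
    Nat.card_subtype_split (fun e => T.src e = v) fun e => (T.var e).isLeft = true] at h
  have h2 : Nat.card {e : T.LeftEdge // T.tgt e.1 = v} = Nat.card {e : T.LeftEdge // T.src e.1 = v} :=
    Nat.card_congr (Θ.subtypeEquiv fun e => by rw [hΘ])
  rw [h2] at h
  exact Nat.add_left_cancel h

theorem IsCyclic.isCyclic_component (hT : T.IsCyclic)
    (hn : Nat.card (Quotient T.yGraph.conn) = Fintype.card T.UEdge + 1)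
    (c : Quotient T.yGraph.conn) : (T.yGraph.component c).IsCyclic :=
  isCyclic_of_isBalanced (T.yGraph.component_isTestGraph c)
    ((hT.isBalanced_yGraph (hT.fwd_eq_bwd hn)).component c)

end Mixed

end StarGraph

/-! ### The two regimes of the limit. -/

section Limits

variable {p q : ℕ} {a : Fin p → ℕ → ℝ} {τ : StarGraph (Fin q) → ℂ} {Ω : ℕ → Type*}
  [∀ N, MeasurableSpace (Ω N)] {P : ∀ N, Measure (Ω N)} [∀ N, IsProbabilityMeasure (P N)]
  {Y : ∀ N, Ω N → Fin q → Matrix (Fin N) (Fin N) ℂ}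

/-- The orders are `N⁻¹` from the normalization, `N⁻ᵘ` from the `u` undirected edges and, by the
leaf inequality, `Nᵘ` from the y-graph. -/
theorem tendsto_zero_of_card_le (hY : HasAllMoments P Y) (h3 : TrafficGrowthBound P Y)
    {T : StarGraph (Fin p ⊕ Fin q)} (hT : T.IsCyclic)
    (hn : Nat.card (Quotient T.yGraph.conn) ≤ Fintype.card T.UEdge) {K : T.UEdge → ℕ → ℂ}
    (hK : ∀ x, (fun N => K x N) =O[atTop] fun N : ℕ => (N : ℝ)⁻¹) :
    Tendsto (fun N : ℕ => (N : ℂ)⁻¹ * ((∏ x, K x N) * ∫ ω, T.yGraph.injSum (Y N ω) ∂(P N))) atTop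
      (𝓝 0) := by
  classical
  have h1 := isBigO_integral_injSum hY h3 (Fintype.card T.UEdge) T.yGraph fun W _ f hf =>
    hT.sum_numLeaves_mapVerts_le hf ((T.yGraph.card_components_mapVerts_le hf).trans hn)
  have h2 : (fun N => ∏ x, K x N) =O[atTop] fun N : ℕ => ((N : ℝ)⁻¹) ^ Fintype.card T.UEdge := by
    have := Asymptotics.IsBigO.finsetProd (s := Finset.univ) fun x (_ : x ∈ Finset.univ) => hK x
    simpa using this
  have h4 : (fun N : ℕ => (N : ℂ)⁻¹) =O[atTop] fun N : ℕ => (N : ℝ)⁻¹ :=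
    Asymptotics.isBigO_of_le _ fun N => by simp
  refine (h4.mul (h2.mul h1)).trans_tendsto ?_
  refine (tendsto_inv_atTop_nhds_zero_nat (𝕜 := ℝ)).congr' ?_
  filter_upwards [eventually_ne_atTop 0] with N hN
  have : (N : ℝ) ≠ 0 := Nat.cast_ne_zero.2 hN
  rw [← mul_pow, inv_mul_cancel₀ this, one_pow, mul_one]

-- The powers of `N` balance exactly: one factor `N` for each of the `u` moments, and `N^(-(u+1))`
-- for the `u + 1` y-components. A nontrivial separating partition merges two components, so at most
-- `u` remain and the leaf inequality makes its contribution `O(Nᵘ)`.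
open scoped Classical in
theorem tendsto_of_card_eq (h1 : ConvergesInTraffics P Y τ) (h2 : TrafficConcentration P Y)
    (h3 : TrafficGrowthBound P Y) {T : StarGraph (Fin p ⊕ Fin q)} (hT : T.IsCyclic)
    (hn : Nat.card (Quotient T.yGraph.conn) = Fintype.card T.UEdge + 1) {K : T.UEdge → ℕ → ℂ}
    (hK : ∀ x, T.fstEnd x ≠ T.sndEnd x → T.fwd x = T.bwd x →
        Tendsto (fun N : ℕ => (N : ℂ) * K x N) atTop (𝓝 (a (T.color x) (T.fwd x)))) :
    Tendsto (fun N : ℕ => (N : ℂ)⁻¹ * ((∏ x, K x N) * ∫ ω, T.yGraph.injSum (Y N ω) ∂(P N))) atTop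
      (𝓝 ((∏ x, (a (T.color x) (T.fwd x) : ℂ)) * ∏ c, τ (T.yGraph.component c))) := by
  have hσ : ∀ σ : Setoid T.yGraph.V, σ ≠ ⊥ → T.yGraph.Separates σ →
      (fun N : ℕ => ∫ ω, (T.yGraph.quot σ).injSum (Y N ω) ∂(P N)) =O[atTop]
        fun N : ℕ => (N : ℝ) ^ Fintype.card T.UEdge := by
    intro σ hσ hsep
    obtain ⟨v, w, hvw, hne⟩ : ∃ v w, σ v w ∧ v ≠ w := by
      by_contra! h
      refine hσ ?_
      ext v w
      exact ⟨fun hvw => h v w hvw, fun hvw => by rw [(hvw : v = w)]⟩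
    refine isBigO_integral_injSum h1.1 h3 _ _ fun W _ f hf => ?_
    have hg : Function.Surjective (f ∘ (Quotient.mk σ : T.yGraph.V → (T.yGraph.quot σ).V)) :=
      hf.comp Quotient.mk_surjective
    have hlt := T.yGraph.card_components_mapVerts_lt (v := v) (w := w) hg
      (congrArg f (Quotient.sound hvw)) fun hc => hne (hsep v w hvw hc)
    exact hT.sum_numLeaves_mapVerts_le hg (by omega)
  have hlim := tendsto_integral_injSum h1 h2 T.yGraph (hT.isCyclic_component hn) hn hσ
  have hKlim := tendsto_finsetProd Finset.univ fun x (_ : x ∈ Finset.univ) =>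
    hK x (hT.1.fstEnd_ne_sndEnd hn x) (hT.fwd_eq_bwd hn x)
  refine (hKlim.mul hlim).congr' ?_
  filter_upwards [eventually_ne_atTop 0] with N hN
  have : (N : ℂ) ≠ 0 := Nat.cast_ne_zero.2 hN
  rw [Finset.prod_mul_distrib, Finset.prod_const, Finset.card_univ, pow_succ]
  field_simp

end Limits

/-! ### Pieces and the reduced graph. -/

theorem edgeConn_subtype {V E : Type*} (s t : E → V) (S : Set E) :
    edgeConn (fun e : {e // e ∈ S} => s e.1) (fun e => t e.1) Set.univ = edgeConn s t S := by
  refine le_antisymm (edgeConn_le fun e _ => edgeConn_of_mem e.2) (edgeConn_le fun e he => ?_)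
  exact edgeConn_of_mem (s := fun e : {e // e ∈ S} => s e.1) (t := fun e => t e.1)
    (Set.mem_univ ⟨e, he⟩)

namespace StarGraph

variable {L C : Type*} (fam : L → C) (T : StarGraph L)

/-- The edges labelled in the family `c`. -/
def famEdges (c : C) : Set T.E := {e | fam (T.var e) = c}

/-- The piece of an edge. -/
def pieceOf (e : T.E) : T.Piece fam := Quotient.mk (T.pieceSetoid fam) e

noncomputable instance : Fintype (T.Piece fam) := Fintype.ofFinite _

variable {fam T}

theorem pieceOf_eq_iff {e e' : T.E} : T.pieceOf fam e = T.pieceOf fam e' ↔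
    fam (T.var e) = fam (T.var e') ∧
      edgeConn T.src T.tgt (T.famEdges fam (fam (T.var e))) (T.src e) (T.src e') := by
  rw [pieceOf, pieceOf, Quotient.eq, ← skeleton_reachable_iff]
  rfl

theorem pieceOf_surjective : Function.Surjective (T.pieceOf fam) := Quotient.mk_surjective

theorem pieceFamily_pieceOf (e : T.E) : T.pieceFamily fam (T.pieceOf fam e) = fam (T.var e) := rfl

/-- An edge of the family that touches a vertex of the piece belongs to the piece, so the vertices
of the piece form a set that no edge of the family crosses. -/
theorem mem_pieceVerts_pieceOf_iff {e : T.E} {v : T.V} :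
    v ∈ T.pieceVerts fam (T.pieceOf fam e) ↔
      edgeConn T.src T.tgt (T.famEdges fam (fam (T.var e))) (T.src e) v := by
  constructor
  · rintro ⟨f, hf, hv⟩
    have h := pieceOf_eq_iff.1 hf.symm
    rcases hv with rfl | rfl
    · exact h.2
    · exact Setoid.trans' _ h.2 (edgeConn_of_mem h.1.symm)
  · intro h
    refine (edgeConn_invariant (p := fun v => v ∈ T.pieceVerts fam (T.pieceOf fam e)) ?_ h).1
      ⟨e, rfl, Or.inl rfl⟩
    have key : ∀ f ∈ T.famEdges fam (fam (T.var e)),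
        (T.src f ∈ T.pieceVerts fam (T.pieceOf fam e) ∨
          T.tgt f ∈ T.pieceVerts fam (T.pieceOf fam e)) → T.pieceOf fam f = T.pieceOf fam e := by
      intro f hf hsf
      have hff : edgeConn T.src T.tgt (T.famEdges fam (fam (T.var e))) (T.src f) (T.tgt f) :=
        edgeConn_of_mem hf
      have aux : ∀ v, v ∈ T.pieceVerts fam (T.pieceOf fam e) →
          edgeConn T.src T.tgt (T.famEdges fam (fam (T.var e))) (T.src f) v →
          T.pieceOf fam f = T.pieceOf fam e := by
        rintro v ⟨g, hg, hv⟩ hfv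
        have h1 := pieceOf_eq_iff.1 hg.symm
        have hgg : edgeConn T.src T.tgt (T.famEdges fam (fam (T.var e))) (T.src g) (T.tgt g) :=
          edgeConn_of_mem h1.1.symm
        refine Eq.symm (pieceOf_eq_iff.2 ⟨(hf : fam (T.var f) = _).symm, Setoid.trans' _ h1.2 ?_⟩)
        rcases hv with rfl | rfl
        · exact Setoid.symm' _ hfv
        · exact Setoid.trans' _ hgg (Setoid.symm' _ hfv)
      rcases hsf with h | h
      · exact aux _ h (Setoid.refl' _ _)
      · exact aux _ h hff
    intro f hf
    exact ⟨fun h => ⟨f, key f hf (Or.inl h), Or.inr rfl⟩,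
      fun h => ⟨f, key f hf (Or.inr h), Or.inl rfl⟩⟩

theorem pieceVerts_nonempty (k : T.Piece fam) : (T.pieceVerts fam k).Nonempty := by
  obtain ⟨e, rfl⟩ := pieceOf_surjective k
  exact ⟨T.src e, e, rfl, Or.inl rfl⟩

variable (fam T) in
/-- The edges labelled in the family `c`, with all the vertices. -/
noncomputable def famGraph (c : C) : StarGraph {l // fam l = c} where
  V := T.V
  E := {e // e ∈ T.famEdges fam c}
  fintypeE := Fintype.ofFinite _
  src e := T.src e.1
  tgt e := T.tgt e.1
  var e := ⟨T.var e.1, e.2⟩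
  star e := T.star e.1

theorem famGraph_conn (c : C) :
    (T.famGraph fam c).conn = edgeConn T.src T.tgt (T.famEdges fam c) :=
  edgeConn_subtype T.src T.tgt _

theorem famGraph_mk_eq_iff (c : C) (v w : T.V) :
    (Quotient.mk (T.famGraph fam c).conn v = Quotient.mk (T.famGraph fam c).conn w) ↔
      edgeConn T.src T.tgt (T.famEdges fam c) w v := by
  refine Quotient.eq.trans ?_
  rw [famGraph_conn]
  exact ⟨fun h => Setoid.symm' _ h, fun h => Setoid.symm' _ h⟩

/-- A piece is a component of the graph of the edges of its family. -/
noncomputable def componentIsoPiece (e : T.E) :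
    ((T.famGraph fam (fam (T.var e))).component (Quotient.mk _ (T.src e))).Iso
      (T.pieceGraph fam (T.pieceOf fam e)) where
  v := Equiv.subtypeEquivRight fun v : T.V =>
    Iff.trans (famGraph_mk_eq_iff (fam (T.var e)) v (T.src e))
      (mem_pieceVerts_pieceOf_iff (fam := fam) (e := e) (v := v)).symm
  e := ⟨fun f => ⟨f.1.1, Eq.symm (pieceOf_eq_iff.2 ⟨f.1.2.symm, (famGraph_mk_eq_iff _ _ _).1 f.2⟩)⟩,
    fun f => ⟨⟨f.1, (pieceOf_eq_iff.1 f.2.symm).1.symm⟩,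
      (famGraph_mk_eq_iff _ _ _).2 (pieceOf_eq_iff.1 f.2.symm).2⟩, fun _ => rfl, fun _ => rfl⟩
  src _ := rfl
  tgt _ := rfl
  var _ := rfl
  star _ := rfl

theorem pieceGraph_isTestGraph (k : T.Piece fam) : (T.pieceGraph fam k).IsTestGraph := by
  obtain ⟨e, rfl⟩ := pieceOf_surjective k
  exact (componentIsoPiece e).isTestGraph (component_isTestGraph _ _)

section Counting

variable (fam T)

/-- The vertices common to several pieces. -/
abbrev SharedVert : Type := {v : T.V // ∃ k k' : T.Piece fam, k ≠ k' ∧ v ∈ T.pieceVerts fam k ∧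
  v ∈ T.pieceVerts fam k'}

theorem reducedGraph_adj_iff {k : T.Piece fam} {v : T.SharedVert fam} :
    (T.reducedGraph fam).Adj (Sum.inl k) (Sum.inr v) ↔ v.1 ∈ T.pieceVerts fam k := by
  rw [reducedGraph, SimpleGraph.fromRel_adj]
  simp

/-- The edges of the reduced graph are the incidences of shared vertices. -/
theorem card_edgeSet_reducedGraph : Nat.card (T.reducedGraph fam).edgeSet =
    Nat.card {x : T.Piece fam × T.SharedVert fam // x.2.1 ∈ T.pieceVerts fam x.1} := by
  refine (Nat.card_congr (Equiv.ofBijective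
    (fun x : {x : T.Piece fam × T.SharedVert fam // x.2.1 ∈ T.pieceVerts fam x.1} =>
      (⟨s(Sum.inl x.1.1, Sum.inr x.1.2), (T.reducedGraph_adj_iff fam).2 x.2⟩ :
        (T.reducedGraph fam).edgeSet)) ⟨?_, ?_⟩)).symm
  · rintro ⟨⟨k, v⟩, h⟩ ⟨⟨k', v'⟩, h'⟩ heq
    have := congrArg Subtype.val heq
    simp at this
    simp [this.1, this.2]
  · rintro ⟨s, hs⟩
    induction s using Sym2.inductionOn with | _ x y
    rw [SimpleGraph.mem_edgeSet] at hs
    rcases x with k | v <;> rcases y with k' | v'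
    · exact absurd hs (by simp [reducedGraph, SimpleGraph.fromRel_adj])
    · exact ⟨⟨⟨k, v'⟩, (T.reducedGraph_adj_iff fam).1 hs⟩, rfl⟩
    · exact ⟨⟨⟨k', v⟩, (T.reducedGraph_adj_iff fam).1 hs.symm⟩, Subtype.ext Sym2.eq_swap⟩
    · exact absurd hs (by simp [reducedGraph, SimpleGraph.fromRel_adj])

variable {T}

theorem IsTestGraph.exists_piece (hT : T.IsTestGraph) [hE : Nonempty T.E] (v : T.V) :
    ∃ k, v ∈ T.pieceVerts fam k := by
  rw [IsTestGraph, skeleton_connected_iff] at hT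
  obtain ⟨e⟩ := hE
  have hinv : ∀ f ∈ Set.univ, (∃ k, T.src f ∈ T.pieceVerts fam k) ↔
      ∃ k, T.tgt f ∈ T.pieceVerts fam k := fun f _ =>
    iff_of_true ⟨T.pieceOf fam f, f, rfl, Or.inl rfl⟩ ⟨T.pieceOf fam f, f, rfl, Or.inr rfl⟩
  exact (edgeConn_invariant (p := fun v => ∃ k, v ∈ T.pieceVerts fam k) hinv
    (hT.2 (T.src e) v)).1 ⟨T.pieceOf fam e, e, rfl, Or.inl rfl⟩

/-- Count the pairs of a piece and a vertex in it. A vertex that is not shared lies in exactly one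
piece, and the pairs with a shared vertex are the edges of the reduced graph. -/
theorem IsTestGraph.card_incidences (hT : T.IsTestGraph) [Nonempty T.E] :
    ∑ k : T.Piece fam, Nat.card (T.pieceVerts fam k) + Nat.card (T.SharedVert fam) =
      Nat.card (T.reducedGraph fam).edgeSet + Nat.card T.V := by
  classical
  rw [card_edgeSet_reducedGraph, ← Nat.card_sigma]
  have h1 : Nat.card (Σ k : T.Piece fam, T.pieceVerts fam k) =
      Nat.card {x : T.Piece fam × T.V // x.2 ∈ T.pieceVerts fam x.1} :=
    Nat.card_congr ⟨fun x => ⟨(x.1, x.2.1), x.2.2⟩, fun x => ⟨x.1.1, x.1.2, x.2⟩,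
      fun _ => rfl, fun _ => rfl⟩
  let shared : T.V → Prop := fun v => ∃ k k' : T.Piece fam, k ≠ k' ∧ v ∈ T.pieceVerts fam k ∧
    v ∈ T.pieceVerts fam k'
  rw [h1, Nat.card_subtype_split (fun x : T.Piece fam × T.V => x.2 ∈ T.pieceVerts fam x.1)
    fun x => shared x.2]
  have h2 : Nat.card {x : {x : T.Piece fam × T.V // shared x.2} //
      x.1.2 ∈ T.pieceVerts fam x.1.1} =
      Nat.card {x : T.Piece fam × T.SharedVert fam // x.2.1 ∈ T.pieceVerts fam x.1} :=
    Nat.card_congr ⟨fun x => ⟨(x.1.1.1, ⟨x.1.1.2, x.1.2⟩), x.2⟩,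
      fun x => ⟨⟨(x.1.1, x.1.2.1), x.1.2.2⟩, x.2⟩, fun _ => rfl, fun _ => rfl⟩
  have h3 : Nat.card {x : {x : T.Piece fam × T.V // ¬shared x.2} //
      x.1.2 ∈ T.pieceVerts fam x.1.1} = Nat.card {v : T.V // ¬shared v} := by
    refine Nat.card_congr (Equiv.ofBijective (fun x => ⟨x.1.1.2, x.1.2⟩) ⟨?_, ?_⟩)
    · rintro ⟨⟨⟨k, v⟩, hv⟩, hk⟩ ⟨⟨⟨k', v'⟩, hv'⟩, hk'⟩ h
      obtain rfl : v = v' := congrArg Subtype.val h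
      obtain rfl : k = k' := by
        by_contra hne
        exact hv ⟨k, k', hne, hk, hk'⟩
      rfl
    · rintro ⟨v, hv⟩
      obtain ⟨k, hk⟩ := hT.exists_piece fam v
      exact ⟨⟨⟨(k, v), hv⟩, hk⟩, rfl⟩
  have h4 : Nat.card T.V = Nat.card {v // shared v} + Nat.card {v : T.V // ¬shared v} := by
    rw [← Nat.card_sum]
    exact Nat.card_congr (Equiv.sumCompl shared).symm
  rw [h2, h3, h4]
  change _ + _ + Nat.card {v // shared v} = _
  omega

/-- Distinct pieces with a common vertex are both adjacent to it, and a walk in `T` passes from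
piece to piece through such vertices. -/
theorem IsTestGraph.reducedGraph_preconnected (hT : T.IsTestGraph) :
    (T.reducedGraph fam).Preconnected := by
  rcases isEmpty_or_nonempty T.E with hE | hE
  · rintro (k | v)
    · obtain ⟨e, -⟩ := pieceOf_surjective k
      exact (hE.false e).elim
    · obtain ⟨k, -⟩ := v.2
      obtain ⟨e, -⟩ := pieceOf_surjective k
      exact (hE.false e).elim
  have hsame : ∀ v (k k' : T.Piece fam), v ∈ T.pieceVerts fam k → v ∈ T.pieceVerts fam k' →
      (T.reducedGraph fam).Reachable (Sum.inl k) (Sum.inl k') := by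
    intro v k k' hk hk'
    by_cases h : k = k'
    · rw [h]
    · let w : T.SharedVert fam := ⟨v, k, k', h, hk, hk'⟩
      exact ((T.reducedGraph_adj_iff fam (v := w)).2 hk).reachable.trans
        ((T.reducedGraph_adj_iff fam (v := w)).2 hk').symm.reachable
  let r : Setoid T.V := ⟨fun v w => ∀ k k' : T.Piece fam, v ∈ T.pieceVerts fam k →
      w ∈ T.pieceVerts fam k' → (T.reducedGraph fam).Reachable (Sum.inl k) (Sum.inl k'),
    fun v k k' => hsame v k k', fun h k k' hk hk' => (h k' k hk' hk).symm, by
      intro x y z h h' k k' hk hk'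
      obtain ⟨l, hl⟩ := hT.exists_piece fam y
      exact (h k l hk hl).trans (h' l k' hl hk')⟩
  have hle : T.conn ≤ r := by
    refine edgeConn_le fun e _ k k' hk hk' => ?_
    exact (hsame (T.src e) k (T.pieceOf fam e) hk ⟨e, rfl, Or.inl rfl⟩).trans
      (hsame (T.tgt e) (T.pieceOf fam e) k' ⟨e, rfl, Or.inr rfl⟩ hk')
  have hT' := hT
  rw [IsTestGraph, skeleton_connected_iff] at hT'
  have hpp : ∀ k k' : T.Piece fam, (T.reducedGraph fam).Reachable (Sum.inl k) (Sum.inl k') := by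
    intro k k'
    obtain ⟨v, hv⟩ := pieceVerts_nonempty k
    obtain ⟨w, hw⟩ := pieceVerts_nonempty k'
    exact hle (hT'.2 v w) k k' hv hw
  have hp : ∀ x, ∃ k : T.Piece fam, (T.reducedGraph fam).Reachable x (Sum.inl k) := by
    rintro (k | v)
    · exact ⟨k, SimpleGraph.Reachable.refl _⟩
    · obtain ⟨k, hk⟩ := hT.exists_piece fam v.1
      exact ⟨k, ((T.reducedGraph_adj_iff fam).2 hk).symm.reachable⟩
  intro x y
  obtain ⟨k, hk⟩ := hp x
  obtain ⟨k', hk'⟩ := hp y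
  exact hk.trans ((hpp k k').trans hk'.symm)

theorem sum_card_pieceVerts (T : StarGraph L) :
    ∑ k : T.Piece fam, Nat.card (T.pieceVerts fam k) =
      ∑ k : T.Piece fam, (Nat.card (T.pieceVerts fam k) - 1) + Nat.card (T.Piece fam) := by
  rw [Nat.card_eq_fintype_card, ← Finset.card_univ, Finset.card_eq_sum_ones,
    ← Finset.sum_add_distrib]
  refine Finset.sum_congr rfl fun k _ => ?_
  have : Nonempty (T.pieceVerts fam k) := (pieceVerts_nonempty k).to_subtype
  have : 0 < Nat.card (T.pieceVerts fam k) := Nat.card_pos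
  omega

/-- The pieces of a graph have enough vertices to connect it, and just enough for a free product. -/
theorem IsTestGraph.card_le_and_isFreeProduct_iff (hT : T.IsTestGraph) :
    Nat.card T.V ≤ ∑ k : T.Piece fam, (Nat.card (T.pieceVerts fam k) - 1) + 1 ∧
      (T.IsFreeProduct fam ↔
        Nat.card T.V = ∑ k : T.Piece fam, (Nat.card (T.pieceVerts fam k) - 1) + 1) := by
  classical
  have hpre := hT.reducedGraph_preconnected fam
  rcases isEmpty_or_nonempty T.E with hE | hE
  · have hP : IsEmpty (T.Piece fam) := ⟨fun k => by
      obtain ⟨e, -⟩ := pieceOf_surjective k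
      exact hE.false e⟩
    have hV : Nat.card T.V = 1 := by
      rw [IsTestGraph, skeleton_connected_iff] at hT
      rw [Nat.card_eq_one_iff_unique]
      refine ⟨⟨fun v w => ?_⟩, hT.1⟩
      exact edgeConn_le (r := ⊥) (fun e _ => (hE.false e).elim) (hT.2 v w)
    have hS : IsEmpty (T.SharedVert fam) := ⟨fun v => by
      obtain ⟨k, -⟩ := v.2
      exact hP.false k⟩
    rw [hV]
    simp only [Finset.univ_eq_empty, Finset.sum_empty, zero_add, le_refl, true_and, iff_true]
    exact ⟨hpre, fun x => isEmptyElim x⟩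
  · have hinc := hT.card_incidences fam
    rw [sum_card_pieceVerts] at hinc
    have hcard : Nat.card (T.Piece fam ⊕ T.SharedVert fam) =
      Nat.card (T.Piece fam) + Nat.card (T.SharedVert fam) := Nat.card_sum
    have hne : Nonempty (T.Piece fam ⊕ T.SharedVert fam) := by
      obtain ⟨e⟩ := hE
      exact ⟨Sum.inl (T.pieceOf fam e)⟩
    have hconn : (T.reducedGraph fam).Connected := ⟨hpre⟩
    -- A connected graph has at most one more vertex than edges, with equality exactly for trees;
    -- the incidence count turns this into the stated comparison for the vertices of `T`.
    have hle : Nat.card (T.Piece fam ⊕ T.SharedVert fam) ≤ _ :=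
      hconn.card_vert_le_card_edgeSet_add_one
    have htree : (T.reducedGraph fam).IsTree ↔ (T.reducedGraph fam).Connected ∧
        Nat.card (T.reducedGraph fam).edgeSet + 1 = Nat.card (T.Piece fam ⊕ T.SharedVert fam) :=
      SimpleGraph.isTree_iff_connected_and_card (G := T.reducedGraph fam)
    have hiff : T.IsFreeProduct fam ↔ (T.reducedGraph fam).IsTree := by
      rw [SimpleGraph.isTree_iff]
      exact ⟨fun h => ⟨hconn, h.2⟩, fun h => ⟨hpre, h.2⟩⟩
    rw [hiff, htree]
    refine ⟨by omega, ⟨fun h => ?_, fun h => ⟨hconn, ?_⟩⟩⟩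
    · have := h.2
      omega
    · omega

end Counting

end StarGraph

theorem familyOf_eq_none_iff {p q : ℕ} (l : Fin p ⊕ Fin q) : familyOf l = none ↔ ¬l.isLeft := by
  cases l <;> simp [familyOf]

theorem familyOf_eq_some_iff {p q : ℕ} (l : Fin p ⊕ Fin q) (j : Fin p) :
    familyOf l = some j ↔ l = Sum.inl j := by
  cases l <;> simp [familyOf]

namespace StarGraph

variable {p q : ℕ} {T : StarGraph (Fin p ⊕ Fin q)}

/-! ### Pieces labelled by the `y_k` -/

theorem edgeConn_famEdges_eq_yGraph_conn {e : T.E} (he : familyOf (T.var e) = none) :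
    edgeConn T.src T.tgt (T.famEdges familyOf (familyOf (T.var e))) = T.yGraph.conn := by
  have h : T.famEdges familyOf (familyOf (T.var e)) = {e | ¬(T.var e).isLeft} := by
    ext f
    rw [he]
    exact familyOf_eq_none_iff _
  rw [h]
  exact (edgeConn_subtype T.src T.tgt {e | ¬(T.var e).isLeft}).symm

theorem yGraph_mk_eq_iff {e : T.E} (he : familyOf (T.var e) = none) (v : T.V) :
    Quotient.mk T.yGraph.conn v = Quotient.mk T.yGraph.conn (T.src e) ↔
      edgeConn T.src T.tgt (T.famEdges familyOf (familyOf (T.var e))) (T.src e) v := by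
  rw [edgeConn_famEdges_eq_yGraph_conn he]
  exact ⟨fun h => Setoid.symm' _ (Quotient.exact h), fun h => Quotient.sound (Setoid.symm' _ h)⟩

/-- A piece labelled by the `y_k` is a component of the graph of the `y_k`. -/
noncomputable def pieceIsoYComponent {e : T.E} (he : familyOf (T.var e) = none) :
    ((T.pieceGraph familyOf (T.pieceOf familyOf e)).relabel fun l => toY ⟨l.1, l.2.trans he⟩).Iso
      (T.yGraph.component (Quotient.mk T.yGraph.conn (T.src e))) where
  v := Equiv.subtypeEquivRight fun v : T.V =>
    Iff.trans (mem_pieceVerts_pieceOf_iff (fam := familyOf) (e := e) (v := v))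
      (yGraph_mk_eq_iff he v).symm
  e := ⟨fun f => ⟨⟨f.1, (familyOf_eq_none_iff _).1 ((pieceOf_eq_iff.1 f.2.symm).1.symm.trans he)⟩,
      (yGraph_mk_eq_iff he _).2 (pieceOf_eq_iff.1 f.2.symm).2⟩,
    fun f => ⟨f.1.1, Eq.symm (pieceOf_eq_iff.2
      ⟨he.trans ((familyOf_eq_none_iff _).2 f.1.2).symm, (yGraph_mk_eq_iff he _).1 f.2⟩)⟩,
    fun _ => rfl, fun _ => rfl⟩
  src _ := rfl
  tgt _ := rfl
  var f := by
    have hf : ¬(T.var f.1).isLeft :=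
      (familyOf_eq_none_iff _).1 ((pieceOf_eq_iff.1 f.2.symm).1.symm.trans he)
    have key : ∀ (l : Fin p ⊕ Fin q) (h : familyOf l = none) (h' : l.isRight),
        l.getRight h' = toY ⟨l, h⟩ := by
      rintro (l | l) h h'
      · simp at h'
      · rfl
    exact key (T.var f.1) ((familyOf_eq_none_iff _).2 hf) (by simpa using hf)
  star _ := rfl

variable (T) in
/-- The pieces labelled by the `y_k`. -/
abbrev YPiece : Type := {k : T.Piece familyOf // T.pieceFamily familyOf k = none}

variable (T) in
/-- The pieces labelled by the `x_j`. -/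
abbrev XPiece : Type := {k : T.Piece familyOf // ¬T.pieceFamily familyOf k = none}

noncomputable instance : Fintype T.YPiece := Fintype.ofFinite _

noncomputable instance : Fintype T.XPiece := Fintype.ofFinite _

theorem YPiece.familyOf_out (k : T.YPiece) : familyOf (T.var k.1.out) = none := by
  have h := k.2
  rw [← Quotient.out_eq k.1] at h
  exact h

theorem pieceOf_out (k : T.Piece familyOf) : T.pieceOf familyOf k.out = k := Quotient.out_eq k

/-- The component of the graph of the `y_k` given by a piece. -/
noncomputable def YPiece.toComponent (k : T.YPiece) : Quotient T.yGraph.conn :=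
  Quotient.mk T.yGraph.conn (T.src k.1.out)

theorem YPiece.toComponent_injective :
    Function.Injective (YPiece.toComponent : T.YPiece → Quotient T.yGraph.conn) := by
  intro k k' h
  have h1 := (yGraph_mk_eq_iff k'.familyOf_out _).1 h
  have h2 := pieceOf_eq_iff.2 ⟨k'.familyOf_out.trans k.familyOf_out.symm, h1⟩
  rw [pieceOf_out, pieceOf_out] at h2
  exact Subtype.ext h2.symm

theorem isEmpty_component_of_notMem_range {c : Quotient T.yGraph.conn}
    (hc : c ∉ Set.range (YPiece.toComponent : T.YPiece → Quotient T.yGraph.conn)) :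
    IsEmpty (T.yGraph.component c).E := by
  refine ⟨fun e => hc ?_⟩
  have he : familyOf (T.var e.1.1) = none := (familyOf_eq_none_iff _).2 e.1.2
  let k : T.YPiece := ⟨T.pieceOf familyOf e.1.1, he⟩
  refine ⟨k, ?_⟩
  have h := pieceOf_eq_iff.1 (show T.pieceOf familyOf e.1.1 = T.pieceOf familyOf k.1.out from
    (pieceOf_out k.1).symm)
  exact ((yGraph_mk_eq_iff he _).2 h.2).trans e.2

theorem card_component_of_isEmpty {L : Type*} {G : StarGraph L} (c : Quotient G.conn)
    (h : IsEmpty (G.component c).E) : Nat.card (G.component c).V = 1 := by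
  have hT := G.component_isTestGraph c
  rw [IsTestGraph, skeleton_connected_iff] at hT
  rw [Nat.card_eq_one_iff_unique]
  exact ⟨⟨fun v w => edgeConn_le (r := ⊥) (fun e _ => (h.false e).elim) (hT.2 v w)⟩, hT.1⟩

theorem YPiece.card_component (k : T.YPiece) :
    Nat.card (T.yGraph.component k.toComponent).V = Nat.card (T.pieceVerts familyOf k.1) := by
  have h := Nat.card_congr (pieceIsoYComponent k.familyOf_out).v
  refine Eq.trans h.symm ?_
  change Nat.card (T.pieceVerts familyOf (T.pieceOf familyOf k.1.out)) = _
  rw [pieceOf_out]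

-- A component of the y-graph that is not a piece is an isolated vertex, and contributes nothing to
-- the sum of the numbers of vertices minus one.
open Classical in
theorem sum_YPiece_add_card : ∑ k : T.YPiece, (Nat.card (T.pieceVerts familyOf k.1) - 1) +
    Nat.card (Quotient T.yGraph.conn) = Nat.card T.V := by
  have h1 : Nat.card T.V = ∑ c : Quotient T.yGraph.conn, Nat.card (T.yGraph.component c).V := by
    have := Nat.card_sigma (β := fun c : Quotient T.yGraph.conn => (T.yGraph.component c).V)
    rw [← this]
    exact Nat.card_congr (Equiv.sigmaFiberEquiv (Quotient.mk T.yGraph.conn)).symm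
  have h2 : ∑ k : T.YPiece, (Nat.card (T.pieceVerts familyOf k.1) - 1) =
      ∑ c : Quotient T.yGraph.conn, (Nat.card (T.yGraph.component c).V - 1) := by
    refine Fintype.sum_of_injective YPiece.toComponent YPiece.toComponent_injective _ _ ?_ ?_
    · intro c hc
      exact (congrArg (· - 1)
        (card_component_of_isEmpty c (isEmpty_component_of_notMem_range hc))).trans (Nat.sub_self 1)
    · intro k
      rw [k.card_component]
  rw [h1, h2, Nat.card_eq_fintype_card, ← Finset.card_univ, Finset.card_eq_sum_ones,
    ← Finset.sum_add_distrib]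
  refine Finset.sum_congr rfl fun c _ => ?_
  have hne : Nonempty (T.yGraph.component c).V := ⟨⟨c.out, Quotient.out_eq c⟩⟩
  have : 0 < Nat.card (T.yGraph.component c).V := Nat.card_pos
  omega

/-! ### Pieces labelled by the `x_j` -/

theorem familyOf_rep (x : T.UEdge) : familyOf (T.var (T.rep x).1) = some (T.color x) :=
  (familyOf_eq_some_iff _ _).2 (Above.var (⟨T.rep x, T.toUEdge_rep x⟩ : T.Above x))

theorem toUEdge_eq_iff {e : T.LeftEdge} {x : T.UEdge} : T.toUEdge e = x ↔
    T.var e.1 = Sum.inl (T.color x) ∧ s(T.src e.1, T.tgt e.1) = x.1.2 := by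
  constructor
  · rintro rfl
    exact ⟨Above.var (⟨e, rfl⟩ : T.Above (T.toUEdge e)), rfl⟩
  · rintro ⟨h1, h2⟩
    refine Subtype.ext (Prod.ext ?_ h2)
    change (T.var e.1).getLeft e.2 = T.color x
    simp [h1]

/-- The piece of an undirected edge. -/
noncomputable def toXPiece (x : T.UEdge) : T.XPiece :=
  ⟨T.pieceOf familyOf (T.rep x).1, by
    rw [pieceFamily_pieceOf, familyOf_rep]
    simp⟩

theorem edgeConn_of_mk_eq {V E : Type*} {s t : E → V} {F : Set E} {e f : E} (he : e ∈ F)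
    (h : s(s e, t e) = s(s f, t f)) : edgeConn s t F (s e) (s f) := by
  rw [Sym2.eq_iff] at h
  rcases h with ⟨h, -⟩ | ⟨-, h⟩
  · rw [h]
  · rw [← h]
    exact edgeConn_of_mem he

theorem pieceOf_eq_toXPiece (e : T.LeftEdge) :
    T.pieceOf familyOf e.1 = (toXPiece (T.toUEdge e)).1 := by
  have h1 := (toUEdge_eq_iff (e := e)).1 rfl
  have h2 := (toUEdge_eq_iff (e := T.rep (T.toUEdge e))).1 (T.toUEdge_rep _)
  refine pieceOf_eq_iff.2 ⟨by rw [h1.1, h2.1], ?_⟩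
  exact edgeConn_of_mk_eq rfl (h1.2.trans h2.2.symm)

theorem XPiece.isLeft {k : T.XPiece} (e : (T.pieceGraph familyOf k.1).E) :
    (T.var e.1).isLeft := by
  by_contra h
  refine k.2 ?_
  rw [← e.2]
  exact (familyOf_eq_none_iff _).2 h

/-- The undirected edge under an edge of a piece. -/
def XPiece.toUEdge {k : T.XPiece} (e : (T.pieceGraph familyOf k.1).E) : T.UEdge :=
  T.toUEdge ⟨e.1, XPiece.isLeft e⟩

theorem XPiece.toXPiece_toUEdge {k : T.XPiece} (e : (T.pieceGraph familyOf k.1).E) :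
    toXPiece (XPiece.toUEdge e) = k :=
  Subtype.ext ((pieceOf_eq_toXPiece ⟨e.1, XPiece.isLeft e⟩).symm.trans e.2)

theorem XPiece.map_mk {k : T.XPiece} (e : (T.pieceGraph familyOf k.1).E) :
    Sym2.map Subtype.val s((T.pieceGraph familyOf k.1).src e, (T.pieceGraph familyOf k.1).tgt e) =
      (XPiece.toUEdge e).1.2 := rfl

theorem XPiece.var_eq {k : T.XPiece} (e f : (T.pieceGraph familyOf k.1).E) :
    T.var e.1 = T.var f.1 := by
  have h := (pieceOf_eq_iff.1 (e.2.trans f.2.symm)).1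
  have he := XPiece.isLeft e
  have hf := XPiece.isLeft f
  generalize T.var e.1 = l at *
  generalize T.var f.1 = l' at *
  rcases l with l | l <;> rcases l' with l' | l' <;> simp [familyOf] at *
  exact h

theorem XPiece.toUEdge_eq_iff {k : T.XPiece} (e f : (T.pieceGraph familyOf k.1).E) :
    XPiece.toUEdge e = XPiece.toUEdge f ↔
      s((T.pieceGraph familyOf k.1).src e, (T.pieceGraph familyOf k.1).tgt e) =
        s((T.pieceGraph familyOf k.1).src f, (T.pieceGraph familyOf k.1).tgt f) := by
  constructor
  · intro h
    refine Sym2.map.injective Subtype.val_injective ?_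
    exact (XPiece.map_mk e).trans ((congrArg (fun x => x.1.2) h).trans (XPiece.map_mk f).symm)
  · intro h
    refine StarGraph.toUEdge_eq_iff.2 ⟨?_, ?_⟩
    · exact (XPiece.var_eq e f).trans ((StarGraph.toUEdge_eq_iff (e := ⟨f.1, XPiece.isLeft f⟩)
        (x := XPiece.toUEdge f)).1 rfl).1
    · exact (XPiece.map_mk e).symm.trans ((congrArg (Sym2.map Subtype.val) h).trans
        (XPiece.map_mk f))

theorem exists_edge_of_mem_edgeSet {L : Type*} {G : StarGraph L}
    (s : (G.skeleton Set.univ).edgeSet) : ∃ e, s(G.src e, G.tgt e) = s.1 ∧ G.src e ≠ G.tgt e := by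
  obtain ⟨s, hs⟩ := s
  induction s using Sym2.inductionOn with | _ v w
  rw [SimpleGraph.mem_edgeSet, skeleton, SimpleGraph.fromRel_adj] at hs
  obtain ⟨hne, ⟨e, -, rfl, rfl⟩ | ⟨e, -, rfl, rfl⟩⟩ := hs
  · exact ⟨e, rfl, hne⟩
  · exact ⟨e, Sym2.eq_swap, hne.symm⟩

theorem mem_edgeSet_skeleton {L : Type*} {G : StarGraph L} {e : G.E} (h : G.src e ≠ G.tgt e) :
    s(G.src e, G.tgt e) ∈ (G.skeleton Set.univ).edgeSet := by
  rw [SimpleGraph.mem_edgeSet, skeleton, SimpleGraph.fromRel_adj]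
  exact ⟨h, Or.inl ⟨e, Set.mem_univ _, rfl, rfl⟩⟩

/-- The undirected edges of a piece that are not loops are the edges of its skeleton. -/
noncomputable def XPiece.edgeSetToUEdge (k : T.XPiece)
    (s : ((T.pieceGraph familyOf k.1).skeleton Set.univ).edgeSet) : {x : T.UEdge // toXPiece x = k} :=
  ⟨XPiece.toUEdge (exists_edge_of_mem_edgeSet s).choose, XPiece.toXPiece_toUEdge _⟩

theorem XPiece.edgeSetToUEdge_eq {k : T.XPiece}
    {s : ((T.pieceGraph familyOf k.1).skeleton Set.univ).edgeSet}
    {e : (T.pieceGraph familyOf k.1).E}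
    (he : s((T.pieceGraph familyOf k.1).src e, (T.pieceGraph familyOf k.1).tgt e) = s.1) :
    (k.edgeSetToUEdge s).1 = XPiece.toUEdge e :=
  (XPiece.toUEdge_eq_iff _ _).2 ((exists_edge_of_mem_edgeSet s).choose_spec.1.trans he.symm)

theorem XPiece.edgeSetToUEdge_injective (k : T.XPiece) : Function.Injective k.edgeSetToUEdge := by
  intro s s' h
  have h1 := (exists_edge_of_mem_edgeSet s).choose_spec.1
  have h2 := (exists_edge_of_mem_edgeSet s').choose_spec.1
  exact Subtype.ext (h1.symm.trans (((XPiece.toUEdge_eq_iff _ _).1 (congrArg Subtype.val h)).trans h2))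

theorem XPiece.exists_edge {k : T.XPiece} (x : {x : T.UEdge // toXPiece x = k}) :
    ∃ e : (T.pieceGraph familyOf k.1).E, XPiece.toUEdge e = x.1 :=
  ⟨⟨(T.rep x.1).1, congrArg Subtype.val x.2⟩, T.toUEdge_rep x.1⟩

theorem XPiece.edgeSetToUEdge_surjective {k : T.XPiece}
    (hl : ∀ e, (T.pieceGraph familyOf k.1).src e ≠ (T.pieceGraph familyOf k.1).tgt e) :
    Function.Surjective k.edgeSetToUEdge := by
  intro x
  obtain ⟨e, he⟩ := XPiece.exists_edge x
  exact ⟨⟨_, mem_edgeSet_skeleton (hl e)⟩, Subtype.ext ((XPiece.edgeSetToUEdge_eq rfl).trans he)⟩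

/-- A piece has at most as many vertices as it should, with equality for fat trees. -/
theorem XPiece.card_le_and_isFatTree_iff (k : T.XPiece) :
    Nat.card (T.pieceVerts familyOf k.1) - 1 ≤ Nat.card {x : T.UEdge // toXPiece x = k} ∧
      ((T.pieceGraph familyOf k.1).IsFatTree ↔ Nat.card (T.pieceVerts familyOf k.1) - 1 =
        Nat.card {x : T.UEdge // toXPiece x = k}) := by
  have hconn : ((T.pieceGraph familyOf k.1).skeleton Set.univ).Connected :=
    pieceGraph_isTestGraph k.1
  have h1 : Nat.card (T.pieceVerts familyOf k.1) ≤
      Nat.card ((T.pieceGraph familyOf k.1).skeleton Set.univ).edgeSet + 1 :=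
    hconn.card_vert_le_card_edgeSet_add_one
  have h2 := Nat.card_le_card_of_injective _ k.edgeSetToUEdge_injective
  have h3 : ((T.pieceGraph familyOf k.1).skeleton Set.univ).IsTree ↔
      ((T.pieceGraph familyOf k.1).skeleton Set.univ).Connected ∧
        Nat.card ((T.pieceGraph familyOf k.1).skeleton Set.univ).edgeSet + 1 =
          Nat.card (T.pieceVerts familyOf k.1) := SimpleGraph.isTree_iff_connected_and_card
  have hne : Nonempty (T.pieceVerts familyOf k.1) := (pieceVerts_nonempty k.1).to_subtype
  have hpos : 0 < Nat.card (T.pieceVerts familyOf k.1) := Nat.card_pos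
  -- Two inequalities are chained: the number of vertices minus one is at most the number of
  -- skeleton edges, with equality for a tree, and the latter is at most the number of undirected
  -- edges, with equality when there is no loop.
  refine ⟨by omega, ⟨fun h => ?_, fun h => ⟨fun e he => ?_, h3.2 ⟨hconn, by omega⟩⟩⟩⟩
  · have h4 := Nat.card_congr (Equiv.ofBijective _
      ⟨k.edgeSetToUEdge_injective, XPiece.edgeSetToUEdge_surjective h.1⟩)
    have h5 := (h3.1 h.2).2
    omega
  · have hcard : Nat.card {x : T.UEdge // toXPiece x = k} ≤
        Nat.card ((T.pieceGraph familyOf k.1).skeleton Set.univ).edgeSet := by omega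
    have hbij : Function.Bijective k.edgeSetToUEdge :=
      (Nat.bijective_iff_injective_and_card _).2 ⟨k.edgeSetToUEdge_injective, le_antisymm h2 hcard⟩
    obtain ⟨s, hs⟩ := hbij.2 ⟨XPiece.toUEdge e, XPiece.toXPiece_toUEdge e⟩
    have h5 := (XPiece.toUEdge_eq_iff _ _).1 (congrArg Subtype.val hs)
    rw [Sym2.eq_iff, he] at h5
    have h6 := (exists_edge_of_mem_edgeSet s).choose_spec.2
    rcases h5 with ⟨h7, h8⟩ | ⟨h7, h8⟩ <;> exact h6 (h7.trans h8.symm)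

/-- Every edge of `T` above the undirected edge lies in the same piece, so none is lost when
multiplicities are computed inside the piece. -/
theorem XPiece.edgeMultiplicity_eq {k : T.XPiece}
    (s : ((T.pieceGraph familyOf k.1).skeleton Set.univ).edgeSet) :
    (T.pieceGraph familyOf k.1).edgeMultiplicity s =
      T.fwd (k.edgeSetToUEdge s).1 + T.bwd (k.edgeSetToUEdge s).1 := by
  classical
  have h1 : T.fwd (k.edgeSetToUEdge s).1 + T.bwd (k.edgeSetToUEdge s).1 =
      Nat.card (T.Above (k.edgeSetToUEdge s).1) := by
    rw [fwd, bwd, ← Nat.card_sum]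
    exact Nat.card_congr (Equiv.sumCompl _)
  have hs := (exists_edge_of_mem_edgeSet s).choose_spec.1
  rw [h1, edgeMultiplicity, ← Nat.card_coe_set_eq]
  refine Nat.card_congr ⟨fun e => ⟨⟨e.1.1, XPiece.isLeft e.1⟩, ?_⟩, fun e => ⟨⟨e.1.1, ?_⟩, ?_⟩,
    fun _ => rfl, fun _ => rfl⟩
  · exact (XPiece.edgeSetToUEdge_eq e.2).symm
  · refine (pieceOf_eq_toXPiece e.1).trans ?_
    rw [e.2]
    exact congrArg Subtype.val (k.edgeSetToUEdge s).2
  · have hk : T.pieceOf familyOf e.1.1 = k.1 := by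
      refine (pieceOf_eq_toXPiece e.1).trans ?_
      rw [e.2]
      exact congrArg Subtype.val (k.edgeSetToUEdge s).2
    exact ((XPiece.toUEdge_eq_iff (⟨e.1.1, hk⟩ : (T.pieceGraph familyOf k.1).E) _).1 e.2).trans hs

end StarGraph

/-! ### Evaluation of the traffic-free product. -/

theorem marginalTraffics_of_eq_none {p q : ℕ} (a : Fin p → ℕ → ℝ) (τY : StarGraph (Fin q) → ℂ)
    {c : Option (Fin p)} (h : c = none) (S : StarGraph {l : Fin p ⊕ Fin q // familyOf l = c}) :
    marginalTraffics a τY c S = τY (S.relabel fun l => toY ⟨l.1, l.2.trans h⟩) := by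
  subst h
  rfl

theorem marginalTraffics_of_eq_some {p q : ℕ} (a : Fin p → ℕ → ℝ) (τY : StarGraph (Fin q) → ℂ)
    {c : Option (Fin p)} {j : Fin p} (h : c = some j)
    (S : StarGraph {l : Fin p ⊕ Fin q // familyOf l = c}) :
    marginalTraffics a τY c S = S.heavyWignerTraffic (a j) := by
  subst h
  rfl

namespace StarGraph

theorem trafficFreeProduct_of_isFreeProduct {L C : Type*} {fam : L → C}
    (μ : (c : C) → StarGraph {l : L // fam l = c} → ℂ) {T : StarGraph L} (h : T.IsFreeProduct fam) :
    trafficFreeProduct fam μ T = ∏ k : T.Piece fam, μ (T.pieceFamily fam k) (T.pieceGraph fam k) := by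
  rw [trafficFreeProduct, if_pos h]
  congr!

variable {p q : ℕ} {T : StarGraph (Fin p ⊕ Fin q)}

theorem sum_card_fiber_toXPiece :
    ∑ k : T.XPiece, Nat.card {x : T.UEdge // toXPiece x = k} = Fintype.card T.UEdge := by
  classical
  rw [← Nat.card_eq_fintype_card, ← Nat.card_congr (Equiv.sigmaFiberEquiv (toXPiece (T := T))),
    Nat.card_sigma]

/-- Let `y` and `x` be the sums of the numbers of vertices minus one over the y-pieces and over the
x-pieces, `c` the number of y-components and `u` the number of undirected edges. Then `|V| ≤ 1 + y +
x`, with equality for a free product, `x ≤ u`, with equality when all x-pieces are fat trees, and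
`|V| = y + c`. Hence `c ≤ u + 1`, with equality exactly when both inequalities are sharp. -/
theorem IsTestGraph.isFreeProduct_and_isFatTree_iff (hT : T.IsTestGraph) :
    (T.IsFreeProduct familyOf ∧ ∀ k : T.XPiece, (T.pieceGraph familyOf k.1).IsFatTree) ↔
      Nat.card (Quotient T.yGraph.conn) = Fintype.card T.UEdge + 1 := by
  classical
  obtain ⟨h1, h2⟩ := hT.card_le_and_isFreeProduct_iff familyOf
  have h3 : ∑ k : T.Piece familyOf, (Nat.card (T.pieceVerts familyOf k) - 1) =
      ∑ k : T.YPiece, (Nat.card (T.pieceVerts familyOf k.1) - 1) +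
        ∑ k : T.XPiece, (Nat.card (T.pieceVerts familyOf k.1) - 1) := by
    rw [← Fintype.sum_subtype_add_sum_subtype (fun k => T.pieceFamily familyOf k = none)]
    congr!
  have h4 := sum_YPiece_add_card (T := T)
  have h5 := sum_card_fiber_toXPiece (T := T)
  have h6 : ∑ k : T.XPiece, (Nat.card (T.pieceVerts familyOf k.1) - 1) ≤
      ∑ k : T.XPiece, Nat.card {x : T.UEdge // toXPiece x = k} :=
    Finset.sum_le_sum fun k _ => k.card_le_and_isFatTree_iff.1
  have h7 : (∀ k : T.XPiece, (T.pieceGraph familyOf k.1).IsFatTree) ↔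
      ∑ k : T.XPiece, (Nat.card (T.pieceVerts familyOf k.1) - 1) =
        ∑ k : T.XPiece, Nat.card {x : T.UEdge // toXPiece x = k} := by
    rw [Finset.sum_eq_sum_iff_of_le fun k _ => k.card_le_and_isFatTree_iff.1]
    exact forall_congr' fun k => by simpa using k.card_le_and_isFatTree_iff.2
  rw [h2, h7]
  omega

theorem heavyWignerFreeProduct_eq_zero (hT : T.IsTestGraph) (a : Fin p → ℕ → ℝ)
    (τ : StarGraph (Fin q) → ℂ)
    (hn : Nat.card (Quotient T.yGraph.conn) ≠ Fintype.card T.UEdge + 1) :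
    heavyWignerFreeProduct a τ T = 0 := by
  rw [heavyWignerFreeProduct]
  by_cases h : T.IsFreeProduct familyOf
  · rw [trafficFreeProduct_of_isFreeProduct _ h]
    have h1 : ∃ k : T.XPiece, ¬(T.pieceGraph familyOf k.1).IsFatTree := by
      by_contra! h1
      exact hn (hT.isFreeProduct_and_isFatTree_iff.1 ⟨h, h1⟩)
    obtain ⟨k, hk⟩ := h1
    refine Finset.prod_eq_zero (Finset.mem_univ k.1) ?_
    obtain ⟨j, hj⟩ := Option.ne_none_iff_exists'.1 k.2
    rw [marginalTraffics_of_eq_some a τ hj, heavyWignerTraffic, if_neg fun h => hk h.1]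
  · rw [trafficFreeProduct, if_neg h]

-- Equal numbers in both directions make each multiplicity twice `fwd`, so the parity condition
-- holds and half the multiplicity is `fwd`.
open scoped Classical in
theorem XPiece.heavyWignerTraffic_eq {k : T.XPiece} (hk : (T.pieceGraph familyOf k.1).IsFatTree)
    (hfb : ∀ x, T.fwd x = T.bwd x) (b : ℕ → ℝ) :
    (T.pieceGraph familyOf k.1).heavyWignerTraffic b =
      ∏ x : {x : T.UEdge // toXPiece x = k}, (b (T.fwd x.1) : ℂ) := by
  have h1 : ∀ s, (T.pieceGraph familyOf k.1).edgeMultiplicity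
      (s : ((T.pieceGraph familyOf k.1).skeleton Set.univ).edgeSet) =
        T.fwd (k.edgeSetToUEdge s).1 + T.fwd (k.edgeSetToUEdge s).1 := fun s => by
    rw [XPiece.edgeMultiplicity_eq s, hfb]
  rw [heavyWignerTraffic, if_pos ⟨hk, fun s => ⟨_, h1 s⟩⟩]
  refine Fintype.prod_bijective k.edgeSetToUEdge
    ⟨k.edgeSetToUEdge_injective, XPiece.edgeSetToUEdge_surjective hk.1⟩ _ _ fun s => ?_
  rw [h1, ← two_mul, Nat.mul_div_cancel_left _ two_pos]

theorem pieceFamily_toXPiece (x : T.UEdge) :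
    T.pieceFamily familyOf (toXPiece x).1 = some (T.color x) := familyOf_rep x

-- The y-pieces agree with components of the y-graph only up to isomorphism, whence `hiso`; the
-- components that are not pieces are isolated vertices, whose factor must be 1, whence `hone`.
open scoped Classical in
theorem IsTestGraph.heavyWignerFreeProduct_eq (hT : T.IsTestGraph) (a : Fin p → ℕ → ℝ)
    {τ : StarGraph (Fin q) → ℂ}
    (hn : Nat.card (Quotient T.yGraph.conn) = Fintype.card T.UEdge + 1)
    (hfb : ∀ x, T.fwd x = T.bwd x)
    (hiso : ∀ S S' : StarGraph (Fin q), S'.IsCyclic → S.Iso S' → τ S = τ S')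
    (hone : ∀ S : StarGraph (Fin q), S.IsCyclic → IsEmpty S.E → τ S = 1)
    (hcyc : ∀ c, (T.yGraph.component c).IsCyclic) :
    heavyWignerFreeProduct a τ T =
      (∏ x, (a (T.color x) (T.fwd x) : ℂ)) * ∏ c, τ (T.yGraph.component c) := by
  obtain ⟨h1, h2⟩ := hT.isFreeProduct_and_isFatTree_iff.2 hn
  rw [heavyWignerFreeProduct, trafficFreeProduct_of_isFreeProduct _ h1]
  have hsplit : ∀ f : T.Piece familyOf → ℂ, ∏ k, f k =
      (∏ k : T.XPiece, f k.1) * ∏ k : T.YPiece, f k.1 := fun f => by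
    rw [← Fintype.prod_subtype_mul_prod_subtype (fun k => T.pieceFamily familyOf k = none),
      mul_comm]
    congr!
  rw [hsplit]
  refine congrArg₂ _ ?_ ?_
  · rw [← prod_fiber_eq (toXPiece (T := T)) fun x => (a (T.color x) (T.fwd x) : ℂ)]
    refine Fintype.prod_congr _ _ fun k => ?_
    obtain ⟨j, hj⟩ := Option.ne_none_iff_exists'.1 k.2
    rw [marginalTraffics_of_eq_some a τ hj, XPiece.heavyWignerTraffic_eq (k := k) (h2 k) hfb]
    refine Finset.prod_congr (by congr!) fun x _ => ?_
    have h3 := pieceFamily_toXPiece x.1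
    rw [x.2, hj, Option.some_inj] at h3
    rw [h3]
  · refine Fintype.prod_of_injective YPiece.toComponent YPiece.toComponent_injective _ _ ?_ ?_
    · exact fun c hc => hone _ (hcyc c) (isEmpty_component_of_notMem_range hc)
    · intro k
      rw [← hiso _ _ (hcyc k.toComponent) (pieceIsoYComponent k.familyOf_out)]
      have key : ∀ (e : T.E) (k : T.Piece familyOf) (he : familyOf (T.var e) = none),
          T.pieceOf familyOf e = k →
          marginalTraffics a τ (T.pieceFamily familyOf k) (T.pieceGraph familyOf k) =
            τ ((T.pieceGraph familyOf (T.pieceOf familyOf e)).relabel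
              fun l => toY ⟨l.1, l.2.trans he⟩) := by
        rintro e _ he rfl
        exact marginalTraffics_of_eq_none a τ he _
      exact key _ _ k.familyOf_out (pieceOf_out k.1)

end StarGraph

/-! ### Invariance and normalization of the limiting functional. -/

section Limits

variable {L : Type*} {τ : StarGraph L → ℂ} {Ω : ℕ → Type*} [∀ N, MeasurableSpace (Ω N)]
  {P : ∀ N, Measure (Ω N)} {A : ∀ N, Ω N → L → Matrix (Fin N) (Fin N) ℂ}

/-- The limit is an arbitrary function of graphs, with no invariance assumed. On cyclic graphs
uniqueness of limits forces it. -/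
theorem ConvergesInTraffics.eq_of_iso (h : ConvergesInTraffics P A τ) {S S' : StarGraph L}
    (hS : S'.IsCyclic) (i : S.Iso S') : τ S = τ S' := by
  have hS0 : S.IsCyclic := by
    refine StarGraph.Iso.isCyclic (T := S') ⟨i.v.symm, i.e.symm, fun x => ?_, fun x => ?_,
      fun x => ?_, fun x => ?_⟩ hS
    · obtain ⟨x, rfl⟩ := i.e.surjective x
      simp [i.src]
    · obtain ⟨x, rfl⟩ := i.e.surjective x
      simp [i.tgt]
    · obtain ⟨x, rfl⟩ := i.e.surjective x
      simp [i.var]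
    · obtain ⟨x, rfl⟩ := i.e.surjective x
      simp [i.star]
  refine tendsto_nhds_unique (h.2 S hS0) ((h.2 S' hS).congr fun N => ?_)
  simp only [StarGraph.injTrace_eq, i.injSum_eq]

/-- A connected graph without edges is a single vertex, so its injective trace is `N⁻¹ · N` for
every `N ≠ 0`. -/
theorem ConvergesInTraffics.eq_one_of_isEmpty [∀ N, IsProbabilityMeasure (P N)]
    (h : ConvergesInTraffics P A τ) {S : StarGraph L} (hS : S.IsCyclic) (hE : IsEmpty S.E) :
    τ S = 1 := by
  refine tendsto_nhds_unique (h.2 S hS) (tendsto_const_nhds.congr' ?_)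
  filter_upwards [eventually_ne_atTop 0] with N hN
  have hT := hS.1
  rw [StarGraph.IsTestGraph, StarGraph.skeleton_connected_iff] at hT
  have : Subsingleton S.V :=
    ⟨fun v w => edgeConn_le (r := ⊥) (fun e _ => (hE.false e).elim) (hT.2 v w)⟩
  have := hT.1
  have huniq : Nat.card (S.V ↪ Fin N) = N := by
    have e : (S.V ↪ Fin N) ≃ Fin N :=
      ⟨fun φ => φ (Classical.arbitrary _), fun i => ⟨fun _ => i, fun _ _ _ => Subsingleton.elim _ _⟩,
        fun φ => by ext v; exact congrArg (fun x => (φ x : ℕ)) (Subsingleton.elim _ _), fun _ => rfl⟩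
    rw [Nat.card_congr e, Nat.card_fin]
  have hw : ∀ ω, S.injTrace (A N ω) = 1 := fun ω => by
    have : ∀ φ : S.V → Fin N, S.weight (A N ω) φ = 1 := fun φ => Fintype.prod_empty _
    simp only [StarGraph.injTrace, this, Finset.sum_const, Finset.card_univ, nsmul_eq_mul, mul_one]
    rw [← Nat.card_eq_fintype_card, huniq, inv_mul_cancel₀ (Nat.cast_ne_zero.2 hN)]
  simp [hw]

end Limits

/-! ### Moments of words -/

/-- Here `φ` lists the intermediate indices of the matrix product; `cons` and `snoc` add the two
outer indices, giving the row and the column read by each factor. -/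
theorem Matrix.ofFn_prod_apply {R ι : Type*} [CommSemiring R] [Fintype ι] [DecidableEq ι] {n : ℕ}
    (f : Fin (n + 1) → Matrix ι ι R) (i j : ι) :
    (List.ofFn f).prod i j = ∑ φ : Fin n → ι, ∏ k, f k (Fin.cons (α := fun _ => ι) i φ k)
      (Fin.snoc (α := fun _ => ι) φ j k) := by
  induction n generalizing i with
  | zero => simp [Fin.snoc]
  | succ n ih =>
    rw [List.ofFn_succ, List.prod_cons, Matrix.mul_apply,
      ← Equiv.sum_comp (Fin.consEquiv fun _ : Fin (n + 1) => ι), Fintype.sum_prod_type]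
    refine Fintype.sum_congr _ _ fun m => ?_
    rw [ih, Finset.mul_sum]
    refine Fintype.sum_congr _ _ fun φ => ?_
    refine Eq.trans ?_ (Fin.prod_univ_succ _).symm
    simp only [Fin.consEquiv, Equiv.coe_fn_mk, ← Fin.cons_snoc_eq_snoc_cons, Fin.cons_zero,
      Fin.cons_succ]

/-- When the two outer indices coincide, the columns are the rows shifted cyclically: addition in
`Fin (n + 1)` wraps around at the last position. This is what makes a trace of a product a sum over
maps on an oriented cycle. -/
theorem Fin.snoc_eq_cons_add_one {ι : Type*} {n : ℕ} (φ : Fin n → ι) (i : ι) (k : Fin (n + 1)) :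
    Fin.snoc (α := fun _ => ι) φ i k = Fin.cons (α := fun _ => ι) i φ (k + 1) := by
  refine Fin.lastCases ?_ (fun k => ?_) k
  · simp
  · rw [Fin.snoc_castSucc, Fin.coeSucc_eq_succ, Fin.cons_succ]

theorem Matrix.trace_ofFn_prod {R ι : Type*} [CommSemiring R] [Fintype ι] [DecidableEq ι] {n : ℕ}
    (f : Fin (n + 1) → Matrix ι ι R) :
    (List.ofFn f).prod.trace = ∑ φ : Fin (n + 1) → ι, ∏ k, f k (φ k) (φ (k + 1)) := by
  rw [← Equiv.sum_comp (Fin.consEquiv fun _ : Fin (n + 1) => ι), Fintype.sum_prod_type,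
    Matrix.trace]
  refine Fintype.sum_congr _ _ fun i => ?_
  rw [Matrix.diag_apply, Matrix.ofFn_prod_apply]
  simp [Fin.consEquiv, Fin.snoc_eq_cons_add_one]

namespace StarGraph

variable {L : Type*}

theorem trace_ofWord {N : ℕ} (A : L → Matrix (Fin N) (Fin N) ℂ) (w : List (L × Bool)) :
    (ofWord w).trace A =
      (N : ℂ)⁻¹ * (w.map fun x => starPow (A x.1) x.2).prod.trace := by
  cases w with
  | nil =>
    rw [trace, List.map_nil, List.prod_nil, Matrix.trace_one]
    congr 1
    have h : ∀ φ : (ofWord ([] : List (L × Bool))).V → Fin N,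
        (ofWord ([] : List (L × Bool))).weight A φ = 1 :=
      fun _ => Finset.prod_eq_one fun x => x.elim
    simp only [h, Finset.sum_const, Finset.card_univ, nsmul_eq_mul, mul_one]
    refine congrArg Nat.cast ?_
    convert Fintype.card_congr (Equiv.funUnique Unit (Fin N))
    rfl
  | cons x w =>
    have h : (x :: w).map (fun x => starPow (A x.1) x.2) = List.ofFn fun k : Fin (w.length + 1) =>
        starPow (A ((x :: w).get k).1) ((x :: w).get k).2 := by
      conv_lhs => rw [← List.ofFn_get (x :: w), List.map_ofFn]
      rfl
    rw [h, Matrix.trace_ofFn_prod, trace]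
    congr 1
    refine Finset.sum_congr (Finset.ext fun φ => ?_) fun φ _ => rfl
    simp only [Finset.mem_univ]
    exact iff_of_true trivial (Fintype.complete (self := _) _)

theorem isCyclic_ofWord (w : List (L × Bool)) : (ofWord w).IsCyclic := by
  cases w with
  | nil =>
    refine ⟨?_, ?_⟩
    · rw [IsTestGraph, skeleton_connected_iff]
      exact ⟨⟨()⟩, fun v w => Setoid.refl' _ _⟩
    · have : IsEmpty (Fin (Fintype.card Empty)) := by
        rw [Fintype.card_empty]
        infer_instance
      exact ⟨(Equiv.equivOfIsEmpty _ Empty : Fin (Fintype.card Empty) ≃ Empty),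
        fun i => (this.false i).elim⟩
  | cons x w =>
    refine ⟨?_, ?_⟩
    · rw [IsTestGraph, skeleton_connected_iff]
      refine ⟨⟨(0 : Fin (w.length + 1))⟩, ?_⟩
      have h : ∀ k : Fin (w.length + 1), edgeConn (ofWord (x :: w)).src (ofWord (x :: w)).tgt
          Set.univ (0 : Fin (w.length + 1)) k := by
        intro k
        induction k using Fin.induction with
        | zero => exact Setoid.refl' _ _
        | succ k ih =>
          refine Setoid.trans' _ ih ?_
          have h1 := edgeConn_of_mem (s := (ofWord (x :: w)).src) (t := (ofWord (x :: w)).tgt)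
            (F := Set.univ) (e := k.castSucc) (Set.mem_univ _)
          rwa [show (ofWord (x :: w)).tgt k.castSucc = k.succ from Fin.coeSucc_eq_succ] at h1
      exact fun v v' => Setoid.trans' _ (Setoid.symm' _ (h v)) (h v')
    · have h : ∀ (m : ℕ) (h : m = w.length + 1) (i : Fin m),
          finCongr h i + 1 = finCongr h (finRotate m i) := by
        rintro _ rfl i
        simp
      exact ⟨finCongr (Fintype.card_fin (w.length + 1)), h _ (Fintype.card_fin (w.length + 1))⟩

theorem IsCyclic.quot {T : StarGraph L} (hT : T.IsCyclic) (σ : Setoid T.V) :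
    (T.quot σ).IsCyclic := by
  obtain ⟨h, c, hc⟩ := hT
  rw [IsTestGraph, skeleton_connected_iff] at h
  refine ⟨?_, c, fun i => congrArg (Quotient.mk σ) (hc i)⟩
  rw [IsTestGraph, skeleton_connected_iff]
  refine ⟨h.1.map (Quotient.mk σ), fun v w => ?_⟩
  obtain ⟨v, rfl⟩ := Quotient.mk_surjective v
  obtain ⟨w, rfl⟩ := Quotient.mk_surjective w
  exact edgeConn_map (Quotient.mk σ) (h.2 v w)

end StarGraph

theorem evalStarPoly_eq_sum {L : Type*} {N : ℕ} (A : L → Matrix (Fin N) (Fin N) ℂ)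
    (Q : FreeAlgebra ℂ (L × Bool)) :
    evalStarPoly A Q = (FreeAlgebra.equivMonoidAlgebraFreeMonoid Q).coeff.sum fun w c =>
      c • (w.toList.map fun x => starPow (A x.1) x.2).prod := by
  have h : evalStarPoly A = (MonoidAlgebra.lift ℂ (Matrix (Fin N) (Fin N) ℂ) (FreeMonoid (L × Bool))
      (FreeMonoid.lift fun x => starPow (A x.1) x.2)).comp
        (FreeAlgebra.equivMonoidAlgebraFreeMonoid : FreeAlgebra ℂ (L × Bool) ≃ₐ[ℂ] _).toAlgHom := by
    refine FreeAlgebra.hom_ext ?_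
    ext x : 1
    simp [evalStarPoly, FreeAlgebra.equivMonoidAlgebraFreeMonoid]
  rw [h]
  simp [MonoidAlgebra.lift_apply, FreeMonoid.lift_apply]

/-! ### From injective traces to plain traces and `*`-moments. -/

section Limits

variable {L : Type*} {τ : StarGraph L → ℂ} {Ω : ℕ → Type*} [∀ N, MeasurableSpace (Ω N)]
  {P : ∀ N, Measure (Ω N)} [∀ N, IsProbabilityMeasure (P N)]
  {A : ∀ N, Ω N → L → Matrix (Fin N) (Fin N) ℂ}

theorem HasAllMoments.integrable_trace (hA : HasAllMoments P A) (T : StarGraph L) (N : ℕ) :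
    Integrable (fun ω => T.trace (A N ω)) (P N) := by
  simp only [StarGraph.trace_eq_sum_quot]
  exact integrable_finsetSum _ fun σ _ => integrable_of_forall (hA.injTrace (T.quot σ) N)

theorem ConvergesInTraffics.tendsto_integral_trace (h : ConvergesInTraffics P A τ)
    {T : StarGraph L} (hT : T.IsCyclic) :
    Tendsto (fun N => ∫ ω, T.trace (A N ω) ∂(P N)) atTop (𝓝 (StarGraph.plainOfInj τ T)) := by
  refine (tendsto_finsetSum Finset.univ fun (σ : Setoid T.V) _ => h.2 _ (hT.quot σ)).congr
    fun N => ?_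
  rw [← integral_finsetSum _ fun σ _ => integrable_of_forall (h.1.injTrace (T.quot σ) N)]
  simp only [StarGraph.trace_eq_sum_quot]

theorem ConvergesInTraffics.hasLimitingStarDistribution (h : ConvergesInTraffics P A τ) :
    HasLimitingStarDistribution P A (starDistributionOf τ) := by
  refine ⟨h.1, fun Q => ?_⟩
  refine (tendsto_finsetSum (FreeAlgebra.equivMonoidAlgebraFreeMonoid Q).coeff.support fun w _ =>
    (h.tendsto_integral_trace (StarGraph.isCyclic_ofWord w.toList)).const_mul
      ((FreeAlgebra.equivMonoidAlgebraFreeMonoid Q).coeff w)).congr fun N => ?_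
  simp only [← integral_const_mul]
  rw [← integral_finsetSum _ fun w _ => (h.1.integrable_trace _ N).const_mul _]
  refine integral_congr_ae (Eventually.of_forall fun ω => ?_)
  simp only [StarGraph.trace_ofWord, evalStarPoly_eq_sum, Finsupp.sum, Matrix.trace_sum,
    Matrix.trace_smul, Finset.mul_sum, smul_eq_mul]
  exact Finset.sum_congr rfl fun w _ => by ring

end Limits

/-! ### The main theorem. -/

theorem hasAllMoments_sumElim {p q : ℕ} {a : Fin p → ℕ → ℝ} {Ω : ℕ → Type*}
    [∀ N, MeasurableSpace (Ω N)] {P : ∀ N, Measure (Ω N)} [∀ N, IsProbabilityMeasure (P N)]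
    {X : ∀ N, Ω N → Fin p → Matrix (Fin N) (Fin N) ℂ}
    {Y : ∀ N, Ω N → Fin q → Matrix (Fin N) (Fin N) ℂ}
    (hX : ∀ j, IsHeavyWigner P (fun N ω => X N ω j) (a j)) (hY : HasAllMoments P Y) :
    HasAllMoments P fun N ω => Sum.elim (X N ω) (Y N ω) := by
  rintro N (j | k) i i' r
  · obtain ⟨-, -, -, -, -, -, -, h⟩ := (hX j).exists_moments
    exact h N i i' r
  · exact hY N k i i' r

theorem theorem2p1 {p q : ℕ} (a : Fin p → ℕ → ℝ) (τY : StarGraph (Fin q) → ℂ)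
    {Ω : ℕ → Type*} [∀ N, MeasurableSpace (Ω N)] (P : ∀ N, Measure (Ω N))
    [∀ N, IsProbabilityMeasure (P N)]
    (X : ∀ N, Ω N → Fin p → Matrix (Fin N) (Fin N) ℂ)
    (Y : ∀ N, Ω N → Fin q → Matrix (Fin N) (Fin N) ℂ)
    (hX : ∀ j, IsHeavyWigner P (fun N ω => X N ω j) (a j))
    (hYmeas : ∀ N k (i j : Fin N), Measurable fun ω => Y N ω k i j)
    (hXindep : ∀ N, iIndepFun (fun (l : Fin p) ω (ij : Fin N × Fin N) => X N ω l ij.1 ij.2) (P N))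
    (hXY : ∀ N, IndepFun
      (fun ω (lij : Fin p × Fin N × Fin N) => X N ω lij.1 lij.2.1 lij.2.2)
      (fun ω (kij : Fin q × Fin N × Fin N) => Y N ω kij.1 kij.2.1 kij.2.2) (P N))
    (hY1 : ConvergesInTraffics P Y τY)
    (hY2 : TrafficConcentration P Y)
    (hY3 : TrafficGrowthBound P Y) :
    HasLimitingStarDistribution P (fun N ω => Sum.elim (X N ω) (Y N ω))
      (starDistributionOf (heavyWignerFreeProduct a τY)) ∧
    ConvergesInTraffics P (fun N ω => Sum.elim (X N ω) (Y N ω)) (heavyWignerFreeProduct a τY) ∧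
    ∀ T : StarGraph (Fin p ⊕ Fin q), T.IsCyclic →
      Tendsto (fun N => ∫ ω, T.trace (Sum.elim (X N ω) (Y N ω)) ∂(P N)) atTop
        (𝓝 (StarGraph.plainOfInj (heavyWignerFreeProduct a τY) T)) := by
  have hm := hasAllMoments_sumElim hX hY1.1
  have hconv : ConvergesInTraffics P (fun N ω => Sum.elim (X N ω) (Y N ω))
      (heavyWignerFreeProduct a τY) := by
    refine ⟨hm, fun T hT => ?_⟩
    obtain ⟨K, hK, hKO, hKlim⟩ := exists_edge_moments hX hYmeas hXindep hXY hY1.1 hm T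
    simp only [hK]
    -- Equality is the tree case, where both sides equal the same product. Otherwise connectedness
    -- leaves at most as many y-components as undirected edges, the expectation tends to zero, and
    -- the free product vanishes as well.
    by_cases hn : Nat.card (Quotient T.yGraph.conn) = Fintype.card T.UEdge + 1
    · rw [hT.1.heavyWignerFreeProduct_eq a hn (hT.fwd_eq_bwd hn)
        (fun S S' hS' i => hY1.eq_of_iso hS' i) (fun S hS hE => hY1.eq_one_of_isEmpty hS hE)
        (hT.isCyclic_component hn)]
      exact tendsto_of_card_eq hY1 hY2 hY3 hT hn hKlim
    · rw [StarGraph.heavyWignerFreeProduct_eq_zero hT.1 a τY hn]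
      have hle : Nat.card (Quotient T.yGraph.conn) ≤ Fintype.card T.UEdge :=
        Nat.lt_succ_iff.1 (lt_of_le_of_ne hT.1.card_components_le hn)
      exact tendsto_zero_of_card_le hY1.1 hY3 hT hle hKO
  exact ⟨hconv.hasLimitingStarDistribution, hconv, fun T hT => hconv.tendsto_integral_trace hT⟩
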